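/- **Gauß–Thomas formula.** Let $(M,\boldsymbol c)$ be a smooth conformal manifold (Riemannian signature) of dimension $d\ge 4$, let $\Sigma\hookrightarrow M$ be a smoothly embedded hypersurface with induced conformal class $\bar{\boldsymbol c}$, and put $\bar d=d-1$. Bars denote the intrinsic objects of $(\Sigma,\bar{\boldsymbol c})$. Let $w\in\mathbb R$ with $w+\tfrac d2\neq 1,\tfrac32,2$. Let $T$ be a smooth weight $w$ tractor tensor of arbitrary rank on $\Sigma$ and let $V$ be any smooth weight $w$ tractor tensor on $M$ extending $T$, where tractors of $\Sigma$ are identified with the tractors of $M$ along $\Sigma$ that are orthogonal to the normal tractor $N$. Then along $\Sigma$ $$ \hat D^T_A V\;=\;\hat{\bar D}_A T+\Gamma_A{}^\sharp T-\frac{X_A}{\bar d+2w-2}\Big\{2\,\Gamma_B{}^\sharp\circ\hat{\bar D}^B T+\Gamma^B{}^\sharp\circ\Gamma_B{}^\sharp T+\frac{1}{\bar d(\bar d-1)}\big[(\hat{\bar D}K)\wedge X\big]^\sharp T-\frac{(3\bar d+2)\,wK}{2\bar d(\bar d-1)}\,T\Big\}. $$ Here the following notation is used. In the splitting given by $g\in\boldsymbol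 c$ a standard tractor is $(t^+,t^a,t^-)\in\mathcal E[1]\oplus TM[-1]\oplus\mathcal E[-1]$. For $\Omega^2g$ it becomes $(t^+,\,t^a+\Upsilon^at^+,\,t^--\Upsilon\cdot t-\tfrac12|\Upsilon|^2t^+)$, where $\Upsilon=d\log\Omega$. The tractor metric is $h(t,t)=2t^+t^-+g(t,t)$ and $X=(0,0,1)$ is the canonical tractor. The tractor connection is $\nabla_a(t^+,t^b,t^-)=(\nabla_at^+-t_a,\ \nabla_at^b+\delta_a^bt^-+P_a{}^bt^+,\ \nabla_at^--P_{ab}t^b)$, where $P$ is the Schouten tensor and $J=\operatorname{tr}P$. On weight $w$ tractors $$\hat D^A V=\Big(wV,\ \nabla^a V,\ -\frac{(\Delta+wJ)V}{d+2w-2}\Big),$$ and $\hat{\bar D}$ is the same operator for $(\Sigma,\bar{\boldsymbol c})$. With $\hat n$ a unit normal, $\mathrm{II}=\nabla^\top\hat n$ the second fundamental form, $\bar d\,H=\bar g^{ab}\mathrm{II}_{ab}$ and $\mathring{\mathrm{II}}=\mathrm{II}-H\bar g$, set $N=(0,\hat n^a,-H)$ and $K=|\mathring{\mathrm{II}}|^2$.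 The tractor $(u^+,u^a,u^-)$ of $\Sigma$ is identified with $(u^+,\,u^a+H\hat n^au^+,\,u^--\tfrac12H^2u^+)$. The tangential Thomas-$D$ operator along $\Sigma$ is $$\hat D^T_A=\hat D_A-N_AN^B\hat D_B+\frac{X_A}{d+2w-3}\Big(N^BN^C\hat D_B\hat D_C+\frac{wK}{d-2}\Big),$$ where the entries of $N$ are not differentiated. Let $F_{ab}=P^\top_{ab}-\bar P_{ab}+H\mathring{\mathrm{II}}_{ab}+\tfrac12H^2\bar g_{ab}$ be the Fialkow tensor and $\mathring F$ its trace-free part. The tractor second fundamental form is $L=\bar q(\mathring{\mathrm{II}})$ (weight $-1$) and the Fialkow tractor is $F=\bar q(\mathring F)$ (weight $-2$). For a trace-free symmetric tensor $t_{ab}$ of weight $v+2$ on $\Sigma$, the symmetric weight $v$ tractor $T=\bar q(t)$ has $$T^{++}=T^{+a}=T^{+-}=0,\quad T^{ab}=t^{ab},\quad T^{a-}=-\frac{\bar\nabla_bt^{ba}}{\bar d+v},\quad T^{--}=\frac{\bar\nabla_a\bar\nabla_bt^{ab}+(\bar d+v)\bar P_{ab}t^{ab}}{(\bar d+v)(\bar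 d+v-1)}.$$ Finally, with $\bar h_{AB}=h_{AB}-N_AN_B$, $$\Gamma_{ABC}=2N_{[C}L_{B]A}+2X_{[C}F_{B]A}+\frac{K}{\bar d(\bar d-1)}X_{[C}\bar h_{B]A}.$$ A skew tractor $\Omega_{AB}$ acts by $\Omega^\sharp V^{AB\cdots}=\Omega^A{}_CV^{CB\cdots}+\Omega^B{}_CV^{AC\cdots}+\cdots$ on all the indices of what stands to its right. Also $u\wedge v=\tfrac12(u_Av_B-u_Bv_A)$ and $x_{[AB]}=\tfrac12(x_{AB}-x_{BA})$. For $d=4$ the slot $F^{--}$ may be given any value, since it drops out of $\Gamma$. For $d=7$ the operator $\hat{\bar D}$ is defined on the weight $-2$ density $K$ only modulo $X$, which is all that $(\hat{\bar D}K)\wedge X$ uses. -/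

import Mathlib

open scoped Manifold ContDiff

noncomputable section

namespace GaussThomas

/-! ## Riemannian geometry in coordinates

A metric on a coordinate domain is given by its matrix of components `G x i j = g_{ij}(x)`.
All formulas are local, so that values of the component functions away from the coordinate
domain are irrelevant. -/

/-- Coordinate space `ℝ^m`. -/
abbrev Coord (m : ℕ) := EuclideanSpace ℝ (Fin m)

/-- Component matrix of a metric, as a function of the coordinates. -/
abbrev MetricFun (m : ℕ) := Coord m → Matrix (Fin m) (Fin m) ℝ

section Riemannian

variable {m : ℕ}

/-- The coordinate derivative `∂_i f`. -/
def pd (i : Fin m) (f : Coord m → ℝ) (x : Coord m) : ℝ :=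
  fderiv ℝ f x (EuclideanSpace.single i 1)

/-- Christoffel symbols `Γ^k_{ij}` of the Levi-Civita connection. -/
def christoffel (G : MetricFun m) (k i j : Fin m) (x : Coord m) : ℝ :=
  1 / 2 * ∑ l, (G x)⁻¹ k l *
    (pd i (fun y => G y j l) x + pd j (fun y => G y i l) x - pd l (fun y => G y i j) x)

/-- Curvature `R_{ij}{}^k{}_l`, with `R(x,y)z = (∇_x∇_y - ∇_y∇_x - ∇_{[x,y]}) z`
and `R(x,y)z = x^i y^j R_{ij}{}^k{}_l z^l`. -/
def riemann (G : MetricFun m) (i j k l : Fin m) (x : Coord m) : ℝ :=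
  pd i (christoffel G k j l) x - pd j (christoffel G k i l) x
    + ∑ a, (christoffel G k i a x * christoffel G a j l x
      - christoffel G k j a x * christoffel G a i l x)

/-- Ricci tensor `Ric_{jl} = R_{kj}{}^k{}_l`. -/
def ricci (G : MetricFun m) (j l : Fin m) (x : Coord m) : ℝ :=
  ∑ k, riemann G k j k l x

/-- Scalar curvature. -/
def scal (G : MetricFun m) (x : Coord m) : ℝ :=
  ∑ j, ∑ l, (G x)⁻¹ j l * ricci G j l x

/-- Trace `J` of the Schouten tensor. -/
def schoutenTrace (G : MetricFun m) (x : Coord m) : ℝ :=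
  scal G x / (2 * ((m : ℝ) - 1))

/-- Schouten tensor `P_{ij}`, with `Ric = (m-2) P + J g` (used for `m ≥ 3`). -/
def schouten (G : MetricFun m) (i j : Fin m) (x : Coord m) : ℝ :=
  (ricci G i j x - schoutenTrace G x * G x i j) / ((m : ℝ) - 2)

/-- Levi-Civita derivative `∇_i η_j` of a one-form. -/
def nablaForm (G : MetricFun m) (η : Coord m → Fin m → ℝ) (i j : Fin m) (x : Coord m) : ℝ :=
  pd i (fun y => η y j) x - ∑ k, christoffel G k i j x * η x k

/-- Levi-Civita derivative `∇_i t_{jk}` of a covariant two-tensor. -/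
def nablaTwo (G : MetricFun m) (t : Coord m → Fin m → Fin m → ℝ) (i j k : Fin m)
    (x : Coord m) : ℝ :=
  pd i (fun y => t y j k) x
    - ∑ l, (christoffel G l i j x * t x l k + christoffel G l i k x * t x j l)

/-- Divergence `(∇·t)_k = g^{ij} ∇_i t_{jk}`. -/
def divTwo (G : MetricFun m) (t : Coord m → Fin m → Fin m → ℝ) (x : Coord m) (k : Fin m) : ℝ :=
  ∑ i, ∑ j, (G x)⁻¹ i j * nablaTwo G t i j k x

/-- Divergence `∇·η = g^{ij} ∇_i η_j`. -/
def divForm (G : MetricFun m) (η : Coord m → Fin m → ℝ) (x : Coord m) : ℝ :=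
  ∑ i, ∑ j, (G x)⁻¹ i j * nablaForm G η i j x

end Riemannian

/-! ## Tractor calculus in a choice of scale

In the splitting given by a metric `g`, a standard tractor is a triple `(t^+, t^a, t^-)`, i.e.
`t^+ Y + t^a Z_a + t^- X`. -/

/-- Slots of a standard tractor: `+` is `Sum.inl ()`, the coordinate `i` is `Sum.inr (Sum.inl i)`
and `-` is `Sum.inr (Sum.inr ())`. -/
abbrev TIdx (m : ℕ) := Unit ⊕ Fin m ⊕ Unit

/-- Components of a rank `r` tractor tensor with all its indices lowered, i.e. its values on the
injectors `Y, Z_i, X`. -/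
abbrev TTensor (m r : ℕ) := (Fin r → TIdx m) → ℝ

/-- A field of tractor components on coordinate space. -/
abbrev TField (m r : ℕ) := Coord m → TTensor m r

section Tractor

variable {m r : ℕ}

/-- The tractor metric `h_{AB}` for a metric with component matrix `A`;
the inverse tractor metric `h^{AB}` is `tractorMetric A⁻¹`. -/
def tractorMetric (A : Matrix (Fin m) (Fin m) ℝ) : TIdx m → TIdx m → ℝ
  | .inl _, .inr (.inr _) => 1
  | .inr (.inl i), .inr (.inl j) => A i j
  | .inr (.inr _), .inl _ => 1
  | _, _ => 0

/-- The canonical tractor with its index lowered: `X_A T^A = t^+`. -/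
def canonicalTractor : TIdx m → ℝ
  | .inl _ => 1
  | _ => 0

/-- Connection coefficients of the tractor connection:
`(∇_i T)^B = ∂_i T^B + (tractorConn G i B C) T^C` is
`(∇_i t^+ - t_i, ∇_i t^k + δ_i^k t^- + P_i^k t^+, ∇_i t^- - P_{ij} t^j)`. -/
def tractorConn (G : MetricFun m) (i : Fin m) (x : Coord m) : TIdx m → TIdx m → ℝ
  | .inl _, .inr (.inl j) => - G x i j
  | .inr (.inl k), .inl _ => ∑ l, (G x)⁻¹ k l * schouten G i l x
  | .inr (.inl k), .inr (.inl j) => christoffel G k i j x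
  | .inr (.inl k), .inr (.inr _) => if i = k then 1 else 0
  | .inr (.inr _), .inr (.inl j) => - schouten G i j x
  | _, _ => 0

/-- Tractor connection `∇_i V` on weighted tractor tensors (lowered indices, densities trivialized
by the scale). -/
def tractorNabla (G : MetricFun m) (i : Fin m) (V : TField m r) : TField m r := fun x β =>
  pd i (fun y => V y β) x
    - ∑ k, ∑ γ, tractorConn G i x γ (β k) * V x (Function.update β k γ)

/-- Tractor Laplacian `Δ = g^{ij} ∇_i ∇_j`, the outer `∇` being Levi-Civita coupled. -/
def tractorLaplacian (G : MetricFun m) (V : TField m r) : TField m r := fun x β =>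
  ∑ i, ∑ j, (G x)⁻¹ i j *
    (tractorNabla G i (tractorNabla G j V) x β
      - ∑ k, christoffel G k i j x * tractorNabla G k V x β)

/-- The hatted Thomas-D operator on weight `w` tractors,
`D̂_A V = w Y_A V + Z_A^i ∇_i V - X_A (Δ + w J) V / (m + 2w - 2)`; the new index comes first.
For `m + 2w = 2` the operator is only defined modulo `X_A`, and the value taken here is the
representative with vanishing `X_A` part. -/
def thomasHat (G : MetricFun m) (w : ℝ) (V : TField m r) : TField m (r + 1) := fun x β =>
  match β 0 with
  | .inl _ => - (tractorLaplacian G V x (Fin.tail β) + w * schoutenTrace G x * V x (Fin.tail β))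
      / ((m : ℝ) + 2 * w - 2)
  | .inr (.inl i) => tractorNabla G i V x (Fin.tail β)
  | .inr (.inr _) => w * V x (Fin.tail β)

/-- The action `Ω^♯` of a two-index tractor `Ω_{AB}` on tractor tensors,
`Ω^♯ V_{A B ⋯} = Ω_A{}^C V_{C B ⋯} + Ω_B{}^C V_{A C ⋯} + ⋯`; `hinv` is the inverse tractor
metric. -/
def sharp (hinv : TIdx m → TIdx m → ℝ) (Ω : TIdx m → TIdx m → ℝ) (V : TTensor m r) :
    TTensor m r := fun β =>
  ∑ k, ∑ C, ∑ D, Ω (β k) C * hinv C D * V (Function.update β k D)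

/-- `u ∧ v = ½ (u_A v_B - u_B v_A)`. -/
def wedge (u v : TIdx m → ℝ) (A B : TIdx m) : ℝ := 1 / 2 * (u A * v B - u B * v A)

/-- Insertion `q(t)` of a trace-free symmetric `t_{ab}` of weight `w + 2` into a weight `w`
tractor, with lowered indices. For `w = 1 - m` the component `q(t)(Y,Y)` is only defined up to an
arbitrary function, and the value taken here is zero. -/
def insertTwo (G : MetricFun m) (w : ℝ) (t : Coord m → Fin m → Fin m → ℝ) : TField m 2 :=
  fun x β => match β 0, β 1 with
  | .inr (.inl i), .inr (.inl j) => t x i j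
  | .inl _, .inr (.inl j) => - divTwo G t x j / ((m : ℝ) + w)
  | .inr (.inl i), .inl _ => - divTwo G t x i / ((m : ℝ) + w)
  | .inl _, .inl _ =>
      (divForm G (divTwo G t) x + ((m : ℝ) + w) *
        ∑ i, ∑ j, ∑ k, ∑ l, (G x)⁻¹ i k * (G x)⁻¹ j l * schouten G i j x * t x k l)
      / (((m : ℝ) + w) * ((m : ℝ) + w - 1))
  | _, _ => 0

end Tractor

/-! ## Hypersurfaces in adapted coordinates

`d = n + 1`, and the hypersurface `Σ` is `{x^0 = 0}` with coordinates `y^i = x^{i+1}`. -/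

section Hypersurface

variable {n r : ℕ}

/-- The inclusion `y ↦ (0, y)`. -/
def slice (y : Coord n) : Coord (n + 1) :=
  WithLp.toLp 2 (Fin.cons (0 : ℝ) (fun i => y i) : Fin (n + 1) → ℝ)

/-- The induced metric `ḡ`. -/
def inducedMetric (G : MetricFun (n + 1)) : MetricFun n := fun y =>
  Matrix.of fun i j => G (slice y) i.succ j.succ

/-- The conormal `n = dx^0 / |dx^0|_g`, which is the unit conormal of `Σ` together with an
extension of it off `Σ`. -/
def conormal (G : MetricFun (n + 1)) (x : Coord (n + 1)) (a : Fin (n + 1)) : ℝ :=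
  if a = 0 then 1 / Real.sqrt ((G x)⁻¹ 0 0) else 0

/-- The unit normal `n^a` along `Σ`. -/
def normal (G : MetricFun (n + 1)) (y : Coord n) (a : Fin (n + 1)) : ℝ :=
  ∑ b, (G (slice y))⁻¹ a b * conormal G (slice y) b

/-- Second fundamental form `II_{ij} = (∇_i n_j)^⊤`. -/
def secondFF (G : MetricFun (n + 1)) (y : Coord n) (i j : Fin n) : ℝ :=
  nablaForm G (conormal G) i.succ j.succ (slice y)

/-- Mean curvature `H = ḡ^{ij} II_{ij} / (d - 1)`. -/
def meanCurv (G : MetricFun (n + 1)) (y : Coord n) : ℝ :=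
  (∑ i, ∑ j, (inducedMetric G y)⁻¹ i j * secondFF G y i j) / n

/-- Trace-free second fundamental form `II - H ḡ`. -/
def tfSecondFF (G : MetricFun (n + 1)) (y : Coord n) (i j : Fin n) : ℝ :=
  secondFF G y i j - meanCurv G y * inducedMetric G y i j

/-- Rigidity density `K`, the squared length of the trace-free second fundamental form. -/
def rigidity (G : MetricFun (n + 1)) (y : Coord n) : ℝ :=
  ∑ i, ∑ j, ∑ k, ∑ l, (inducedMetric G y)⁻¹ i k * (inducedMetric G y)⁻¹ j l *
    tfSecondFF G y i j * tfSecondFF G y k l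

/-- Fialkow tensor `F = P^⊤ - P̄ + H (II - H ḡ) + ½ H² ḡ`. -/
def fialkow (G : MetricFun (n + 1)) (y : Coord n) (i j : Fin n) : ℝ :=
  schouten G i.succ j.succ (slice y) - schouten (inducedMetric G) i j y
    + meanCurv G y * tfSecondFF G y i j + 1 / 2 * meanCurv G y ^ 2 * inducedMetric G y i j

/-- Trace-free Fialkow tensor. -/
def tfFialkow (G : MetricFun (n + 1)) (y : Coord n) (i j : Fin n) : ℝ :=
  fialkow G y i j
    - (∑ k, ∑ l, (inducedMetric G y)⁻¹ k l * fialkow G y k l) / n * inducedMetric G y i j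

/-- Tractor second fundamental form `L`. -/
def tractorL (G : MetricFun (n + 1)) : TField n 2 :=
  insertTwo (inducedMetric G) (-1) (tfSecondFF G)

/-- Fialkow tractor `F`. -/
def tractorF (G : MetricFun (n + 1)) : TField n 2 :=
  insertTwo (inducedMetric G) (-2) (tfFialkow G)

/-- Normal tractor `N^A = (0, n^a, -H)`. -/
def normalTractor (G : MetricFun (n + 1)) (y : Coord n) : TIdx (n + 1) → ℝ
  | .inl _ => 0
  | .inr (.inl a) => normal G y a
  | .inr (.inr _) => - meanCurv G y

/-- Normal tractor `N_A` with its index lowered. -/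
def normalTractorLow (G : MetricFun (n + 1)) (y : Coord n) (A : TIdx (n + 1)) : ℝ :=
  ∑ B, tractorMetric (G (slice y)) A B * normalTractor G y B

/-- The orthogonal projection of the ambient tractor bundle along `Σ` onto `N^⊥`, followed by the
canonical isomorphism of `N^⊥` with the tractor bundle of `Σ`, in the scales `g` and `ḡ`:
`(v^+, v^a, v^-) ↦ (v^+, v^a - n^a n·v, v^- + H n·v - ½ H² v^+)`.
The inverse isomorphism is `(u^+, u^a, u^-) ↦ (u^+, u^a + H n^a u^+, u^- - ½ H² u^+)`. -/
def tractorProj (G : MetricFun (n + 1)) (y : Coord n) : TIdx n → TIdx (n + 1) → ℝ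
  | .inl _, .inl _ => 1
  | .inr (.inl i), .inr (.inl a) =>
      (if i.succ = a then 1 else 0) - normal G y i.succ * conormal G (slice y) a
  | .inr (.inr _), .inl _ => - (1 / 2) * meanCurv G y ^ 2
  | .inr (.inr _), .inr (.inl a) => meanCurv G y * conormal G (slice y) a
  | .inr (.inr _), .inr (.inr _) => 1
  | _, _ => 0

/-- A tractor tensor of `Σ` at `y`, viewed as an ambient tractor tensor (annihilated by `N` in
every slot). -/
def ambient (G : MetricFun (n + 1)) (y : Coord n) (t : TTensor n r) : TTensor (n + 1) r :=
  fun α => ∑ β : Fin r → TIdx n, (∏ k, tractorProj G y (β k) (α k)) * t β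

/-- The tractor
`Γ_{ABC} = 2 N_{[C} L_{B]A} + 2 X_{[C} F_{B]A} + K / (d̄ (d̄ - 1)) X_{[C} h̄_{B]A}`. -/
def gammaTractor (G : MetricFun (n + 1)) (y : Coord n) (A B C : TIdx (n + 1)) : ℝ :=
  let N := normalTractorLow G y
  let X : TIdx (n + 1) → ℝ := canonicalTractor
  let L := fun A B => ambient G y (tractorL G y) ![A, B]
  let F := fun A B => ambient G y (tractorF G y) ![A, B]
  let hbar := fun A B => tractorMetric (G (slice y)) A B - N A * N B
  (N C * L B A - N B * L C A) + (X C * F B A - X B * F C A)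
    + rigidity G y / ((n : ℝ) * (n - 1)) * (1 / 2 * (X C * hbar B A - X B * hbar C A))

/-- The tangential Thomas-D operator, evaluated along `Σ`,
`D̂^T_A V = D̂_A V - N_A N^B D̂_B V
  + X_A / (d + 2w - 3) (N^B N^C D̂_B D̂_C V + w K / (d - 2) V)`.
The normal tractor is not differentiated, so that no extension of it off `Σ` is involved. -/
def tangentialThomas (G : MetricFun (n + 1)) (w : ℝ) (V : TField (n + 1) r) (y : Coord n) :
    TTensor (n + 1) (r + 1) := fun α =>
  let d : ℝ := n + 1
  let A := α 0
  let β : Fin r → TIdx (n + 1) := Fin.tail α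
  let N := normalTractor G y
  let DV := thomasHat G w V
  let DDV := thomasHat G (w - 1) DV
  DV (slice y) (Fin.cons A β)
    - normalTractorLow G y A * ∑ B, N B * DV (slice y) (Fin.cons B β)
    + canonicalTractor A / (d + 2 * w - 3) *
      ((∑ B, ∑ C, N B * N C * DDV (slice y) (Fin.cons B (Fin.cons C β)))
        + w * rigidity G y / (d - 2) * V (slice y) β)

/-- The right-hand side of the Gauß–Thomas formula for a weight `w` tractor `T` of `Σ`:
`D̂̄_A T + Γ_A^♯ T - X_A / (d̄ + 2w - 2) { 2 Γ_B^♯ ∘ D̂̄^B T + Γ^B^♯ ∘ Γ_B^♯ T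
  + 1 / (d̄ (d̄ - 1)) [(D̂̄ K) ∧ X]^♯ T - (3 d̄ + 2) w K / (2 d̄ (d̄ - 1)) T }`. -/
def gaussThomas (G : MetricFun (n + 1)) (w : ℝ) (T : TField n r) (y : Coord n) :
    TTensor (n + 1) (r + 1) := fun α =>
  let A := α 0
  let β : Fin r → TIdx (n + 1) := Fin.tail α
  let X : TIdx (n + 1) → ℝ := canonicalTractor
  let hinv := tractorMetric (G (slice y))⁻¹
  let Γ := gammaTractor G y
  let K := rigidity G y
  let t := ambient G y (T y)
  let Dt := ambient G y (thomasHat (inducedMetric G) w T y)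
  let Γt : TTensor (n + 1) (r + 1) := fun γ => sharp hinv (Γ (γ 0)) t (Fin.tail γ)
  let DK := fun B =>
    ambient G y (thomasHat (inducedMetric G) (-2) (fun z (_ : Fin 0 → TIdx n) => rigidity G z) y)
      ![B]
  Dt (Fin.cons A β) + Γt (Fin.cons A β)
    - X A / ((n : ℝ) + 2 * w - 2) *
      (2 * (∑ B, ∑ C, hinv B C * sharp hinv (Γ B) Dt (Fin.cons C β))
        + (∑ B, ∑ C, hinv B C * sharp hinv (Γ B) Γt (Fin.cons C β))
        + 1 / ((n : ℝ) * (n - 1)) * sharp hinv (wedge DK X) t β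
        - (3 * (n : ℝ) + 2) * w * K / (2 * n * (n - 1)) * t β)

end Hypersurface

/-! ## Conformal manifolds and weighted tractor fields -/

section Manifold

variable {m : ℕ} {M : Type*} [TopologicalSpace M] [ChartedSpace (Coord m) M]
  [IsManifold (𝓡 m) ∞ M]

/-- Smooth Riemannian metrics on `M`. -/
abbrev RMetric (m : ℕ) (M : Type*) [TopologicalSpace M] [ChartedSpace (Coord m) M]
    [IsManifold (𝓡 m) ∞ M] :=
  Bundle.ContMDiffRiemannianMetric (𝓡 m) ∞ (Coord m) (fun p : M => TangentSpace (𝓡 m) p)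

/-- `g' = Ω² g` with `Ω` smooth and positive. -/
structure IsRescaling (g g' : RMetric m M) (Ω : M → ℝ) : Prop where
  smooth : ContMDiff (𝓡 m) 𝓘(ℝ, ℝ) ∞ Ω
  pos : ∀ p, 0 < Ω p
  eq : ∀ p (u v : TangentSpace (𝓡 m) p), g'.inner p u v = Ω p ^ 2 * g.inner p u v

/-- The differential `dΩ` of a function, as a number `dΩ(v)`. -/
def differential (Ω : M → ℝ) (p : M) (v : TangentSpace (𝓡 m) p) : ℝ :=
  mfderiv (𝓡 m) 𝓘(ℝ, ℝ) Ω p v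

/-- A conformal class of Riemannian metrics. -/
structure ConformalClass (m : ℕ) (M : Type*) [TopologicalSpace M] [ChartedSpace (Coord m) M]
    [IsManifold (𝓡 m) ∞ M] where
  metrics : Set (RMetric m M)
  nonempty : metrics.Nonempty
  mem_iff : ∀ g ∈ metrics, ∀ g', g' ∈ metrics ↔ ∃ Ω, IsRescaling g g' Ω

/-- The standard tractor fibre `ℝ ⊕ T_p M ⊕ ℝ` at `p` in a choice of splitting. -/
abbrev TractorFibre (m : ℕ) {M : Type*} [TopologicalSpace M] [ChartedSpace (Coord m) M] (p : M) :=
  ℝ × TangentSpace (𝓡 m) p × ℝ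

/-- The change of splitting from `g` to `Ω² g`: a tractor that is `(t^+, t^a, t^-)` for `g` is
`(Ω t^+, Ω⁻¹ (t^a + Υ^a t^+), Ω⁻¹ (t^- - Υ·t - ½ |Υ|² t^+))` for `Ω² g`, the powers of `Ω` being
the weights of `E[1] ⊕ TM[-1] ⊕ E[-1]`. Here `a = Ω(p)` and `u = Υ^a` is the `g`-gradient of
`log Ω` at `p`. -/
def changeSplitting (g : RMetric m M) (p : M) (a : ℝ) (u : TangentSpace (𝓡 m) p)
    (t : TractorFibre m p) : TractorFibre m p :=
  (a * t.1, a⁻¹ • (t.2.1 + t.1 • u),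
    a⁻¹ * (t.2.2 - g.inner p u t.2.1 - 1 / 2 * g.inner p u u * t.1))

/-- The injectors `Y, Z_i, X` at the point with coordinates `x` in the chart `φ`. -/
def injector (φ : OpenPartialHomeomorph M (Coord m)) (x : Coord m) :
    TIdx m → TractorFibre m (φ.symm x)
  | .inl _ => (1, 0, 0)
  | .inr (.inl i) => (0, mfderiv (𝓡 m) (𝓡 m) φ.symm x (EuclideanSpace.single i (1 : ℝ)), 0)
  | .inr (.inr _) => (0, 0, 1)

/-- Components `g_{ij}` of a metric in a chart. -/
def RMetric.comp (g : RMetric m M) (φ : OpenPartialHomeomorph M (Coord m)) : MetricFun m :=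
  fun x => Matrix.of fun i j =>
    g.inner (φ.symm x)
      (mfderiv (𝓡 m) (𝓡 m) φ.symm x (EuclideanSpace.single i (1 : ℝ)))
      (mfderiv (𝓡 m) (𝓡 m) φ.symm x (EuclideanSpace.single j (1 : ℝ)))

/-- Components in a chart of a field of multilinear forms on the tractor fibres. -/
def formComp {r : ℕ} (t : ∀ p : M, MultilinearMap ℝ (fun _ : Fin r => TractorFibre m p) ℝ)
    (φ : OpenPartialHomeomorph M (Coord m)) : TField m r :=
  fun x β => t (φ.symm x) fun k => injector φ x (β k)

/-- Smooth weight `w` tractor tensors of rank `r` on `(M, c)`, with indices lowered by the tractor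
metric: a family of multilinear forms on the tractor fibres, one for each scale, with the
transformation law of a weight `w` tractor. -/
structure TractorField (c : ConformalClass m M) (r : ℕ) (w : ℝ) where
  form : c.metrics → ∀ p : M, MultilinearMap ℝ (fun _ : Fin r => TractorFibre m p) ℝ
  conformal : ∀ (g g' : c.metrics) (Ω : M → ℝ), IsRescaling g.1 g'.1 Ω →
    ∀ (p : M) (u : TangentSpace (𝓡 m) p),
      (∀ v : TangentSpace (𝓡 m) p,
        g.1.inner p u v = (Ω p)⁻¹ * differential Ω p v) →
      ∀ t : Fin r → TractorFibre m p,
        form g' p (fun k => changeSplitting g.1 p (Ω p) u (t k)) = Ω p ^ w * form g p t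
  smooth : ∀ (g : c.metrics), ∀ φ ∈ IsManifold.maximalAtlas (𝓡 m) ∞ M, ∀ β,
    ContDiffOn ℝ ∞ (fun x => formComp (form g) φ x β) φ.target

/-- Components of a tractor field in the scale `g` and the chart `φ`. -/
def TractorField.comp {c : ConformalClass m M} {r : ℕ} {w : ℝ} (T : TractorField c r w)
    (g : c.metrics) (φ : OpenPartialHomeomorph M (Coord m)) : TField m r :=
  formComp (T.form g) φ

end Manifold

/-! ## Conformally embedded hypersurfaces -/

section Embedding

variable {n : ℕ} {M S : Type*} [TopologicalSpace M] [ChartedSpace (Coord (n + 1)) M]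
  [IsManifold (𝓡 (n + 1)) ∞ M] [TopologicalSpace S] [ChartedSpace (Coord n) S]
  [IsManifold (𝓡 n) ∞ S]

/-- `ḡ` is the metric induced on `S` by `g` and `ι`. -/
def IsInducedMetric (ι : S → M) (g : RMetric (n + 1) M) (gbar : RMetric n S) : Prop :=
  ∀ (p : S) (u v : TangentSpace (𝓡 n) p),
    gbar.inner p u v =
      g.inner (ι p) (mfderiv (𝓡 n) (𝓡 (n + 1)) ι p u) (mfderiv (𝓡 n) (𝓡 (n + 1)) ι p v)

/-- `c̄` is the conformal class on `S` induced by `c` and `ι`. -/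
def IsInducedClass (ι : S → M) (c : ConformalClass (n + 1) M) (cbar : ConformalClass n S) : Prop :=
  ∀ g ∈ c.metrics, ∃ gbar ∈ cbar.metrics, IsInducedMetric ι g gbar

/-- Smooth charts `φ` of `M` and `ψ` of `S` in which `ι` is `y ↦ (0, y)`. The unit conormal of
the hypersurface is taken in the direction of increasing `x^0`; the opposite choice is obtained
by reflecting `x^0`. -/
structure IsAdapted (ι : S → M) (φ : OpenPartialHomeomorph M (Coord (n + 1)))
    (ψ : OpenPartialHomeomorph S (Coord n)) : Prop where
  mem_left : φ ∈ IsManifold.maximalAtlas (𝓡 (n + 1)) ∞ M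
  mem_right : ψ ∈ IsManifold.maximalAtlas (𝓡 n) ∞ S
  maps : ∀ p ∈ ψ.source, ι p ∈ φ.source
  eq_slice : ∀ p ∈ ψ.source, φ (ι p) = slice (ψ p)

/-- Adapted charts exist around every point of an embedded hypersurface. -/
theorem exists_isAdapted (ι : S → M)
    (hι : Manifold.IsSmoothEmbedding (𝓡 n) (𝓡 (n + 1)) ∞ ι) (p : S) :
    ∃ (φ : OpenPartialHomeomorph M (Coord (n + 1))) (ψ : OpenPartialHomeomorph S (Coord n)), IsAdapted ι φ ψ ∧ p ∈ ψ.source := by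
  have h : Manifold.IsImmersionAt (𝓡 n) (𝓡 (n + 1)) ∞ ι p := hι.isImmersion.isImmersionAt p
  obtain ⟨Λ, hΛ⟩ : ∃ Λ : Coord (n + 1) ≃L[ℝ] Coord (n + 1), ∀ u, Λ (h.equiv (u, 0)) = slice u := by
    let σ : Coord n →ₗ[ℝ] Coord (n + 1) :=
      { toFun := slice
        map_add' := fun u v => by
          ext i; refine Fin.cases ?_ (fun j => ?_) i <;> simp [slice]
        map_smul' := fun a v => by
          ext i; refine Fin.cases ?_ (fun j => ?_) i <;> simp [slice] }
    have hσ : Function.Injective σ := fun u v huv => by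
      ext j
      have := congrArg (fun z : Coord (n + 1) => z j.succ) huv
      simpa [σ, slice] using this
    let τ : Coord n →ₗ[ℝ] Coord (n + 1) :=
      h.equiv.toLinearEquiv.toLinearMap ∘ₗ LinearMap.inl ℝ (Coord n) h.complement
    have hτ : Function.Injective τ := h.equiv.injective.comp LinearMap.inl_injective
    let e : LinearMap.range τ ≃ₗ[ℝ] LinearMap.range σ :=
      (LinearEquiv.ofInjective τ hτ).symm.trans (LinearEquiv.ofInjective σ hσ)
    obtain ⟨Λ, hΛ⟩ := Submodule.exists_linearEquiv_restrict_eq e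
    refine ⟨Λ.toContinuousLinearEquiv, fun u => ?_⟩
    have h1 := hΛ (LinearEquiv.ofInjective τ hτ u)
    have h2 : e (LinearEquiv.ofInjective τ hτ u) = LinearEquiv.ofInjective σ hσ u := by
      simp [e]
    rw [h2] at h1
    exact h1.symm
  let Φ : OpenPartialHomeomorph (Coord (n + 1)) (Coord (n + 1)) :=
    Λ.toHomeomorph.toOpenPartialHomeomorph
  have hΦ : Φ ∈ contDiffGroupoid ∞ (𝓡 (n + 1)) := by
    rw [contDiffGroupoid, mem_groupoid_of_pregroupoid]
    refine ⟨?_, ?_⟩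
    · exact (Λ.contDiff (n := ∞)).contDiffOn
    · exact (Λ.symm.contDiff (n := ∞)).contDiffOn
  refine ⟨h.codChart.trans Φ, h.domChart, ⟨?_, h.domChart_mem_maximalAtlas, ?_, ?_⟩,
    h.mem_domChart_source⟩
  · rw [IsManifold.mem_maximalAtlas_iff, mem_maximalAtlas_iff]
    intro e' he'
    have hc := h.codChart_mem_maximalAtlas
    rw [IsManifold.mem_maximalAtlas_iff, mem_maximalAtlas_iff] at hc
    obtain ⟨h1, h2⟩ := hc e' he'
    constructor
    · have := (contDiffGroupoid ∞ (𝓡 (n + 1))).trans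
        ((contDiffGroupoid ∞ (𝓡 (n + 1))).symm hΦ) h1
      simpa [OpenPartialHomeomorph.trans_symm_eq_symm_trans_symm,
        OpenPartialHomeomorph.trans_assoc] using this
    · have := (contDiffGroupoid ∞ (𝓡 (n + 1))).trans h2 hΦ
      simpa [OpenPartialHomeomorph.trans_assoc] using this
  · intro q hq
    have := h.source_subset_preimage_source hq
    simpa [Φ] using this
  · intro q hq
    have hm : h.domChart q ∈ (h.domChart.extend (𝓡 n)).target := by
      simpa using h.domChart.map_source hq
    have := h.writtenInCharts hm
    have hl : h.codChart (ι q) = h.equiv (h.domChart q, 0) := by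
      simpa [h.domChart.left_inv hq] using this
    change Λ (h.codChart (ι q)) = _
    rw [hl, hΛ]

/-- The tractor field `V` of `M` is an extension of the tractor field `T` of the hypersurface:
along the hypersurface, `V` equals `T` under the identification of hypersurface tractors with
ambient tractors orthogonal to the normal tractor. -/
def IsExtension (ι : S → M) {c : ConformalClass (n + 1) M} {cbar : ConformalClass n S}
    {r : ℕ} {w : ℝ} (T : TractorField cbar r w) (V : TractorField c r w) : Prop :=
  ∀ (g : c.metrics) (gbar : cbar.metrics), IsInducedMetric ι g.1 gbar.1 →
    ∀ φ ψ, IsAdapted ι φ ψ → ∀ y ∈ ψ.target,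
      V.comp g φ (slice y) = ambient (g.1.comp φ) y (T.comp gbar ψ y)

end Embedding

end GaussThomas

end

open GaussThomas

noncomputable section

open scoped Matrix

set_option linter.unusedSectionVars false

namespace GaussThomas

/-! ## Calculus of coordinate derivatives -/

section Calculus

variable {m : ℕ} {f g : Coord m → ℝ} {x : Coord m}

/-! Everything is local: in adapted charts and a fixed scale the claim concerns a metric `G` on an
open set and component functions `V`, `T` that match along the slice. That local version is
`MetricOn.tangentialThomas_eq_gaussThomas`; the manifold enters only through smoothness and
positivity of components (`metricOn_comp`).

The heart is a tractor Gauss formula. The identification of tractors of Σ with `N^⊥` (matrix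
`projM`, dual frame `frameM`) is not parallel for the ambient tractor connection. Its defect in the
direction `∂_i` is `Γ_i = L_i ∧ N + F_i ∧ X` (here without the factor ½ in `∧`), where `F` includes
the pure trace part `κ h̄`, `κ = K / (2n(n-1))`. This is checked entry by entry in
`MetricOn.mpd_frameM` and `MetricOn.vpd_normalTractor`, from the Gauss and Weingarten formulas, the
traced Codazzi equation (`MetricOn.sum_schouten_mul_normal`) and the definition of the Fialkow
tensor, whose trace `nκ` comes from the traced Gauss equation (`MetricOn.trace_fialkow`). Hence `∇ -
Γ^♯` (matrix `tildeM`) makes the identification, `N` and the tractor metric parallel, and `∇_i V =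
∇̄_i T + Γ_i^♯ T` along Σ (`MetricOn.covS_pull`). This settles every slot of the formula except the
one carrying the Laplacian.

For that slot the Gauss formula is applied twice and traced. The Laplacian of `V` along Σ becomes
`Δ̄T + 2 Γ^{i♯} ∇̄_i T + Γ^{i♯} Γ_i^♯ T + (∇^i Γ_i)^♯ T`, and the divergence is `-(n-2) Γ_Y + (D̂̄K
∧ X) / (2n(n-1))`, again without the ½ (`MetricOn.sum_mpd_gam`). The latter holds because the
insertion `q` is normalised to have divergence proportional to its own `Y` column. On the left-hand
side the correction `N^B N^C D̂_B D̂_C` cancels all normal derivatives of `V`, so only the Laplacian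
along Σ and zeroth order terms survive (`MetricOn.tangentialThomas_inl`).

On the right-hand side `X^A Γ_A = 0` reduces the contractions to tangential ones and a single `Γ_Y`
term, while the action of `Γ_B` on the contracted index itself contributes `(n+1) κ`
(`MetricOn.sum_sharp_gammaTractor`). With `E = n + 2w - 2` the comparison comes down to `1 - 2w/E =
(n-2)/E` for the `Γ_Y` terms and `2(n+1) - (3n+2) = -n` for the multiples of `wK`. -/

theorem pd_congr (i : Fin m) (h : f =ᶠ[nhds x] g) : pd i f x = pd i g x := by
  unfold pd; rw [h.fderiv_eq]

/-- Identities between metric quantities hold only on the chart domain; openness is what allows them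
to be differentiated. -/
theorem pd_congr_of_eqOn {U : Set (Coord m)} (hU : IsOpen U) (hx : x ∈ U)
    (h : ∀ y ∈ U, f y = g y) (i : Fin m) : pd i f x = pd i g x :=
  pd_congr i (Filter.eventuallyEq_of_mem (hU.mem_nhds hx) h)

theorem diffAt (hf : ContDiffAt ℝ ∞ f x) : DifferentiableAt ℝ f x :=
  hf.differentiableAt (by simp)

theorem pd_const (i : Fin m) (a : ℝ) : pd i (fun _ => a) x = 0 := by
  simp [pd]

theorem pd_add (i : Fin m) (hf : ContDiffAt ℝ ∞ f x) (hg : ContDiffAt ℝ ∞ g x) :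
    pd i (fun y => f y + g y) x = pd i f x + pd i g x := by
  unfold pd; rw [fderiv_fun_add (diffAt hf) (diffAt hg)]; rfl

theorem pd_sub (i : Fin m) (hf : ContDiffAt ℝ ∞ f x) (hg : ContDiffAt ℝ ∞ g x) :
    pd i (fun y => f y - g y) x = pd i f x - pd i g x := by
  unfold pd; rw [fderiv_fun_sub (diffAt hf) (diffAt hg)]; rfl

theorem pd_neg (i : Fin m) : pd i (fun y => - f y) x = - pd i f x := by
  unfold pd; rw [fderiv_fun_neg]; rfl

theorem pd_mul (i : Fin m) (hf : ContDiffAt ℝ ∞ f x) (hg : ContDiffAt ℝ ∞ g x) :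
    pd i (fun y => f y * g y) x = pd i f x * g x + f x * pd i g x := by
  unfold pd; rw [fderiv_fun_mul (diffAt hf) (diffAt hg)]
  simp only [_root_.add_apply, _root_.smul_apply, smul_eq_mul]
  ring

theorem pd_const_mul (i : Fin m) (a : ℝ) (hf : ContDiffAt ℝ ∞ f x) :
    pd i (fun y => a * f y) x = a * pd i f x := by
  rw [pd_mul i contDiffAt_const hf, pd_const, zero_mul, zero_add]

theorem pd_div_const (i : Fin m) (a : ℝ) (hf : ContDiffAt ℝ ∞ f x) :
    pd i (fun y => f y / a) x = pd i f x / a := by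
  simp only [div_eq_mul_inv]
  rw [pd_mul i hf contDiffAt_const, pd_const, mul_zero, add_zero]

theorem pd_sum {ι : Type*} (s : Finset ι) {F : ι → Coord m → ℝ} (i : Fin m)
    (hF : ∀ a ∈ s, ContDiffAt ℝ ∞ (F a) x) :
    pd i (fun y => ∑ a ∈ s, F a y) x = ∑ a ∈ s, pd i (F a) x := by
  unfold pd; rw [fderiv_fun_sum (fun a ha => diffAt (hF a ha))]
  simp

theorem contDiffAt_pd (i : Fin m) (hf : ContDiffAt ℝ ∞ f x) : ContDiffAt ℝ ∞ (pd i f) x :=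
  (hf.fderiv_right (m := ∞) (by simp)).clm_apply contDiffAt_const

theorem contDiffAt_finsum {ι : Type*} {s : Finset ι} {F : ι → Coord m → ℝ}
    (hF : ∀ a ∈ s, ContDiffAt ℝ ∞ (F a) x) : ContDiffAt ℝ ∞ (fun y => ∑ a ∈ s, F a y) x :=
  ContDiffAt.sum hF

theorem pd_comm (i j : Fin m) (hf : ContDiffAt ℝ ∞ f x) : pd i (pd j f) x = pd j (pd i f) x := by
  have hs : IsSymmSndFDerivAt ℝ f x := hf.isSymmSndFDerivAt (by
    simpa using (WithTop.coe_le_coe.2 le_top : ((2 : ℕ∞) : ℕ∞ω) ≤ ((⊤ : ℕ∞) : ℕ∞ω)))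
  have hd : DifferentiableAt ℝ (fderiv ℝ f) x :=
    (hf.fderiv_right (m := ∞) (by simp)).differentiableAt (by simp)
  have key : ∀ k l : Fin m, pd k (pd l f) x
      = fderiv ℝ (fderiv ℝ f) x (EuclideanSpace.single k 1) (EuclideanSpace.single l 1) := by
    intro k l
    have : pd k (pd l f) x
        = fderiv ℝ (fun y => fderiv ℝ f y (EuclideanSpace.single l 1)) x
          (EuclideanSpace.single k 1) := rfl
    rw [this, fderiv_clm_apply hd (differentiableAt_const _)]
    simp
  rw [key, key, hs.eq]

/-- Cramer's rule: determinant and adjugate are polynomial in the entries, and the determinant does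
not vanish at the point. -/
theorem contDiffAt_inv {k : ℕ} {B : Coord m → Matrix (Fin k) (Fin k) ℝ}
    (hB : ∀ i j, ContDiffAt ℝ ∞ (fun y => B y i j) x) (hdet : (B x).det ≠ 0) (i j : Fin k) :
    ContDiffAt ℝ ∞ (fun y => (B y)⁻¹ i j) x := by
  have hd : ∀ C : Coord m → Matrix (Fin k) (Fin k) ℝ,
      (∀ i j, ContDiffAt ℝ ∞ (fun y => C y i j) x) → ContDiffAt ℝ ∞ (fun y => (C y).det) x := by
    intro C hC
    simp only [Matrix.det_apply']
    exact ContDiffAt.sum fun σ _ => contDiffAt_const.mul (contDiffAt_prod fun l _ => hC _ _)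
  simp only [Matrix.inv_def, Ring.inverse_eq_inv', Matrix.smul_apply, smul_eq_mul]
  refine (hd B hB).inv hdet |>.mul ?_
  simp only [Matrix.adjugate_apply]
  refine hd _ fun a b => ?_
  by_cases h : a = j
  · subst h; simpa using contDiffAt_const
  · simpa [Matrix.updateRow_ne h] using hB a b

end Calculus

/-! ### Matrix-valued and vector-valued functions -/

section MatrixCalculus

variable {m : ℕ} {I J K : Type*} {x : Coord m}

/-- Entrywise smoothness of a matrix-valued function. -/
def MSmooth (A : Coord m → Matrix I J ℝ) (x : Coord m) : Prop :=
  ∀ a b, ContDiffAt ℝ ∞ (fun y => A y a b) x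

/-- Entrywise coordinate derivative of a matrix-valued function. -/
def mpd (i : Fin m) (A : Coord m → Matrix I J ℝ) (x : Coord m) : Matrix I J ℝ :=
  Matrix.of fun a b => pd i (fun y => A y a b) x

/-- Entrywise smoothness of a vector-valued function. -/
def VSmooth (u : Coord m → I → ℝ) (x : Coord m) : Prop :=
  ∀ a, ContDiffAt ℝ ∞ (fun y => u y a) x

/-- Entrywise coordinate derivative of a vector-valued function. -/
def vpd (i : Fin m) (u : Coord m → I → ℝ) (x : Coord m) : I → ℝ :=
  fun a => pd i (fun y => u y a) x

theorem MSmooth.mul [Fintype J] {A : Coord m → Matrix I J ℝ} {B : Coord m → Matrix J K ℝ}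
    (hA : MSmooth A x) (hB : MSmooth B x) : MSmooth (fun y => A y * B y) x := fun a b => by
  simp only [Matrix.mul_apply]
  exact ContDiffAt.sum fun c _ => (hA a c).mul (hB c b)

theorem MSmooth.add {A B : Coord m → Matrix I J ℝ} (hA : MSmooth A x) (hB : MSmooth B x) :
    MSmooth (fun y => A y + B y) x := fun a b => (hA a b).add (hB a b)

theorem MSmooth.sub {A B : Coord m → Matrix I J ℝ} (hA : MSmooth A x) (hB : MSmooth B x) :
    MSmooth (fun y => A y - B y) x := fun a b => (hA a b).sub (hB a b)

theorem MSmooth.transpose {A : Coord m → Matrix I J ℝ} (hA : MSmooth A x) :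
    MSmooth (fun y => (A y)ᵀ) x := fun a b => hA b a

theorem MSmooth.mulVec [Fintype J] {A : Coord m → Matrix I J ℝ} {u : Coord m → J → ℝ}
    (hA : MSmooth A x) (hu : VSmooth u x) : VSmooth (fun y => A y *ᵥ u y) x := fun a => by
  simp only [Matrix.mulVec, dotProduct]
  exact ContDiffAt.sum fun c _ => (hA a c).mul (hu c)

theorem VSmooth.vecMulVec {u : Coord m → I → ℝ} {v : Coord m → J → ℝ}
    (hu : VSmooth u x) (hv : VSmooth v x) :
    MSmooth (fun y => Matrix.vecMulVec (u y) (v y)) x := fun a b => (hu a).mul (hv b)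

theorem MSmooth.mpd {A : Coord m → Matrix I J ℝ} (hA : MSmooth A x) (i : Fin m) :
    MSmooth (fun y => mpd i A y) x := fun a b => contDiffAt_pd i (hA a b)

theorem mpd_mul [Fintype J] {A : Coord m → Matrix I J ℝ} {B : Coord m → Matrix J K ℝ}
    (hA : MSmooth A x) (hB : MSmooth B x) (i : Fin m) :
    mpd i (fun y => A y * B y) x = mpd i A x * B x + A x * mpd i B x := by
  ext a b
  simp only [mpd, Matrix.of_apply, Matrix.mul_apply, Matrix.add_apply]
  rw [pd_sum _ _ fun c _ => (hA a c).mul (hB c b), ← Finset.sum_add_distrib]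
  exact Finset.sum_congr rfl fun c _ => pd_mul i (hA a c) (hB c b)

theorem mpd_add {A B : Coord m → Matrix I J ℝ} (hA : MSmooth A x) (hB : MSmooth B x) (i : Fin m) :
    mpd i (fun y => A y + B y) x = mpd i A x + mpd i B x := by
  ext a b; exact pd_add i (hA a b) (hB a b)

theorem mpd_sub {A B : Coord m → Matrix I J ℝ} (hA : MSmooth A x) (hB : MSmooth B x) (i : Fin m) :
    mpd i (fun y => A y - B y) x = mpd i A x - mpd i B x := by
  ext a b; exact pd_sub i (hA a b) (hB a b)

theorem mpd_transpose (A : Coord m → Matrix I J ℝ) (i : Fin m) :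
    mpd i (fun y => (A y)ᵀ) x = (mpd i A x)ᵀ := rfl

theorem mpd_const (A : Matrix I J ℝ) (i : Fin m) : mpd i (fun _ => A) x = 0 := by
  ext a b; exact pd_const i _

theorem mpd_congr_of_eqOn {A B : Coord m → Matrix I J ℝ} {U : Set (Coord m)} (hU : IsOpen U)
    (hx : x ∈ U) (h : ∀ y ∈ U, A y = B y) (i : Fin m) : mpd i A x = mpd i B x := by
  ext a b; exact pd_congr_of_eqOn hU hx (fun y hy => by rw [h y hy]) i

theorem mpd_vecMulVec {u : Coord m → I → ℝ} {v : Coord m → J → ℝ} (hu : VSmooth u x)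
    (hv : VSmooth v x) (i : Fin m) :
    mpd i (fun y => Matrix.vecMulVec (u y) (v y)) x
      = Matrix.vecMulVec (vpd i u x) (v x) + Matrix.vecMulVec (u x) (vpd i v x) := by
  ext a b; exact pd_mul i (hu a) (hv b)

theorem vpd_mulVec [Fintype J] {A : Coord m → Matrix I J ℝ} {u : Coord m → J → ℝ} (hA : MSmooth A x)
    (hu : VSmooth u x) (i : Fin m) :
    vpd i (fun y => A y *ᵥ u y) x = mpd i A x *ᵥ u x + A x *ᵥ vpd i u x := by
  ext a
  simp only [vpd, mpd, Matrix.mulVec, dotProduct, Pi.add_apply, Matrix.of_apply]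
  rw [pd_sum _ _ fun c _ => (hA a c).mul (hu c), ← Finset.sum_add_distrib]
  exact Finset.sum_congr rfl fun c _ => pd_mul i (hA a c) (hu c)

theorem pd_dotProduct [Fintype I] {u v : Coord m → I → ℝ} (hu : VSmooth u x) (hv : VSmooth v x) (i : Fin m) :
    pd i (fun y => u y ⬝ᵥ v y) x = vpd i u x ⬝ᵥ v x + u x ⬝ᵥ vpd i v x := by
  simp only [vpd, dotProduct]
  rw [pd_sum _ _ fun c _ => (hu c).mul (hv c), ← Finset.sum_add_distrib]
  exact Finset.sum_congr rfl fun c _ => pd_mul i (hu c) (hv c)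

end MatrixCalculus

/-! ## The Levi-Civita connection and its curvature -/

section Metric

variable {m : ℕ}

/-- Smooth Riemannian metrics on an open set of coordinate space. -/
structure MetricOn (G : MetricFun m) (U : Set (Coord m)) : Prop where
  isOpen : IsOpen U
  posDef : ∀ x ∈ U, (G x).PosDef
  smooth : ∀ x ∈ U, MSmooth G x

/-- The matrix `(Γ_i)^k_j` of Christoffel symbols. -/
def chris (G : MetricFun m) (i : Fin m) (x : Coord m) : Matrix (Fin m) (Fin m) ℝ :=
  Matrix.of fun k j => christoffel G k i j x

/-- The curvature matrix `(R_{ij})^k_l`. -/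
def curv (G : MetricFun m) (i j : Fin m) (x : Coord m) : Matrix (Fin m) (Fin m) ℝ :=
  mpd i (chris G j) x - mpd j (chris G i) x + (chris G i x * chris G j x - chris G j x * chris G i x)

/-- Puts the curvature in the form `dΓ + [Γ, Γ]`, so that its symmetries become matrix identities.
-/
theorem riemann_eq_curv (G : MetricFun m) (i j k l : Fin m) (x : Coord m) :
    riemann G i j k l x = curv G i j x k l := by
  simp only [riemann, curv, Matrix.add_apply, Matrix.sub_apply, Matrix.mul_apply, mpd,
    Matrix.of_apply, chris, Finset.sum_sub_distrib]

variable {G : MetricFun m} {U : Set (Coord m)} {x : Coord m}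

namespace MetricOn

theorem symm (hG : MetricOn G U) (hx : x ∈ U) : (G x)ᵀ = G x := by
  simpa using (hG.posDef x hx).isHermitian.eq

theorem symm_apply (hG : MetricOn G U) (hx : x ∈ U) (i j : Fin m) : G x i j = G x j i := by
  conv_lhs => rw [← hG.symm hx]
  rfl

theorem det_ne (hG : MetricOn G U) (hx : x ∈ U) : (G x).det ≠ 0 := (hG.posDef x hx).det_pos.ne'

theorem mul_inv (hG : MetricOn G U) (hx : x ∈ U) : G x * (G x)⁻¹ = 1 :=
  Matrix.mul_nonsing_inv _ (isUnit_iff_ne_zero.2 (hG.det_ne hx))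

theorem inv_mul (hG : MetricOn G U) (hx : x ∈ U) : (G x)⁻¹ * G x = 1 :=
  Matrix.nonsing_inv_mul _ (isUnit_iff_ne_zero.2 (hG.det_ne hx))

theorem inv_symm (hG : MetricOn G U) (hx : x ∈ U) : ((G x)⁻¹)ᵀ = (G x)⁻¹ := by
  rw [Matrix.transpose_nonsing_inv, hG.symm hx]

theorem inv_symm_apply (hG : MetricOn G U) (hx : x ∈ U) (i j : Fin m) :
    (G x)⁻¹ i j = (G x)⁻¹ j i := by
  conv_lhs => rw [← hG.inv_symm hx]
  rfl

theorem inv_smooth (hG : MetricOn G U) (hx : x ∈ U) : MSmooth (fun y => (G y)⁻¹) x :=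
  fun a b => contDiffAt_inv (hG.smooth x hx) (hG.det_ne hx) a b

theorem chris_smooth (hG : MetricOn G U) (hx : x ∈ U) (i : Fin m) : MSmooth (chris G i) x := by
  intro k j
  have h := hG.smooth x hx
  refine contDiffAt_const.mul (ContDiffAt.sum fun l _ => (hG.inv_smooth hx k l).mul ?_)
  exact ((contDiffAt_pd _ (h _ _)).add (contDiffAt_pd _ (h _ _))).sub (contDiffAt_pd _ (h _ _))

theorem christoffel_smooth (hG : MetricOn G U) (hx : x ∈ U) (k i j : Fin m) :
    ContDiffAt ℝ ∞ (fun y => christoffel G k i j y) x := hG.chris_smooth hx i k j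

theorem christoffel_symm (hG : MetricOn G U) (hx : x ∈ U) (k i j : Fin m) :
    christoffel G k i j x = christoffel G k j i x := by
  simp only [christoffel]
  congr 1
  refine Finset.sum_congr rfl fun l _ => ?_
  rw [pd_congr_of_eqOn hG.isOpen hx (fun y hy => hG.symm_apply hy i j) l]
  ring

/-- Christoffel symbols of the first kind. -/
theorem mul_chris (hG : MetricOn G U) (hx : x ∈ U) (i k j : Fin m) :
    (G x * chris G i x) k j = 1 / 2 *
      (pd i (fun y => G y j k) x + pd j (fun y => G y i k) x - pd k (fun y => G y i j) x) := by
  let c : Fin m → ℝ := fun l =>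
    pd i (fun y => G y j l) x + pd j (fun y => G y i l) x - pd l (fun y => G y i j) x
  have h1 : ∀ a, chris G i x a j = 1 / 2 * ((G x)⁻¹ *ᵥ c) a := fun a => rfl
  have h2 : G x *ᵥ ((G x)⁻¹ *ᵥ c) = c := by
    rw [Matrix.mulVec_mulVec, hG.mul_inv hx, Matrix.one_mulVec]
  have h3 : (G x * chris G i x) k j = 1 / 2 * (G x *ᵥ ((G x)⁻¹ *ᵥ c)) k := by
    simp only [Matrix.mul_apply, h1]
    conv_rhs => rw [Matrix.mulVec, dotProduct]
    rw [Finset.mul_sum]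
    exact Finset.sum_congr rfl fun a _ => by ring
  rw [h3, h2]

/-- Metric compatibility. -/
theorem mpd_metric (hG : MetricOn G U) (hx : x ∈ U) (i : Fin m) :
    mpd i G x = (chris G i x)ᵀ * G x + G x * chris G i x := by
  have h : (chris G i x)ᵀ * G x = (G x * chris G i x)ᵀ := by
    rw [Matrix.transpose_mul, hG.symm hx]
  ext j k
  rw [h, Matrix.add_apply, Matrix.transpose_apply, hG.mul_chris hx, hG.mul_chris hx]
  rw [pd_congr_of_eqOn hG.isOpen hx (fun y hy => hG.symm_apply hy k j) i]
  simp only [mpd, Matrix.of_apply]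
  ring

/-- Obtained by differentiating `G G⁻¹ = 1`, inserting metric compatibility and solving. -/
theorem mpd_inv (hG : MetricOn G U) (hx : x ∈ U) (i : Fin m) :
    mpd i (fun y => (G y)⁻¹) x = - (chris G i x * (G x)⁻¹) - (G x)⁻¹ * (chris G i x)ᵀ := by
  have h : mpd i (fun y => G y * (G y)⁻¹) x = 0 := by
    rw [mpd_congr_of_eqOn hG.isOpen hx (fun y hy => hG.mul_inv hy), mpd_const]
  rw [mpd_mul (hG.smooth x hx) (hG.inv_smooth hx), hG.mpd_metric hx] at h
  have h2 : (G x)⁻¹ * (((chris G i x)ᵀ * G x + G x * chris G i x) * (G x)⁻¹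
      + G x * mpd i (fun y => (G y)⁻¹) x) = 0 := by rw [h, mul_zero]
  have e1 : (G x)⁻¹ * (((chris G i x)ᵀ * G x + G x * chris G i x) * (G x)⁻¹
      + G x * mpd i (fun y => (G y)⁻¹) x)
      = (G x)⁻¹ * (chris G i x)ᵀ * (G x * (G x)⁻¹) + ((G x)⁻¹ * G x) * chris G i x * (G x)⁻¹
        + ((G x)⁻¹ * G x) * mpd i (fun y => (G y)⁻¹) x := by noncomm_ring
  rw [e1, hG.mul_inv hx, hG.inv_mul hx, mul_one, one_mul, one_mul] at h2
  rw [← sub_eq_zero, ← h2]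
  abel

/-- Second partial derivatives of the metric commute. Expanding both by metric compatibility, the
difference is exactly the symmetric part of the lowered curvature. -/
theorem curv_skew (hG : MetricOn G U) (hx : x ∈ U) (i j : Fin m) :
    (G x * curv G i j x)ᵀ = - (G x * curv G i j x) := by
  have hs := hG.smooth x hx
  have hc := fun k => hG.chris_smooth hx k
  have second : ∀ k l, mpd k (fun y => mpd l G y) x
      = (mpd k (chris G l) x)ᵀ * G x + (chris G l x)ᵀ * ((chris G k x)ᵀ * G x + G x * chris G k x)
        + (((chris G k x)ᵀ * G x + G x * chris G k x) * chris G l x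
        + G x * mpd k (chris G l) x) := by
    intro k l
    rw [mpd_congr_of_eqOn hG.isOpen hx (fun y hy => hG.mpd_metric hy l),
      mpd_add ((hc l).transpose.mul hs) (hs.mul (hc l)), mpd_mul (hc l).transpose hs,
      mpd_mul hs (hc l), hG.mpd_metric hx k, mpd_transpose]
  have hcomm : mpd i (fun y => mpd j G y) x = mpd j (fun y => mpd i G y) x := by
    ext a b; exact pd_comm i j (hs a b)
  rw [second, second] at hcomm
  rw [Matrix.transpose_mul, hG.symm hx, eq_neg_iff_add_eq_zero, curv]
  simp only [Matrix.transpose_add, Matrix.transpose_sub, Matrix.transpose_mul]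
  rw [← sub_eq_zero] at hcomm
  rw [← hcomm]
  noncomm_ring

theorem curv_antisymm (i j : Fin m) : curv G j i x = - curv G i j x := by
  simp only [curv]; abel

/-- Torsion-freeness: after exchanging the lower indices of the Christoffel symbols all terms cancel
in pairs. -/
theorem curv_bianchi (hG : MetricOn G U) (hx : x ∈ U) (i j k l : Fin m) :
    curv G i j x k l + curv G j l x k i + curv G l i x k j = 0 := by
  have hp : ∀ a b c : Fin m, pd a (fun y => christoffel G k b c y) x
      = pd a (fun y => christoffel G k c b y) x := fun a b c =>
    pd_congr_of_eqOn hG.isOpen hx (fun y hy => hG.christoffel_symm hy k b c) a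
  have hp' : ∀ a b c : Fin m, ∑ e, christoffel G k a e x * christoffel G e b c x
      = ∑ e, christoffel G k a e x * christoffel G e c b x := fun a b c =>
    Finset.sum_congr rfl fun e _ => by rw [hG.christoffel_symm hx e b c]
  simp only [← riemann_eq_curv, riemann, Finset.sum_sub_distrib]
  rw [hp i j l, hp j l i, hp l i j, hp' i j l, hp' j l i, hp' l i j]
  ring

theorem trace_curv (hG : MetricOn G U) (hx : x ∈ U) (i j : Fin m) :
    (curv G i j x).trace = 0 := by
  have h1 : curv G i j x = (G x)⁻¹ * (G x * curv G i j x) := by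
    rw [← mul_assoc, hG.inv_mul hx, one_mul]
  have h2 : (curv G i j x).trace = - (curv G i j x).trace := by
    conv_lhs => rw [h1, ← Matrix.trace_transpose, Matrix.transpose_mul, hG.curv_skew hx,
      hG.inv_symm hx, Matrix.neg_mul, Matrix.trace_neg, Matrix.trace_mul_comm, ← mul_assoc,
      hG.inv_mul hx, one_mul]
  linarith

/-- Tracing the Bianchi identity gives `Ric_{jl} - Ric_{lj}` plus the trace of a curvature
endomorphism, and that trace is zero by skewness. -/
theorem ricci_symm (hG : MetricOn G U) (hx : x ∈ U) (j l : Fin m) :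
    ricci G j l x = ricci G l j x := by
  have h := hG.trace_curv hx j l
  simp only [Matrix.trace, Matrix.diag] at h
  have hb : ∑ k, (curv G k j x k l + curv G j l x k k + curv G l k x k j) = 0 :=
    Finset.sum_eq_zero fun k _ => hG.curv_bianchi hx k j k l
  have ha : ∀ k, curv G l k x k j = - curv G k l x k j := fun k => by
    rw [curv_antisymm]; rfl
  simp only [Finset.sum_add_distrib, ha, Finset.sum_neg_distrib, h] at hb
  simp only [ricci, riemann_eq_curv]
  linarith

theorem curv_smooth (hG : MetricOn G U) (hx : x ∈ U) (i j : Fin m) : MSmooth (curv G i j) x :=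
  ((((hG.chris_smooth hx j).mpd i).sub ((hG.chris_smooth hx i).mpd j)).add
    (((hG.chris_smooth hx i).mul (hG.chris_smooth hx j)).sub
      ((hG.chris_smooth hx j).mul (hG.chris_smooth hx i))))

theorem ricci_smooth (hG : MetricOn G U) (hx : x ∈ U) (i j : Fin m) :
    ContDiffAt ℝ ∞ (fun y => ricci G i j y) x := by
  simp only [ricci, riemann_eq_curv]
  exact ContDiffAt.sum fun k _ => hG.curv_smooth hx k i k j

theorem schoutenTrace_smooth (hG : MetricOn G U) (hx : x ∈ U) :
    ContDiffAt ℝ ∞ (fun y => schoutenTrace G y) x := by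
  simp only [schoutenTrace, scal]
  exact (ContDiffAt.sum fun j _ => ContDiffAt.sum fun l _ =>
    (hG.inv_smooth hx j l).mul (hG.ricci_smooth hx j l)).div_const _

theorem schouten_smooth (hG : MetricOn G U) (hx : x ∈ U) (i j : Fin m) :
    ContDiffAt ℝ ∞ (fun y => schouten G i j y) x := by
  simp only [schouten]
  exact ((hG.ricci_smooth hx i j).sub
    ((hG.schoutenTrace_smooth hx).mul (hG.smooth x hx i j))).div_const _

theorem schouten_symm (hG : MetricOn G U) (hx : x ∈ U) (i j : Fin m) :
    schouten G i j x = schouten G j i x := by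
  simp only [schouten, hG.ricci_symm hx i j, hG.symm_apply hx i j]

end MetricOn

end Metric

/-! ## Hypersurface geometry in adapted coordinates -/

section Slice

variable {n : ℕ}

/-- The inclusion of the slice as a continuous linear map. -/
def sliceL (n : ℕ) : Coord n →L[ℝ] Coord (n + 1) :=
  LinearMap.toContinuousLinearMap
    { toFun := slice
      map_add' := fun u v => by
        ext i; refine Fin.cases ?_ (fun j => ?_) i <;> simp [slice]
      map_smul' := fun a v => by
        ext i; refine Fin.cases ?_ (fun j => ?_) i <;> simp [slice] }

theorem sliceL_apply (y : Coord n) : sliceL n y = slice y := rfl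

theorem contDiff_slice : ContDiff ℝ ∞ (slice : Coord n → Coord (n + 1)) := (sliceL n).contDiff

theorem slice_single (i : Fin n) :
    slice (EuclideanSpace.single i (1 : ℝ)) = EuclideanSpace.single i.succ 1 := by
  ext a
  refine Fin.cases ?_ (fun j => ?_) a
  · simp [slice, (Fin.succ_ne_zero i).symm]
  · simp [slice]

theorem isOpen_preimage_slice {U : Set (Coord (n + 1))} (hU : IsOpen U) :
    IsOpen (slice ⁻¹' U : Set (Coord n)) := hU.preimage contDiff_slice.continuous

theorem contDiffAt_comp_slice {f : Coord (n + 1) → ℝ} {y : Coord n}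
    (hf : ContDiffAt ℝ ∞ f (slice y)) : ContDiffAt ℝ ∞ (fun z => f (slice z)) y :=
  ContDiffAt.comp y hf contDiff_slice.contDiffAt

theorem pd_comp_slice {f : Coord (n + 1) → ℝ} {y : Coord n} (i : Fin n)
    (hf : ContDiffAt ℝ ∞ f (slice y)) :
    pd i (fun z => f (slice z)) y = pd i.succ f (slice y) := by
  have h := (diffAt hf).hasFDerivAt.comp y ((sliceL n).hasFDerivAt (x := y))
  have h' : fderiv ℝ (fun z => f (slice z)) y = (fderiv ℝ f (slice y)).comp (sliceL n) := h.fderiv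
  rw [pd, h', ContinuousLinearMap.comp_apply, sliceL_apply, slice_single]
  rfl

end Slice

/-! ### The Gauss and Weingarten formulas in adapted coordinates -/

section Hypersurface

variable {n : ℕ} {G : MetricFun (n + 1)} {U : Set (Coord (n + 1))} {y : Coord n}

theorem conormal_succ (x : Coord (n + 1)) (i : Fin n) : conormal G x i.succ = 0 := by
  simp [conormal, Fin.succ_ne_zero]

theorem sum_conormal_mul (x : Coord (n + 1)) (v : Fin (n + 1) → ℝ) :
    ∑ a, conormal G x a * v a = conormal G x 0 * v 0 := by
  simp [Fin.sum_univ_succ, conormal_succ]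

theorem normal_eq (y : Coord n) (a : Fin (n + 1)) :
    normal G y a = (G (slice y))⁻¹ a 0 * conormal G (slice y) 0 := by
  simp [normal, Fin.sum_univ_succ, conormal_succ]

namespace MetricOn

theorem induced (hG : MetricOn G U) : MetricOn (inducedMetric G) (slice ⁻¹' U) where
  isOpen := isOpen_preimage_slice hG.isOpen
  posDef := fun _ hy => (hG.posDef _ hy).submatrix (Fin.succ_injective n)
  smooth := fun _ hy i j => contDiffAt_comp_slice (hG.smooth _ hy i.succ j.succ)

theorem inv_zero_pos (hG : MetricOn G U) {x : Coord (n + 1)} (hx : x ∈ U) : 0 < (G x)⁻¹ 0 0 :=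
  (hG.posDef x hx).inv.diag_pos

theorem conormal_zero_pos (hG : MetricOn G U) {x : Coord (n + 1)} (hx : x ∈ U) :
    0 < conormal G x 0 := by
  simp only [conormal, if_true]
  exact one_div_pos.2 (Real.sqrt_pos.2 (hG.inv_zero_pos hx))

theorem conormal_mul_normal (hG : MetricOn G U) (hy : slice y ∈ U) :
    conormal G (slice y) 0 * normal G y 0 = 1 := by
  rw [normal_eq]
  simp only [conormal, if_true]
  have h := hG.inv_zero_pos hy
  have h2 := Real.mul_self_sqrt h.le
  have h3 := (Real.sqrt_pos.2 h).ne'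
  field_simp
  nlinarith

theorem metric_mulVec_normal (hG : MetricOn G U) (hy : slice y ∈ U) :
    G (slice y) *ᵥ normal G y = conormal G (slice y) := by
  have : normal G y = (G (slice y))⁻¹ *ᵥ conormal G (slice y) := rfl
  rw [this, Matrix.mulVec_mulVec, hG.mul_inv hy, Matrix.one_mulVec]

theorem metric_normal (hG : MetricOn G U) (hy : slice y ∈ U) (a : Fin (n + 1)) :
    ∑ b, G (slice y) a b * normal G y b = conormal G (slice y) a :=
  congrFun (hG.metric_mulVec_normal hy) a

/-- The conormal is a multiple of `dx^0`, so the zeroth column of the inverse metric is a multiple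
of the normal; the factor is fixed by the normalisation of `n`. -/
theorem inv_zero (hG : MetricOn G U) (hy : slice y ∈ U) (a : Fin (n + 1)) :
    (G (slice y))⁻¹ a 0 = normal G y a * normal G y 0 := by
  have h := hG.conormal_mul_normal hy
  calc (G (slice y))⁻¹ a 0 = (G (slice y))⁻¹ a 0 * (conormal G (slice y) 0 * normal G y 0) := by
        rw [h, mul_one]
    _ = _ := by rw [← mul_assoc, ← normal_eq]

/-- Block inversion: subtracting `n^i n^j` compensates for the index `0` missing from the tangential
sum, because the lowered normal has no tangential components. -/
theorem inv_succ_succ (hG : MetricOn G U) (hy : slice y ∈ U) (i j : Fin n) :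
    (G (slice y))⁻¹ i.succ j.succ
      = (inducedMetric G y)⁻¹ i j + normal G y i.succ * normal G y j.succ := by
  have key : (inducedMetric G y)⁻¹ = Matrix.of fun i j : Fin n =>
      (G (slice y))⁻¹ i.succ j.succ - normal G y i.succ * normal G y j.succ := by
    refine Matrix.inv_eq_right_inv ?_
    ext k l
    have h1 : ∑ a, G (slice y) k.succ a * (G (slice y))⁻¹ a l.succ
        = (1 : Matrix (Fin (n + 1)) (Fin (n + 1)) ℝ) k.succ l.succ := by
      rw [← hG.mul_inv hy, Matrix.mul_apply]
    have h2 := hG.metric_normal hy k.succ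
    rw [Fin.sum_univ_succ] at h1 h2
    rw [conormal_succ] at h2
    rw [hG.inv_symm_apply hy 0 l.succ, hG.inv_zero hy] at h1
    simp only [Matrix.mul_apply, Matrix.of_apply, mul_sub, Finset.sum_sub_distrib, inducedMetric]
    have h3 : ∑ a : Fin n, G (slice y) k.succ a.succ * (normal G y a.succ * normal G y l.succ)
        = (∑ a : Fin n, G (slice y) k.succ a.succ * normal G y a.succ) * normal G y l.succ := by
      rw [Finset.sum_mul]; exact Finset.sum_congr rfl fun _ _ => by ring
    have h4 : (1 : Matrix (Fin (n + 1)) (Fin (n + 1)) ℝ) k.succ l.succ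
        = (1 : Matrix (Fin n) (Fin n) ℝ) k l := by
      simp [Matrix.one_apply]
    rw [h3, ← h4, ← h1]
    linear_combination (- normal G y l.succ) * h2
  rw [key]; simp

/-- The decomposition `g⁻¹ = ḡ⁻¹ + n ⊗ n`, by which ambient traces are split into tangential and
normal parts. -/
theorem sum_inv_mul (hG : MetricOn G U) (hy : slice y ∈ U) (f : Fin (n + 1) → Fin (n + 1) → ℝ) :
    ∑ a, ∑ b, (G (slice y))⁻¹ a b * f a b
      = ∑ i, ∑ j, (inducedMetric G y)⁻¹ i j * f (Fin.succ i) (Fin.succ j)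
        + ∑ a, ∑ b, normal G y a * normal G y b * f a b := by
  simp only [Fin.sum_univ_succ (n := n), hG.inv_zero hy, hG.inv_symm_apply hy 0 (Fin.succ _),
    hG.inv_succ_succ hy, add_mul, Finset.sum_add_distrib]
  have h : ∀ i : Fin n, normal G y i.succ * normal G y 0 * f 0 i.succ
      = normal G y 0 * normal G y i.succ * f 0 i.succ := fun i => by ring
  simp only [h]
  ring

theorem conormal_smooth (hG : MetricOn G U) {x : Coord (n + 1)} (hx : x ∈ U)
    (a : Fin (n + 1)) : ContDiffAt ℝ ∞ (fun z => conormal G z a) x := by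
  unfold conormal
  by_cases h : a = 0
  · simp only [h, if_true]
    exact contDiffAt_const.div ((hG.inv_smooth hx 0 0).sqrt (hG.inv_zero_pos hx).ne')
      (Real.sqrt_pos.2 (hG.inv_zero_pos hx)).ne'
  · simp only [h, if_false]
    exact contDiffAt_const

theorem conormal_slice_smooth (hG : MetricOn G U) (hy : slice y ∈ U) :
    VSmooth (fun z : Coord n => conormal G (slice z)) y := fun a =>
  contDiffAt_comp_slice (hG.conormal_smooth hy a)

theorem normal_smooth (hG : MetricOn G U) (hy : slice y ∈ U) : VSmooth (normal G) y := fun a => by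
  unfold normal
  exact ContDiffAt.sum fun b _ => (contDiffAt_comp_slice (hG.inv_smooth hy a b)).mul
    (hG.conormal_slice_smooth hy b)

/-- The tangential components of the conormal vanish identically, so no derivative survives. -/
theorem secondFF_eq (G : MetricFun (n + 1)) (y : Coord n) (i j : Fin n) :
    secondFF G y i j = - (conormal G (slice y) 0 * christoffel G 0 i.succ j.succ (slice y)) := by
  have : (fun z => conormal G z j.succ) = fun _ => (0 : ℝ) := funext fun z => conormal_succ z j
  rw [secondFF, nablaForm, this, pd_const, Fin.sum_univ_succ]
  simp only [conormal_succ, mul_zero, Finset.sum_const_zero]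
  ring

theorem secondFF_symm (hG : MetricOn G U) (hy : slice y ∈ U) (i j : Fin n) :
    secondFF G y i j = secondFF G y j i := by
  rw [secondFF_eq, secondFF_eq, hG.christoffel_symm hy]

theorem secondFF_smooth (hG : MetricOn G U) (hy : slice y ∈ U) (i j : Fin n) :
    ContDiffAt ℝ ∞ (fun z => secondFF G z i j) y := by
  simp only [secondFF_eq]
  exact ((hG.conormal_slice_smooth hy 0).mul
    (contDiffAt_comp_slice (hG.christoffel_smooth hy _ _ _))).neg

theorem meanCurv_smooth (hG : MetricOn G U) (hy : slice y ∈ U) :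
    ContDiffAt ℝ ∞ (fun z => meanCurv G z) y := by
  unfold meanCurv
  exact (ContDiffAt.sum fun i _ => ContDiffAt.sum fun j _ =>
    (hG.induced.inv_smooth hy i j).mul (hG.secondFF_smooth hy i j)).div_const _

theorem tfSecondFF_smooth (hG : MetricOn G U) (hy : slice y ∈ U) (i j : Fin n) :
    ContDiffAt ℝ ∞ (fun z => tfSecondFF G z i j) y :=
  (hG.secondFF_smooth hy i j).sub ((hG.meanCurv_smooth hy).mul (hG.induced.smooth y hy i j))

theorem tfSecondFF_symm (hG : MetricOn G U) (hy : slice y ∈ U) (i j : Fin n) :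
    tfSecondFF G y i j = tfSecondFF G y j i := by
  rw [tfSecondFF, tfSecondFF, hG.secondFF_symm hy, hG.induced.symm_apply hy]

theorem christoffel_zero (hG : MetricOn G U) (hy : slice y ∈ U) (i j : Fin n) :
    christoffel G 0 i.succ j.succ (slice y) = - (secondFF G y i j * normal G y 0) := by
  rw [secondFF_eq]
  linear_combination (- christoffel G 0 i.succ j.succ (slice y)) * hG.conormal_mul_normal hy

/-- Gauss formula for the tangential part of the connection. -/
theorem christoffel_succ (hG : MetricOn G U) (hy : slice y ∈ U) (k i j : Fin n) :
    christoffel G k.succ i.succ j.succ (slice y)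
      = christoffel (inducedMetric G) k i j y - secondFF G y i j * normal G y k.succ := by
  set c : Fin (n + 1) → ℝ := fun l => pd i.succ (fun z => G z j.succ l) (slice y)
    + pd j.succ (fun z => G z i.succ l) (slice y) - pd l (fun z => G z i.succ j.succ) (slice y)
    with hc
  have h0 : christoffel G 0 i.succ j.succ (slice y)
      = normal G y 0 * (1 / 2 * ∑ l, normal G y l * c l) := by
    simp only [christoffel]
    rw [← mul_assoc, mul_comm (normal G y 0), mul_assoc, Finset.mul_sum _ _ (normal G y 0)]
    congr 1
    refine Finset.sum_congr rfl fun l _ => ?_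
    rw [hG.inv_symm_apply hy 0 l, hG.inv_zero hy]; ring
  have hn0 : normal G y 0 ≠ 0 := right_ne_zero_of_mul_eq_one (hG.conormal_mul_normal hy)
  -- Contracting the first-kind symbols with `n` is read off from the component `Γ^0`, already known
  -- in terms of `II`, by cancelling `n^0`.
  have h1 : 1 / 2 * ∑ l, normal G y l * c l = - secondFF G y i j := by
    rw [hG.christoffel_zero hy] at h0
    exact mul_left_cancel₀ hn0 (by linear_combination -h0)
  have hb : christoffel (inducedMetric G) k i j y
      = 1 / 2 * ∑ l : Fin n, (inducedMetric G y)⁻¹ k l * c l.succ := by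
    simp only [christoffel]
    congr 1
    refine Finset.sum_congr rfl fun l _ => ?_
    have hp : ∀ a b p : Fin n, pd a (fun z => inducedMetric G z b p) y
        = pd a.succ (fun z => G z b.succ p.succ) (slice y) := fun a b p =>
      pd_comp_slice a (hG.smooth _ hy b.succ p.succ)
    rw [hp, hp, hp]
  have hk : christoffel G k.succ i.succ j.succ (slice y)
      = 1 / 2 * ∑ l, (G (slice y))⁻¹ k.succ l * c l := rfl
  rw [hk, hb, Fin.sum_univ_succ]
  rw [Fin.sum_univ_succ] at h1
  simp only [hG.inv_zero hy, hG.inv_succ_succ hy, add_mul, Finset.sum_add_distrib, mul_assoc,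
    ← Finset.mul_sum]
  linear_combination (normal G y k.succ) * h1

theorem metric_smooth_slice (hG : MetricOn G U) (hy : slice y ∈ U) :
    MSmooth (fun z : Coord n => G (slice z)) y := fun a b =>
  contDiffAt_comp_slice (hG.smooth _ hy a b)

theorem mpd_metric_slice (hG : MetricOn G U) (hy : slice y ∈ U) (i : Fin n) :
    mpd i (fun z : Coord n => G (slice z)) y
      = (chris G i.succ (slice y))ᵀ * G (slice y) + G (slice y) * chris G i.succ (slice y) := by
  rw [← hG.mpd_metric hy]
  ext a b
  exact pd_comp_slice i (hG.smooth _ hy a b)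

/-- The covariant derivative of the normal along the hypersurface. -/
def nablaNormal (G : MetricFun (n + 1)) (i : Fin n) (y : Coord n) : Fin (n + 1) → ℝ :=
  vpd i (normal G) y + chris G i.succ (slice y) *ᵥ normal G y

/-- Metric compatibility: lowering the index commutes with the covariant derivative along the
hypersurface. -/
theorem metric_nablaNormal (hG : MetricOn G U) (hy : slice y ∈ U) (i : Fin n) :
    G (slice y) *ᵥ nablaNormal G i y = vpd i (fun z => conormal G (slice z)) y
      - (chris G i.succ (slice y))ᵀ *ᵥ conormal G (slice y) := by
  have h1 : vpd i (fun z => conormal G (slice z)) y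
      = vpd i (fun z => G (slice z) *ᵥ normal G z) y := by
    ext a
    exact pd_congr_of_eqOn (isOpen_preimage_slice hG.isOpen) hy
      (fun z hz => (congrFun (hG.metric_mulVec_normal hz) a).symm) i
  rw [h1, vpd_mulVec (hG.metric_smooth_slice hy) (hG.normal_smooth hy), hG.mpd_metric_slice hy,
    ← hG.metric_mulVec_normal hy, nablaNormal]
  simp only [Matrix.mulVec_add, Matrix.add_mulVec, Matrix.mulVec_mulVec]
  abel

/-- Differentiate `|n|² = 1`. -/
theorem conormal_nablaNormal (hG : MetricOn G U) (hy : slice y ∈ U) (i : Fin n) :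
    conormal G (slice y) ⬝ᵥ nablaNormal G i y = 0 := by
  have h1 : pd i (fun z => conormal G (slice z) ⬝ᵥ normal G z) y = 0 := by
    rw [pd_congr_of_eqOn (g := fun _ => (1 : ℝ)) (isOpen_preimage_slice hG.isOpen) hy
      (fun z hz => ?_) i, pd_const]
    rw [dotProduct, sum_conormal_mul]; exact hG.conormal_mul_normal hz
  rw [pd_dotProduct (hG.conormal_slice_smooth hy) (hG.normal_smooth hy)] at h1
  have h2 : normal G y ⬝ᵥ (G (slice y) *ᵥ nablaNormal G i y)
      = conormal G (slice y) ⬝ᵥ nablaNormal G i y := by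
    rw [Matrix.dotProduct_mulVec, ← Matrix.mulVec_transpose, hG.symm hy,
      hG.metric_mulVec_normal hy]
  have h3 : conormal G (slice y) ⬝ᵥ nablaNormal G i y
      = conormal G (slice y) ⬝ᵥ vpd i (normal G) y
        + conormal G (slice y) ⬝ᵥ (chris G i.succ (slice y) *ᵥ normal G y) := by
    rw [nablaNormal, dotProduct_add]
  rw [hG.metric_nablaNormal hy, dotProduct_sub, Matrix.mulVec_transpose,
    dotProduct_comm (normal G y) (_ ᵥ* _), ← Matrix.dotProduct_mulVec,
    dotProduct_comm (normal G y)] at h2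
  linarith

/-- Weingarten formula: the normal component. -/
theorem nablaNormal_zero (hG : MetricOn G U) (hy : slice y ∈ U) (i : Fin n) :
    nablaNormal G i y 0 = 0 := by
  have h := hG.conormal_nablaNormal hy i
  rw [dotProduct, sum_conormal_mul] at h
  exact (mul_eq_zero.1 h).resolve_left (hG.conormal_zero_pos hy).ne'

theorem metric_nablaNormal_succ (hG : MetricOn G U) (hy : slice y ∈ U) (i j : Fin n) :
    (G (slice y) *ᵥ nablaNormal G i y) j.succ = secondFF G y i j := by
  have : (fun z : Coord n => conormal G (slice z) j.succ) = fun _ => (0 : ℝ) :=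
    funext fun z => conormal_succ _ j
  rw [hG.metric_nablaNormal hy, Pi.sub_apply, vpd, this, pd_const, secondFF_eq, Matrix.mulVec,
    dotProduct_comm, dotProduct, sum_conormal_mul]
  simp [chris]

/-- Weingarten formula: the tangential components. -/
theorem nablaNormal_succ (hG : MetricOn G U) (hy : slice y ∈ U) (i k : Fin n) :
    nablaNormal G i y k.succ = ∑ j, (inducedMetric G y)⁻¹ k j * secondFF G y i j := by
  have h : ∀ j, ∑ p : Fin n, inducedMetric G y j p * nablaNormal G i y p.succ
      = secondFF G y i j := by
    intro j
    rw [← hG.metric_nablaNormal_succ hy, Matrix.mulVec, dotProduct, Fin.sum_univ_succ,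
      hG.nablaNormal_zero hy, mul_zero, zero_add]
    rfl
  have h2 : inducedMetric G y *ᵥ (fun p => nablaNormal G i y p.succ) = secondFF G y i := funext h
  have h3 := congrArg (fun v => (inducedMetric G y)⁻¹ *ᵥ v) h2
  simp only [Matrix.mulVec_mulVec, hG.induced.inv_mul (x := y) hy, Matrix.one_mulVec] at h3
  exact congrFun h3 k

end MetricOn

end Hypersurface

/-! ### The Gauss and Codazzi equations, their traces, and the trace of the Fialkow tensor -/

section Hypersurface

variable {n : ℕ} {G : MetricFun (n + 1)} {U : Set (Coord (n + 1))} {y : Coord n}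

namespace MetricOn

theorem induced_mul_nablaNormal (hG : MetricOn G U) (hy : slice y ∈ U) (i j : Fin n) :
    ∑ p : Fin n, inducedMetric G y j p * nablaNormal G i y p.succ = secondFF G y i j := by
  rw [← hG.metric_nablaNormal_succ hy, Matrix.mulVec, dotProduct, Fin.sum_univ_succ,
    hG.nablaNormal_zero hy, mul_zero, zero_add]
  rfl

/-- The skew derivative `∇̄_i II_{jl} - ∇̄_j II_{il}`. -/
def codazzi (G : MetricFun (n + 1)) (y : Coord n) (i j l : Fin n) : ℝ :=
  nablaTwo (inducedMetric G) (secondFF G) i j l y - nablaTwo (inducedMetric G) (secondFF G) j i l y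

/-- The Gauss formula splits `Γ^b_{jl}` into its intrinsic part and `-II_{jl} n^b`; the latter,
contracted with `Γ^a_{ib}`, completes `∂_i n` to `∇_i n`. -/
theorem sum_christoffel_mul (hG : MetricOn G U) (hy : slice y ∈ U) (i j l : Fin n)
    (a : Fin (n + 1)) :
    ∑ b, christoffel G a i.succ b (slice y) * christoffel G b j.succ l.succ (slice y)
      = ∑ k : Fin n, christoffel G a i.succ k.succ (slice y) * christoffel (inducedMetric G) k j l y
        - secondFF G y j l * (nablaNormal G i y a - pd i (fun z => normal G z a) y) := by
  have h : nablaNormal G i y a - pd i (fun z => normal G z a) y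
      = ∑ b, christoffel G a i.succ b (slice y) * normal G y b := by
    simp [nablaNormal, vpd, Matrix.mulVec, dotProduct, chris]
  rw [h, Fin.sum_univ_succ, Fin.sum_univ_succ, hG.christoffel_zero hy]
  simp only [hG.christoffel_succ hy, mul_sub, Finset.sum_sub_distrib, mul_add, Finset.mul_sum]
  have h2 : ∀ k : Fin n, christoffel G a i.succ k.succ (slice y) *
      (secondFF G y j l * normal G y k.succ) = secondFF G y j l *
      (christoffel G a i.succ k.succ (slice y) * normal G y k.succ) := fun k => by ring
  simp only [h2]
  ring

theorem curv_slice (hG : MetricOn G U) (hy : slice y ∈ U) (i j l : Fin n) (a : Fin (n + 1)) :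
    curv G i.succ j.succ (slice y) a l.succ
      = (pd i (fun z => christoffel G a j.succ l.succ (slice z)) y
          + ∑ k : Fin n, christoffel G a i.succ k.succ (slice y) *
              christoffel (inducedMetric G) k j l y
          - secondFF G y j l * (nablaNormal G i y a - pd i (fun z => normal G z a) y))
        - (pd j (fun z => christoffel G a i.succ l.succ (slice z)) y
          + ∑ k : Fin n, christoffel G a j.succ k.succ (slice y) *
              christoffel (inducedMetric G) k i l y
          - secondFF G y i l * (nablaNormal G j y a - pd j (fun z => normal G z a) y)) := by
  have hs := fun b c => hG.christoffel_smooth hy a b c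
  rw [← riemann_eq_curv, riemann, Finset.sum_sub_distrib, hG.sum_christoffel_mul hy,
    hG.sum_christoffel_mul hy, pd_comp_slice i (hs _ _), pd_comp_slice j (hs _ _)]
  ring

/-- The Christoffel terms acting on the antisymmetrised pair cancel by torsion-freeness. What
remains has the form in which the curvature produces it. -/
theorem codazzi_eq (hG : MetricOn G U) (hy : slice y ∈ U) (i j l : Fin n) :
    codazzi G y i j l = (pd i (fun z => secondFF G z j l) y
        + ∑ k, secondFF G y i k * christoffel (inducedMetric G) k j l y)
      - (pd j (fun z => secondFF G z i l) y
        + ∑ k, secondFF G y j k * christoffel (inducedMetric G) k i l y) := by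
  have h : ∀ k, christoffel (inducedMetric G) k j i y = christoffel (inducedMetric G) k i j y :=
    fun k => hG.induced.christoffel_symm (x := y) hy k j i
  simp only [codazzi, nablaTwo, Finset.sum_add_distrib, h]
  have h2 : ∀ p q : Fin n, ∑ k, christoffel (inducedMetric G) k p l y * secondFF G y q k
      = ∑ k, secondFF G y q k * christoffel (inducedMetric G) k p l y :=
    fun p q => Finset.sum_congr rfl fun _ _ => mul_comm _ _
  rw [h2, h2]
  ring

theorem curv_slice_zero (hG : MetricOn G U) (hy : slice y ∈ U) (i j l : Fin n) :
    curv G i.succ j.succ (slice y) 0 l.succ = - (codazzi G y i j l * normal G y 0) := by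
  have hp : ∀ p q : Fin n, pd p (fun z => christoffel G 0 q.succ l.succ (slice z)) y
      = - (pd p (fun z => secondFF G z q l) y * normal G y 0
        + secondFF G y q l * pd p (fun z => normal G z 0) y) := by
    intro p q
    rw [pd_congr_of_eqOn (isOpen_preimage_slice hG.isOpen) hy
      (fun z hz => hG.christoffel_zero hz q l), pd_neg,
      pd_mul p (hG.secondFF_smooth hy q l) (hG.normal_smooth hy 0)]
  have hsum : ∀ p q : Fin n, ∑ k, secondFF G y p k * normal G y 0 *
      christoffel (inducedMetric G) k q l y
      = normal G y 0 * ∑ k, secondFF G y p k * christoffel (inducedMetric G) k q l y := by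
    intro p q
    rw [Finset.mul_sum]; exact Finset.sum_congr rfl fun _ _ => by ring
  rw [hG.curv_slice hy, hG.codazzi_eq hy, hp, hp, hG.nablaNormal_zero hy, hG.nablaNormal_zero hy]
  simp only [hG.christoffel_zero hy, neg_mul, Finset.sum_neg_distrib, hsum]
  ring

/-- With the index `k` still raised a Codazzi term proportional to `n^k` is present; it drops out in
`gauss_equation`, once the index is lowered. -/
theorem curv_slice_succ (hG : MetricOn G U) (hy : slice y ∈ U) (i j k l : Fin n) :
    curv G i.succ j.succ (slice y) k.succ l.succ
      = curv (inducedMetric G) i j y k l - codazzi G y i j l * normal G y k.succ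
        - (secondFF G y j l * nablaNormal G i y k.succ
          - secondFF G y i l * nablaNormal G j y k.succ) := by
  have hp : ∀ p q : Fin n, pd p (fun z => christoffel G k.succ q.succ l.succ (slice z)) y
      = pd p (fun z => christoffel (inducedMetric G) k q l z) y
        - (pd p (fun z => secondFF G z q l) y * normal G y k.succ
        + secondFF G y q l * pd p (fun z => normal G z k.succ) y) := by
    intro p q
    rw [pd_congr_of_eqOn (isOpen_preimage_slice hG.isOpen) hy
      (fun z hz => hG.christoffel_succ hz k q l),
      pd_sub p (hG.induced.christoffel_smooth (x := y) hy k q l)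
        ((hG.secondFF_smooth hy q l).mul (hG.normal_smooth hy k.succ)),
      pd_mul p (hG.secondFF_smooth hy q l) (hG.normal_smooth hy k.succ)]
  have hsum : ∀ p q : Fin n, ∑ b, secondFF G y p b * normal G y k.succ *
      christoffel (inducedMetric G) b q l y
      = normal G y k.succ * ∑ b, secondFF G y p b * christoffel (inducedMetric G) b q l y := by
    intro p q
    rw [Finset.mul_sum]; exact Finset.sum_congr rfl fun _ _ => by ring
  rw [hG.curv_slice hy, hG.codazzi_eq hy, hp, hp]
  simp only [hG.christoffel_succ hy, sub_mul, Finset.sum_sub_distrib, hsum]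
  rw [← riemann_eq_curv, riemann, Finset.sum_sub_distrib]
  ring

/-- Gauss equation. -/
theorem gauss_equation (hG : MetricOn G U) (hy : slice y ∈ U) (i j k l : Fin n) :
    (G (slice y) * curv G i.succ j.succ (slice y)) k.succ l.succ
      = (inducedMetric G y * curv (inducedMetric G) i j y) k l
        - (secondFF G y j l * secondFF G y i k - secondFF G y i l * secondFF G y j k) := by
  have hn := hG.metric_normal hy k.succ
  rw [conormal_succ, Fin.sum_univ_succ] at hn
  rw [Matrix.mul_apply, Fin.sum_univ_succ, Matrix.mul_apply]
  simp only [hG.curv_slice_zero hy, hG.curv_slice_succ hy, mul_sub, Finset.sum_sub_distrib]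
  have e : ∀ p : Fin n, G (slice y) k.succ p.succ = inducedMetric G y k p := fun p => rfl
  simp only [e] at hn ⊢
  have h1 : ∀ p q : Fin n, ∑ x, inducedMetric G y k x * (secondFF G y p l * nablaNormal G q y x.succ)
      = secondFF G y p l * secondFF G y q k := by
    intro p q
    rw [← hG.induced_mul_nablaNormal hy q k, Finset.mul_sum]
    exact Finset.sum_congr rfl fun _ _ => by ring
  have h2 : ∑ x, inducedMetric G y k x * (codazzi G y i j l * normal G y x.succ)
      = codazzi G y i j l * ∑ x, inducedMetric G y k x * normal G y x.succ := by
    rw [Finset.mul_sum]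
    exact Finset.sum_congr rfl fun _ _ => by ring
  rw [h1, h1, h2]
  linear_combination (- codazzi G y i j l) * hn

/-- Codazzi equation. -/
theorem codazzi_equation (hG : MetricOn G U) (hy : slice y ∈ U) (i j l : Fin n) :
    (normal G y ᵥ* (G (slice y) * curv G i.succ j.succ (slice y))) l.succ
      = - codazzi G y i j l := by
  have hv : normal G y ᵥ* G (slice y) = conormal G (slice y) := by
    rw [← Matrix.mulVec_transpose, hG.symm hy, hG.metric_mulVec_normal hy]
  rw [← Matrix.vecMul_vecMul, hv, Matrix.vecMul, dotProduct, sum_conormal_mul, hG.curv_slice_zero hy]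
  linear_combination (- codazzi G y i j l) * hG.conormal_mul_normal hy

/-- The Ricci tensor as a trace of the lowered curvature. -/
theorem ricci_eq (hG : MetricOn G U) (hy : slice y ∈ U) (b d : Fin (n + 1)) :
    ricci G b d (slice y)
      = ∑ i, ∑ k, (inducedMetric G y)⁻¹ i k *
          (G (slice y) * curv G i.succ b (slice y)) k.succ d
        + ∑ a, normal G y a * (normal G y ᵥ* (G (slice y) * curv G a b (slice y))) d := by
  have h : ∀ c, curv G c b (slice y) c d
      = ∑ e, (G (slice y))⁻¹ c e * (G (slice y) * curv G c b (slice y)) e d := by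
    intro c
    rw [← Matrix.mul_apply, ← mul_assoc, hG.inv_mul hy, one_mul]
  simp only [ricci, riemann_eq_curv]
  rw [Finset.sum_congr rfl fun c _ => h c,
    hG.sum_inv_mul hy (fun c e => (G (slice y) * curv G c b (slice y)) e d)]
  congr 1
  refine Finset.sum_congr rfl fun a _ => ?_
  rw [Matrix.vecMul, dotProduct, Finset.mul_sum]
  exact Finset.sum_congr rfl fun _ _ => by ring

theorem lowered_curv_skew (hG : MetricOn G U) {x : Coord (n + 1)} (hx : x ∈ U)
    (a b c d : Fin (n + 1)) : (G x * curv G a b x) c d = - (G x * curv G a b x) d c := by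
  conv_lhs => rw [← Matrix.transpose_apply (G x * curv G a b x) d c, hG.curv_skew hx]
  rfl

theorem vecMul_dotProduct_curv (hG : MetricOn G U) {x : Coord (n + 1)} (hx : x ∈ U)
    (v : Fin (n + 1) → ℝ) (a b : Fin (n + 1)) : (v ᵥ* (G x * curv G a b x)) ⬝ᵥ v = 0 := by
  have h : (v ᵥ* (G x * curv G a b x)) ⬝ᵥ v = - ((v ᵥ* (G x * curv G a b x)) ⬝ᵥ v) := by
    conv_lhs => rw [← Matrix.mulVec_transpose, hG.curv_skew hx, Matrix.neg_mulVec,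
      neg_dotProduct, dotProduct_comm, Matrix.dotProduct_mulVec]
  linarith

theorem curv_mulVec (hG : MetricOn G U) {x : Coord (n + 1)} (hx : x ∈ U)
    (v : Fin (n + 1) → ℝ) (a b c : Fin (n + 1)) :
    ∑ d, (G x * curv G a b x) c d * v d = - (v ᵥ* (G x * curv G a b x)) c := by
  rw [Matrix.vecMul, dotProduct, ← Finset.sum_neg_distrib]
  exact Finset.sum_congr rfl fun d _ => by rw [hG.lowered_curv_skew hx a b c d]; ring

/-- Traced Codazzi equation. -/
theorem sum_ricci_mul_normal (hG : MetricOn G U) (hy : slice y ∈ U) (j : Fin n) :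
    ∑ d, ricci G j.succ d (slice y) * normal G y d
      = ∑ i, ∑ k, (inducedMetric G y)⁻¹ i k * codazzi G y i j k := by
  -- The normal part of the trace inserts `n` into both indices of a skew form.
  have h1 : ∑ d, (∑ a, normal G y a *
      (normal G y ᵥ* (G (slice y) * curv G a j.succ (slice y))) d) * normal G y d = 0 := by
    simp only [Finset.sum_mul]
    rw [Finset.sum_comm]
    refine Finset.sum_eq_zero fun a _ => ?_
    have := hG.vecMul_dotProduct_curv hy (normal G y) a j.succ
    rw [dotProduct] at this
    simp only [mul_assoc, ← Finset.mul_sum, this, mul_zero]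
  simp only [hG.ricci_eq hy, add_mul, Finset.sum_add_distrib]
  rw [h1]
  simp only [add_zero, Finset.sum_mul]
  rw [Finset.sum_comm]
  refine Finset.sum_congr rfl fun i _ => ?_
  rw [Finset.sum_comm]
  refine Finset.sum_congr rfl fun k _ => ?_
  simp only [mul_assoc, ← Finset.mul_sum]
  rw [hG.curv_mulVec hy, hG.codazzi_equation hy, neg_neg]

/-- `R(n, E_j, n, E_l)` traced over the hypersurface. -/
def normalCurv (G : MetricFun (n + 1)) (y : Coord n) : ℝ :=
  ∑ j, ∑ l, (inducedMetric G y)⁻¹ j l * ∑ a, normal G y a *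
    (normal G y ᵥ* (G (slice y) * curv G a j.succ (slice y))) l.succ

/-- In the split trace the purely normal term vanishes by skewness; antisymmetry in both pairs of
indices turns the tangential term into `normalCurv`. -/
theorem ricci_normal_normal (hG : MetricOn G U) (hy : slice y ∈ U) :
    ∑ b, ∑ d, normal G y b * normal G y d * ricci G b d (slice y) = normalCurv G y := by
  have h1 : ∑ b, ∑ d, normal G y b * normal G y d * (∑ a, normal G y a *
      (normal G y ᵥ* (G (slice y) * curv G a b (slice y))) d) = 0 := by
    refine Finset.sum_eq_zero fun b _ => ?_
    simp only [Finset.mul_sum]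
    rw [Finset.sum_comm]
    refine Finset.sum_eq_zero fun a _ => ?_
    have := hG.vecMul_dotProduct_curv hy (normal G y) a b
    rw [dotProduct] at this
    calc _ = normal G y b * normal G y a * ∑ d,
          (normal G y ᵥ* (G (slice y) * curv G a b (slice y))) d * normal G y d := by
            rw [Finset.mul_sum]; exact Finset.sum_congr rfl fun _ _ => by ring
      _ = 0 := by rw [this, mul_zero]
  simp only [hG.ricci_eq hy, mul_add, Finset.sum_add_distrib, h1, add_zero]
  have h2 : ∀ b, ∑ d, normal G y b * normal G y d * (∑ i, ∑ k, (inducedMetric G y)⁻¹ i k *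
      (G (slice y) * curv G i.succ b (slice y)) k.succ d)
      = ∑ i, ∑ k, (inducedMetric G y)⁻¹ i k * (normal G y b *
        (normal G y ᵥ* (G (slice y) * curv G b i.succ (slice y))) k.succ) := by
    intro b
    simp only [Finset.mul_sum]
    rw [Finset.sum_comm]
    refine Finset.sum_congr rfl fun i _ => ?_
    rw [Finset.sum_comm]
    refine Finset.sum_congr rfl fun k _ => ?_
    have h3 := hG.curv_mulVec hy (normal G y) i.succ b k.succ
    have h4 : curv G b i.succ (slice y) = - curv G i.succ b (slice y) := curv_antisymm _ _
    rw [h4, Matrix.mul_neg, Matrix.vecMul_neg, Pi.neg_apply, ← h3, Finset.mul_sum, Finset.mul_sum]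
    exact Finset.sum_congr rfl fun _ _ => by ring
  simp only [h2]
  simp only [normalCurv, Finset.mul_sum]
  rw [Finset.sum_comm]
  refine Finset.sum_congr rfl fun i _ => ?_
  rw [Finset.sum_comm]

theorem trace_mul_eq_sum (A B : Matrix (Fin n) (Fin n) ℝ) :
    (A * B).trace = ∑ i, ∑ j, A i j * B j i := by
  simp [Matrix.trace, Matrix.mul_apply]

/-- Traced Gauss equation. -/
theorem sum_inv_mul_ricci (hG : MetricOn G U) (hy : slice y ∈ U) :
    ∑ j : Fin n, ∑ l : Fin n, (inducedMetric G y)⁻¹ j l * ricci G j.succ l.succ (slice y)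
      = scal (inducedMetric G) y
        - ((∑ i, ∑ j, (inducedMetric G y)⁻¹ i j * secondFF G y i j) ^ 2
          - ∑ i, ∑ j, ∑ k, ∑ l, (inducedMetric G y)⁻¹ i k * (inducedMetric G y)⁻¹ j l *
            secondFF G y i j * secondFF G y k l) + normalCurv G y := by
  have hB := hG.induced
  have hr : ∀ j l : Fin n, ricci (inducedMetric G) j l y
      = ∑ i, ∑ k, (inducedMetric G y)⁻¹ i k *
        (inducedMetric G y * curv (inducedMetric G) i j y) k l := by
    intro j l
    simp only [ricci, riemann_eq_curv]
    refine Finset.sum_congr rfl fun i _ => ?_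
    rw [← Matrix.mul_apply, ← mul_assoc, hB.inv_mul (x := y) hy, one_mul]
  have hric : ∀ j l : Fin n, ricci G j.succ l.succ (slice y) = ricci (inducedMetric G) j l y
      - (∑ i, ∑ k, (inducedMetric G y)⁻¹ i k * (secondFF G y j l * secondFF G y i k)
        - ∑ i, ∑ k, (inducedMetric G y)⁻¹ i k * (secondFF G y i l * secondFF G y j k))
      + ∑ a, normal G y a *
        (normal G y ᵥ* (G (slice y) * curv G a j.succ (slice y))) l.succ := by
    intro j l
    rw [hG.ricci_eq hy, hr]
    simp only [hG.gauss_equation hy, mul_sub, Finset.sum_sub_distrib]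
  have h1 : ∑ j, ∑ l, (inducedMetric G y)⁻¹ j l *
      ∑ i, ∑ k, (inducedMetric G y)⁻¹ i k * (secondFF G y j l * secondFF G y i k)
      = (∑ i, ∑ j, (inducedMetric G y)⁻¹ i j * secondFF G y i j) ^ 2 := by
    rw [sq, Finset.sum_mul]
    refine Finset.sum_congr rfl fun j _ => ?_
    rw [Finset.sum_mul]
    refine Finset.sum_congr rfl fun l _ => ?_
    simp only [Finset.mul_sum]
    exact Finset.sum_congr rfl fun i _ => Finset.sum_congr rfl fun k _ => by ring
  have h2 : ∑ j, ∑ l, (inducedMetric G y)⁻¹ j l *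
      ∑ i, ∑ k, (inducedMetric G y)⁻¹ i k * (secondFF G y i l * secondFF G y j k)
      = ∑ i, ∑ j, ∑ k, ∑ l, (inducedMetric G y)⁻¹ i k * (inducedMetric G y)⁻¹ j l *
            secondFF G y i j * secondFF G y k l := by
    simp only [Finset.mul_sum]
    refine Finset.sum_congr rfl fun i _ => ?_
    have : ∀ k, ∑ l, ∑ j, (inducedMetric G y)⁻¹ i k *
        ((inducedMetric G y)⁻¹ l j * (secondFF G y l k * secondFF G y i j))
        = ∑ j, ∑ l, (inducedMetric G y)⁻¹ i k * (inducedMetric G y)⁻¹ j l *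
            secondFF G y i j * secondFF G y k l := by
      intro k
      rw [Finset.sum_comm]
      refine Finset.sum_congr rfl fun j _ => Finset.sum_congr rfl fun l _ => ?_
      rw [hB.inv_symm_apply (x := y) hy l j, hG.secondFF_symm hy l k]; ring
    simp only [this]
    rw [Finset.sum_comm]
  simp only [hric, mul_add, mul_sub, Finset.sum_add_distrib, Finset.sum_sub_distrib, h1, h2]
  rw [scal, normalCurv]

theorem scal_slice (hG : MetricOn G U) (hy : slice y ∈ U) :
    scal G (slice y)
      = ∑ j : Fin n, ∑ l : Fin n, (inducedMetric G y)⁻¹ j l * ricci G j.succ l.succ (slice y)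
        + normalCurv G y := by
  rw [scal, hG.sum_inv_mul hy (fun a b => ricci G a b (slice y)), hG.ricci_normal_normal hy]

theorem sum_inv_mul_metric {m : ℕ} {G : MetricFun m} {U : Set (Coord m)} {x : Coord m}
    (hG : MetricOn G U) (hx : x ∈ U) : ∑ i, ∑ j, (G x)⁻¹ i j * G x i j = m := by
  have h : ∀ i, ∑ j, (G x)⁻¹ i j * G x i j = 1 := by
    intro i
    have := congrFun (congrFun (hG.inv_mul hx) i) i
    rw [Matrix.mul_apply, Matrix.one_apply_eq] at this
    rw [← this]
    exact Finset.sum_congr rfl fun j _ => by rw [hG.symm_apply hx i j]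
  simp [h]

theorem sum_inv_mul_secondFF (hn : n ≠ 0) :
    ∑ i, ∑ j, (inducedMetric G y)⁻¹ i j * secondFF G y i j = n * meanCurv G y := by
  rw [meanCurv]; field_simp

theorem trace_tfSecondFF (hG : MetricOn G U) (hy : slice y ∈ U) (hn : n ≠ 0) :
    ∑ i, ∑ j, (inducedMetric G y)⁻¹ i j * tfSecondFF G y i j = 0 := by
  have h := hG.induced.sum_inv_mul_metric (x := y) hy
  have h2 : ∀ i j, (inducedMetric G y)⁻¹ i j * tfSecondFF G y i j
      = (inducedMetric G y)⁻¹ i j * secondFF G y i j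
        - meanCurv G y * ((inducedMetric G y)⁻¹ i j * inducedMetric G y i j) := fun i j => by
    rw [tfSecondFF]; ring
  simp only [h2, Finset.sum_sub_distrib, ← Finset.mul_sum, h, sum_inv_mul_secondFF hn]
  ring

theorem rigidity_eq (hG : MetricOn G U) (hy : slice y ∈ U) (hn : n ≠ 0) :
    rigidity G y = ∑ i, ∑ j, ∑ k, ∑ l, (inducedMetric G y)⁻¹ i k * (inducedMetric G y)⁻¹ j l *
            secondFF G y i j * secondFF G y k l - n * meanCurv G y ^ 2 := by
  have hB := hG.induced
  -- Double contractions become traces of products of `ḡ⁻¹ s` and `ḡ⁻¹ tᵀ`, in which `II - H ḡ`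
  -- expands bilinearly and `ḡ⁻¹ ḡ = 1`.
  have e : ∀ s t : Fin n → Fin n → ℝ,
      ∑ i, ∑ j, ∑ k, ∑ l, (inducedMetric G y)⁻¹ i k * (inducedMetric G y)⁻¹ j l * s i j * t k l
      = (((inducedMetric G y)⁻¹ * Matrix.of s) * ((inducedMetric G y)⁻¹ * (Matrix.of t)ᵀ)).trace := by
    intro s t
    have : ((inducedMetric G y)⁻¹ * Matrix.of s) * ((inducedMetric G y)⁻¹ * (Matrix.of t)ᵀ)
        = ((inducedMetric G y)⁻¹ * Matrix.of s * (inducedMetric G y)⁻¹) * (Matrix.of t)ᵀ := by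
      simp only [mul_assoc]
    rw [this, trace_mul_eq_sum]
    simp only [Matrix.mul_apply, Finset.sum_mul, Matrix.transpose_apply, Matrix.of_apply]
    have r1 : ∀ k l, ∑ j, ∑ i, (inducedMetric G y)⁻¹ k i * s i j * (inducedMetric G y)⁻¹ j l * t k l
        = ∑ i, ∑ j, (inducedMetric G y)⁻¹ i k * (inducedMetric G y)⁻¹ j l * s i j * t k l := by
      intro k l
      rw [Finset.sum_comm]
      refine Finset.sum_congr rfl fun i _ => Finset.sum_congr rfl fun j _ => ?_
      rw [hB.inv_symm_apply (x := y) hy k i]; ring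
    simp only [r1]
    calc _ = ∑ i, ∑ k, ∑ j, ∑ l, (inducedMetric G y)⁻¹ i k * (inducedMetric G y)⁻¹ j l * s i j * t k l :=
          Finset.sum_congr rfl fun i _ => Finset.sum_comm
      _ = ∑ k, ∑ i, ∑ j, ∑ l, (inducedMetric G y)⁻¹ i k * (inducedMetric G y)⁻¹ j l * s i j * t k l :=
          Finset.sum_comm
      _ = ∑ k, ∑ i, ∑ l, ∑ j, (inducedMetric G y)⁻¹ i k * (inducedMetric G y)⁻¹ j l * s i j * t k l :=
          Finset.sum_congr rfl fun k _ => Finset.sum_congr rfl fun i _ => Finset.sum_comm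
      _ = _ := Finset.sum_congr rfl fun k _ => Finset.sum_comm
  have htr : ((inducedMetric G y)⁻¹ * Matrix.of (secondFF G y)).trace = n * meanCurv G y := by
    rw [trace_mul_eq_sum, ← sum_inv_mul_secondFF hn]
    exact Finset.sum_congr rfl fun i _ => Finset.sum_congr rfl fun j _ => by
      rw [Matrix.of_apply, hG.secondFF_symm hy j i]
  have hs : (Matrix.of (secondFF G y))ᵀ = Matrix.of (secondFF G y) := by
    ext i j; exact hG.secondFF_symm hy j i
  have ht : Matrix.of (tfSecondFF G y)
      = Matrix.of (secondFF G y) - meanCurv G y • inducedMetric G y := by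
    ext i j; rfl
  rw [rigidity, e, e, ht, Matrix.transpose_sub, Matrix.transpose_smul, hs,
    hB.symm (x := y) hy, mul_sub, Matrix.mul_smul, hB.inv_mul (x := y) hy]
  simp only [sub_mul, mul_sub, Matrix.trace_sub, smul_mul_assoc, mul_smul_comm, one_mul,
    mul_one, Matrix.trace_smul, htr, smul_eq_mul, Matrix.trace_one, Fintype.card_fin]
  ring

/-- The trace of the Fialkow tensor. -/
theorem trace_fialkow (hG : MetricOn G U) (hy : slice y ∈ U) (hn : 3 ≤ n) :
    ∑ k, ∑ l, (inducedMetric G y)⁻¹ k l * fialkow G y k l = rigidity G y / (2 * ((n : ℝ) - 1)) := by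
  have h0 : n ≠ 0 := by omega
  have hB := hG.induced
  have hm := hB.sum_inv_mul_metric (x := y) hy
  have hGs := hG.sum_inv_mul_ricci hy
  have hsc := hG.scal_slice hy
  have hK := hG.rigidity_eq hy h0
  have ht := hG.trace_tfSecondFF hy h0
  have hr : (3 : ℝ) ≤ n := by exact_mod_cast hn
  have e : ∀ k l, (inducedMetric G y)⁻¹ k l * fialkow G y k l
      = (1 / ((n : ℝ) - 1)) * ((inducedMetric G y)⁻¹ k l * ricci G k.succ l.succ (slice y))
        - (schoutenTrace G (slice y) / ((n : ℝ) - 1)) *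
          ((inducedMetric G y)⁻¹ k l * inducedMetric G y k l)
        - (1 / ((n : ℝ) - 2)) * ((inducedMetric G y)⁻¹ k l * ricci (inducedMetric G) k l y)
        + (schoutenTrace (inducedMetric G) y / ((n : ℝ) - 2)) *
          ((inducedMetric G y)⁻¹ k l * inducedMetric G y k l)
        + meanCurv G y * ((inducedMetric G y)⁻¹ k l * tfSecondFF G y k l)
        + 1 / 2 * meanCurv G y ^ 2 * ((inducedMetric G y)⁻¹ k l * inducedMetric G y k l) := by
    intro k l
    have e1 : G (slice y) k.succ l.succ = inducedMetric G y k l := rfl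
    have e2 : ((n + 1 : ℕ) : ℝ) - 2 = (n : ℝ) - 1 := by push_cast; ring
    rw [fialkow, schouten, schouten, e1, e2]
    ring
  simp only [e, Finset.sum_add_distrib, Finset.sum_sub_distrib, ← Finset.mul_sum, hm, ht]
  rw [← scal]
  have hJ : schoutenTrace G (slice y) = scal G (slice y) / (2 * n) := by
    rw [schoutenTrace]; push_cast; ring
  -- `normalCurv` occurs once in the tangential Ricci trace and twice in the scalar curvature, which
  -- carries half the weight here, so it cancels. The remaining terms are the contracted Gauss
  -- equation.
  rw [hJ, schoutenTrace, hsc, hGs, hK, sum_inv_mul_secondFF h0]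
  have h1 : (n : ℝ) - 1 ≠ 0 := by linarith
  have h2 : (n : ℝ) - 2 ≠ 0 := by linarith
  have h3 : (n : ℝ) ≠ 0 := by linarith
  field_simp
  ring

end MetricOn

end Hypersurface

/-! ### Covariant derivatives of two-tensors and the traced Codazzi equation -/

section Hypersurface

variable {m n : ℕ}

theorem nablaTwo_eq_matrix (G : MetricFun m) (t : Coord m → Fin m → Fin m → ℝ) (i j k : Fin m)
    (x : Coord m) : nablaTwo G t i j k x
      = (mpd i (fun y => Matrix.of (t y)) x - (chris G i x)ᵀ * Matrix.of (t x)
        - Matrix.of (t x) * chris G i x) j k := by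
  simp only [nablaTwo, mpd, chris, Matrix.sub_apply, Matrix.mul_apply, Matrix.transpose_apply,
    Matrix.of_apply, Finset.sum_add_distrib]
  have : ∀ l, christoffel G l i k x * t x j l = t x j l * christoffel G l i k x :=
    fun l => mul_comm _ _
  simp only [this]
  ring

/-- The trace commutes with the covariant derivative. -/
theorem MetricOn.pd_trace {G : MetricFun m} {U : Set (Coord m)} {x : Coord m}
    (hG : MetricOn G U) (hx : x ∈ U) {t : Coord m → Fin m → Fin m → ℝ}
    (ht : MSmooth (fun y => Matrix.of (t y)) x) (i : Fin m) :
    pd i (fun y => ∑ j, ∑ k, (G y)⁻¹ j k * t y j k) x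
      = ∑ j, ∑ k, (G x)⁻¹ j k * nablaTwo G t i j k x := by
  have e : ∀ (A B : Matrix (Fin m) (Fin m) ℝ), ∑ j, ∑ k, A j k * B j k = (A * Bᵀ).trace := by
    intro A B; rw [MetricOn.trace_mul_eq_sum]; rfl
  have hi : ∀ j k, ContDiffAt ℝ ∞ (fun y => (G y)⁻¹ j k) x := hG.inv_smooth hx
  have ht' : ∀ j k, ContDiffAt ℝ ∞ (fun y => t y j k) x := ht
  have h1 : pd i (fun y => ∑ j, ∑ k, (G y)⁻¹ j k * t y j k) x
      = ∑ j, ∑ k, (mpd i (fun y => (G y)⁻¹) x j k * Matrix.of (t x) j k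
        + (G x)⁻¹ j k * mpd i (fun y => Matrix.of (t y)) x j k) := by
    rw [pd_sum _ _ fun j _ => contDiffAt_finsum fun k _ => (hi j k).mul (ht' j k)]
    refine Finset.sum_congr rfl fun j _ => ?_
    rw [pd_sum _ _ fun k _ => (hi j k).mul (ht' j k)]
    exact Finset.sum_congr rfl fun k _ => pd_mul i (hi j k) (ht' j k)
  rw [h1]
  simp only [nablaTwo_eq_matrix, Finset.sum_add_distrib]
  rw [e, e, e, hG.mpd_inv hx, Matrix.transpose_sub, Matrix.transpose_sub, Matrix.transpose_mul,
    Matrix.transpose_mul, Matrix.transpose_transpose, mul_sub, mul_sub, sub_mul, neg_mul]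
  simp only [Matrix.trace_sub, Matrix.trace_neg]
  have c1 : (chris G i x * (G x)⁻¹ * (Matrix.of (t x))ᵀ).trace
      = ((G x)⁻¹ * ((Matrix.of (t x))ᵀ * chris G i x)).trace := by
    rw [mul_assoc, Matrix.trace_mul_comm, mul_assoc]
  rw [c1, mul_assoc (G x)⁻¹]
  ring

/-- Since `∇g = 0`. Used to separate the pure trace parts of `II` and of the Fialkow tensor. -/
theorem MetricOn.nablaTwo_smul_metric {G : MetricFun m} {U : Set (Coord m)} {x : Coord m}
    (hG : MetricOn G U) (hx : x ∈ U) {f : Coord m → ℝ} (hf : ContDiffAt ℝ ∞ f x)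
    (i j k : Fin m) :
    nablaTwo G (fun y a b => f y * G y a b) i j k x = pd i f x * G x j k := by
  have h := congrFun (congrFun (hG.mpd_metric hx i) j) k
  simp only [mpd, chris, Matrix.of_apply, Matrix.add_apply, Matrix.mul_apply,
    Matrix.transpose_apply] at h
  rw [nablaTwo, pd_mul i hf (hG.smooth x hx j k), h, Finset.sum_add_distrib, mul_add,
    Finset.mul_sum, Finset.mul_sum]
  have e1 : ∀ l, christoffel G l i j x * (f x * G x l k) = f x * (christoffel G l i j x * G x l k) :=
    fun l => by ring
  have e2 : ∀ l, christoffel G l i k x * (f x * G x j l) = f x * (G x j l * christoffel G l i k x) :=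
    fun l => by ring
  simp only [e1, e2]
  ring

theorem nablaTwo_add (G : MetricFun m) {s t : Coord m → Fin m → Fin m → ℝ} {x : Coord m}
    (hs : MSmooth (fun y => Matrix.of (s y)) x) (ht : MSmooth (fun y => Matrix.of (t y)) x)
    (i j k : Fin m) :
    nablaTwo G (fun y a b => s y a b + t y a b) i j k x = nablaTwo G s i j k x
      + nablaTwo G t i j k x := by
  have hs' : ∀ j k, ContDiffAt ℝ ∞ (fun y => s y j k) x := hs
  have ht' : ∀ j k, ContDiffAt ℝ ∞ (fun y => t y j k) x := ht
  simp only [nablaTwo]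
  rw [pd_add i (hs' j k) (ht' j k)]
  simp only [mul_add, Finset.sum_add_distrib]
  ring

theorem nablaTwo_symm (G : MetricFun m) {U : Set (Coord m)} {x : Coord m} (hU : IsOpen U)
    (hx : x ∈ U) {t : Coord m → Fin m → Fin m → ℝ} (ht : ∀ y ∈ U, ∀ a b, t y a b = t y b a)
    (i j k : Fin m) : nablaTwo G t i j k x = nablaTwo G t i k j x := by
  simp only [nablaTwo]
  rw [pd_congr_of_eqOn hU hx (fun y hy => ht y hy j k) i]
  congr 1
  refine Finset.sum_congr rfl fun l _ => ?_
  rw [ht x hx l k, ht x hx j l]; ring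

theorem divTwo_eq_of_symm (G : MetricFun m) {U : Set (Coord m)} {x : Coord m} (hU : IsOpen U)
    (hx : x ∈ U) {t : Coord m → Fin m → Fin m → ℝ} (ht : ∀ y ∈ U, ∀ a b, t y a b = t y b a)
    (k : Fin m) : divTwo G t x k = ∑ i, ∑ j, (G x)⁻¹ i j * nablaTwo G t i k j x := by
  simp only [divTwo]
  exact Finset.sum_congr rfl fun i _ => Finset.sum_congr rfl fun j _ => by
    rw [nablaTwo_symm G hU hx ht i j k]

theorem divTwo_smooth {G : MetricFun m} {U : Set (Coord m)} {x : Coord m}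
    (hG : MetricOn G U) (hx : x ∈ U) {t : Coord m → Fin m → Fin m → ℝ}
    (ht : MSmooth (fun y => Matrix.of (t y)) x) (k : Fin m) :
    ContDiffAt ℝ ∞ (fun y => divTwo G t y k) x := by
  simp only [divTwo, nablaTwo]
  refine ContDiffAt.sum fun i _ => ContDiffAt.sum fun j _ => (hG.inv_smooth hx i j).mul ?_
  refine (contDiffAt_pd i (ht j k)).sub (ContDiffAt.sum fun l _ => ?_)
  exact ((hG.christoffel_smooth hx _ _ _).mul (ht _ _)).add
    ((hG.christoffel_smooth hx _ _ _).mul (ht _ _))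

variable {G : MetricFun (n + 1)} {U : Set (Coord (n + 1))} {y : Coord n}

namespace MetricOn

theorem tfSecondFF_msmooth (hG : MetricOn G U) (hy : slice y ∈ U) :
    MSmooth (fun z => Matrix.of (tfSecondFF G z)) y := fun i j => hG.tfSecondFF_smooth hy i j

/-- Traced Codazzi equation for the trace-free second fundamental form. -/
theorem sum_schouten_mul_normal (hG : MetricOn G U) (hy : slice y ∈ U) (hn : 3 ≤ n) (j : Fin n) :
    ∑ d, schouten G j.succ d (slice y) * normal G y d
      = divTwo (inducedMetric G) (tfSecondFF G) y j / ((n : ℝ) - 1)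
        - pd j (fun z => meanCurv G z) y := by
  have hB := hG.induced
  have h0 : n ≠ 0 := by omega
  have hr : (3 : ℝ) ≤ n := by exact_mod_cast hn
  have h1 : (n : ℝ) - 1 ≠ 0 := by linarith
  have hsplit : secondFF G = fun z a b => tfSecondFF G z a b + meanCurv G z * inducedMetric G z a b := by
    funext z a b; rw [tfSecondFF]; ring
  have hHs := hG.meanCurv_smooth hy
  have hHG : MSmooth (fun z => Matrix.of fun a b => meanCurv G z * inducedMetric G z a b) y :=
    fun a b => hHs.mul (hB.smooth y hy a b)
  have hII : ∀ a b c, nablaTwo (inducedMetric G) (secondFF G) a b c y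
      = nablaTwo (inducedMetric G) (tfSecondFF G) a b c y
        + pd a (fun z => meanCurv G z) y * inducedMetric G y b c := by
    intro a b c
    conv_lhs => rw [hsplit]
    rw [nablaTwo_add _ (hG.tfSecondFF_msmooth hy) hHG, hB.nablaTwo_smul_metric (x := y) hy hHs]
  -- The trace vanishes all along the hypersurface, hence so does its derivative, and trace and `∇̄`
  -- commute.
  have htr : ∑ i, ∑ k, (inducedMetric G y)⁻¹ i k *
      nablaTwo (inducedMetric G) (tfSecondFF G) j i k y = 0 := by
    rw [← hB.pd_trace (x := y) hy (hG.tfSecondFF_msmooth hy),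
      pd_congr_of_eqOn (g := fun _ => (0 : ℝ)) hB.isOpen hy
        (fun z hz => hG.trace_tfSecondFF hz h0), pd_const]
  have hdiv := divTwo_eq_of_symm (inducedMetric G) hB.isOpen (x := y) hy
    (t := tfSecondFF G) (fun z hz => hG.tfSecondFF_symm hz) j
  have hg : ∑ i, ∑ k, (inducedMetric G y)⁻¹ i k *
      (pd i (fun z => meanCurv G z) y * inducedMetric G y j k) = pd j (fun z => meanCurv G z) y := by
    have : ∀ i, ∑ k, (inducedMetric G y)⁻¹ i k *
        (pd i (fun z => meanCurv G z) y * inducedMetric G y j k)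
        = pd i (fun z => meanCurv G z) y * (1 : Matrix (Fin n) (Fin n) ℝ) i j := by
      intro i
      rw [← hB.inv_mul (x := y) hy, Matrix.mul_apply, Finset.mul_sum]
      exact Finset.sum_congr rfl fun k _ => by rw [hB.symm_apply (x := y) hy j k]; ring
    simp only [this, Matrix.one_apply]
    simp
  -- The factor `n - 1` arises as the trace `n` of the metric minus the one term in which the
  -- derivative index is contracted.
  have hric : ∑ d, ricci G j.succ d (slice y) * normal G y d
      = divTwo (inducedMetric G) (tfSecondFF G) y j
        - ((n : ℝ) - 1) * pd j (fun z => meanCurv G z) y := by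
    rw [hG.sum_ricci_mul_normal hy]
    simp only [codazzi, hII, mul_sub, mul_add, Finset.sum_sub_distrib, Finset.sum_add_distrib]
    rw [hg, htr, ← hdiv]
    have : ∑ i, ∑ k, (inducedMetric G y)⁻¹ i k *
        (pd j (fun z => meanCurv G z) y * inducedMetric G y i k)
        = pd j (fun z => meanCurv G z) y * n := by
      rw [← hB.sum_inv_mul_metric (x := y) hy]
      simp only [Finset.mul_sum]
      exact Finset.sum_congr rfl fun i _ => Finset.sum_congr rfl fun k _ => by ring
    rw [this]; ring
  have hGn := hG.metric_normal hy j.succ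
  rw [conormal_succ] at hGn
  have e : ∀ d, schouten G j.succ d (slice y) * normal G y d
      = (1 / ((n : ℝ) - 1)) * (ricci G j.succ d (slice y) * normal G y d)
        - schoutenTrace G (slice y) / ((n : ℝ) - 1) * (G (slice y) j.succ d * normal G y d) := by
    intro d
    have e2 : ((n + 1 : ℕ) : ℝ) - 2 = (n : ℝ) - 1 := by push_cast; ring
    rw [schouten, e2]; ring
  simp only [e, Finset.sum_sub_distrib, ← Finset.mul_sum, hGn, hric]
  field_simp
  ring

end MetricOn

end Hypersurface

/-! ## The derivation action on tensors -/

section Derivation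

variable {m r : ℕ} {I J : Type*} [Fintype I] [Fintype J]
  {x : Coord m}

/-- The derivation action of an endomorphism on covariant tensors. -/
def der (M : Matrix I I ℝ) (V : (Fin r → I) → ℝ) : (Fin r → I) → ℝ := fun β =>
  ∑ k, ∑ c, M (β k) c * V (Function.update β k c)

theorem der_add_left (M M' : Matrix I I ℝ) (V : (Fin r → I) → ℝ) :
    der (M + M') V = der M V + der M' V := by
  funext β
  simp only [der, Matrix.add_apply, add_mul, Finset.sum_add_distrib, Pi.add_apply]

theorem der_smul_left (a : ℝ) (M : Matrix I I ℝ) (V : (Fin r → I) → ℝ) :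
    der (a • M) V = a • der M V := by
  funext β
  simp only [der, Matrix.smul_apply, smul_eq_mul, Pi.smul_apply, Finset.mul_sum, mul_assoc]

theorem der_neg_left (M : Matrix I I ℝ) (V : (Fin r → I) → ℝ) : der (-M) V = - der M V := by
  rw [← neg_one_smul ℝ, der_smul_left, neg_one_smul]

theorem der_sub_left (M M' : Matrix I I ℝ) (V : (Fin r → I) → ℝ) :
    der (M - M') V = der M V - der M' V := by
  rw [sub_eq_add_neg, der_add_left, der_neg_left, sub_eq_add_neg]

theorem der_zero_left (V : (Fin r → I) → ℝ) : der 0 V = 0 := by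
  funext β; simp [der]

theorem der_sum_left {κ : Type*} (s : Finset κ) (M : κ → Matrix I I ℝ) (V : (Fin r → I) → ℝ) :
    der (∑ a ∈ s, M a) V = ∑ a ∈ s, der (M a) V := by
  classical
  induction s using Finset.induction_on with
  | empty => simp [der_zero_left]
  | insert a s ha ih => rw [Finset.sum_insert ha, Finset.sum_insert ha, der_add_left, ih]

theorem der_add_right (M : Matrix I I ℝ) (V W : (Fin r → I) → ℝ) :
    der M (V + W) = der M V + der M W := by
  funext β
  simp only [der, Pi.add_apply, mul_add, Finset.sum_add_distrib]

theorem der_smul_right (a : ℝ) (M : Matrix I I ℝ) (V : (Fin r → I) → ℝ) :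
    der M (a • V) = a • der M V := by
  funext β
  simp only [der, Pi.smul_apply, smul_eq_mul, Finset.mul_sum]
  exact Finset.sum_congr rfl fun _ _ => Finset.sum_congr rfl fun _ _ => by ring

theorem der_neg_right (M : Matrix I I ℝ) (V : (Fin r → I) → ℝ) : der M (-V) = - der M V := by
  rw [← neg_one_smul ℝ, der_smul_right, neg_one_smul]

theorem der_sub_right (M : Matrix I I ℝ) (V W : (Fin r → I) → ℝ) :
    der M (V - W) = der M V - der M W := by
  rw [sub_eq_add_neg, der_add_right, der_neg_right, sub_eq_add_neg]

theorem der_zero_right (M : Matrix I I ℝ) : der M (0 : (Fin r → I) → ℝ) = 0 := by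
  funext β; simp [der]

theorem der_sum_right {κ : Type*} (s : Finset κ) (M : Matrix I I ℝ) (V : κ → (Fin r → I) → ℝ) :
    der M (∑ a ∈ s, V a) = ∑ a ∈ s, der M (V a) := by
  classical
  induction s using Finset.induction_on with
  | empty => simp [der_zero_right]
  | insert a s ha ih => rw [Finset.sum_insert ha, Finset.sum_insert ha, der_add_right, ih]

/-- Two successive actions hit either the same slot, giving the matrix product, or two different
slots. -/
theorem der_der (M M' : Matrix I I ℝ) (V : (Fin r → I) → ℝ) (β : Fin r → I) :
    der M (der M' V) β = der (M * M') V β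
      + ∑ k, ∑ l ∈ Finset.univ.erase k, ∑ c, ∑ d, M (β k) c * M' (β l) d *
        V (Function.update (Function.update β k c) l d) := by
  simp only [der]
  rw [← Finset.sum_add_distrib]
  refine Finset.sum_congr rfl fun k _ => ?_
  have h : ∀ c, M (β k) c * ∑ l, ∑ d, M' (Function.update β k c l) d *
      V (Function.update (Function.update β k c) l d)
      = ∑ d, M (β k) c * M' c d * V (Function.update β k d)
        + ∑ l ∈ Finset.univ.erase k, ∑ d, M (β k) c * M' (β l) d *
          V (Function.update (Function.update β k c) l d) := by
    intro c
    rw [← Finset.add_sum_erase _ _ (Finset.mem_univ k), mul_add]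
    congr 1
    · simp only [Function.update_self, Function.update_idem, Finset.mul_sum, mul_assoc]
    · rw [Finset.mul_sum]
      refine Finset.sum_congr rfl fun l hl => ?_
      rw [Function.update_of_ne (Finset.ne_of_mem_erase hl), Finset.mul_sum]
      exact Finset.sum_congr rfl fun d _ => by ring
  simp only [h, Finset.sum_add_distrib]
  congr 1
  · rw [Finset.sum_comm]
    refine Finset.sum_congr rfl fun d _ => ?_
    rw [Matrix.mul_apply, Finset.sum_mul]
  · rw [Finset.sum_comm]

/-- Matrices acting in different slots commute, so only the same-slot products contribute to the
commutator. -/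
theorem der_comm (M M' : Matrix I I ℝ) (V : (Fin r → I) → ℝ) :
    der M (der M' V) - der M' (der M V) = der (M * M' - M' * M) V := by
  funext β
  rw [Pi.sub_apply, der_der, der_der, der_sub_left, Pi.sub_apply]
  have h : ∑ k, ∑ l ∈ Finset.univ.erase k, ∑ c, ∑ d, M (β k) c * M' (β l) d *
        V (Function.update (Function.update β k c) l d)
      = ∑ k, ∑ l ∈ Finset.univ.erase k, ∑ c, ∑ d, M' (β k) c * M (β l) d *
        V (Function.update (Function.update β k c) l d) := by
    rw [Finset.sum_comm' (t' := Finset.univ) (s' := fun l => Finset.univ.erase l)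
      (by intro a b; simp [ne_comm])]
    refine Finset.sum_congr rfl fun l _ => Finset.sum_congr rfl fun k hk => ?_
    rw [Finset.sum_comm]
    refine Finset.sum_congr rfl fun d _ => Finset.sum_congr rfl fun c _ => ?_
    rw [Function.update_comm (Finset.ne_of_mem_erase hk)]
    ring
  rw [h]; ring

theorem VSmooth.der {M : Coord m → Matrix I I ℝ} {V : Coord m → (Fin r → I) → ℝ}
    (hM : MSmooth M x) (hV : VSmooth V x) : VSmooth (fun y => der (M y) (V y)) x := fun _ =>
  contDiffAt_finsum fun _ _ => contDiffAt_finsum fun _ _ => (hM _ _).mul (hV _)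

theorem vpd_der {M : Coord m → Matrix I I ℝ} {V : Coord m → (Fin r → I) → ℝ}
    (hM : MSmooth M x) (hV : VSmooth V x) (i : Fin m) :
    vpd i (fun y => der (M y) (V y)) x = der (mpd i M x) (V x) + der (M x) (vpd i V x) := by
  funext β
  simp only [vpd, der, Pi.add_apply]
  rw [pd_sum _ _ fun k _ => contDiffAt_finsum fun c _ => (hM _ _).mul (hV _),
    ← Finset.sum_add_distrib]
  refine Finset.sum_congr rfl fun k _ => ?_
  rw [pd_sum _ _ fun c _ => (hM _ _).mul (hV _), ← Finset.sum_add_distrib]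
  exact Finset.sum_congr rfl fun c _ => pd_mul i (hM _ _) (hV _)

/-- Covariant derivative of tensors with respect to the connection matrix `A` in the direction
`∂_i`. -/
def cov (i : Fin m) (A : Coord m → Matrix I I ℝ) (V : Coord m → (Fin r → I) → ℝ) (y : Coord m) :
    (Fin r → I) → ℝ := vpd i V y - der (A y) (V y)

/-- Leibniz rule for an endomorphism field: commuting the connection matrix past `M` produces the
covariant derivative `∂_i M - [A, M]`. -/
theorem cov_der (i : Fin m) (A : Coord m → Matrix I I ℝ) {M : Coord m → Matrix I I ℝ}
    {V : Coord m → (Fin r → I) → ℝ} (hM : MSmooth M x) (hV : VSmooth V x) :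
    cov i A (fun y => der (M y) (V y)) x
      = der (mpd i M x - (A x * M x - M x * A x)) (V x) + der (M x) (cov i A V x) := by
  rw [cov, cov, vpd_der hM hV, der_sub_right, der_sub_left, ← der_comm]
  abel

/-- Change of frame of a covariant tensor. -/
def pull (P : Matrix J I ℝ) (t : (Fin r → J) → ℝ) : (Fin r → I) → ℝ := fun α =>
  ∑ β : Fin r → J, (∏ k, P (β k) (α k)) * t β

/-- Change of frame, with the frame in slot `k` replaced by `R`. -/
def pullAt (P R : Matrix J I ℝ) (k : Fin r) (t : (Fin r → J) → ℝ) : (Fin r → I) → ℝ := fun α =>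
  ∑ β : Fin r → J, (R (β k) (α k) * ∏ j ∈ Finset.univ.erase k, P (β j) (α j)) * t β

theorem pullAt_sub (P R R' : Matrix J I ℝ) (k : Fin r) (t : (Fin r → J) → ℝ) :
    pullAt P (R - R') k t = pullAt P R k t - pullAt P R' k t := by
  funext α
  simp only [pullAt, Matrix.sub_apply, sub_mul, Finset.sum_sub_distrib, Pi.sub_apply]

/-- An action after the change of frame and, in `pull_der`, one before it are both written as `pull`
with one slot modified. This reduces parallelism on tensors to an identity for the single matrix
`P`. -/
theorem der_pull (P : Matrix J I ℝ) (M : Matrix I I ℝ) (t : (Fin r → J) → ℝ) :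
    der M (pull P t) = ∑ k, pullAt P (P * Mᵀ) k t := by
  funext α
  rw [Finset.sum_apply]
  simp only [der, pull, pullAt]
  refine Finset.sum_congr rfl fun k _ => ?_
  simp only [Finset.mul_sum]
  rw [Finset.sum_comm]
  refine Finset.sum_congr rfl fun β _ => ?_
  rw [Matrix.mul_apply, Finset.sum_mul, Finset.sum_mul]
  refine Finset.sum_congr rfl fun c _ => ?_
  rw [← Finset.mul_prod_erase _ _ (Finset.mem_univ k), Function.update_self,
    Finset.prod_congr rfl fun j hj => by rw [Function.update_of_ne (Finset.ne_of_mem_erase hj)],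
    Matrix.transpose_apply]
  ring

theorem pull_der (P : Matrix J I ℝ) (M : Matrix J J ℝ) (t : (Fin r → J) → ℝ) :
    pull P (der M t) = ∑ k, pullAt P (Mᵀ * P) k t := by
  funext α
  rw [Finset.sum_apply]
  simp only [der, pull, pullAt, Finset.mul_sum]
  rw [Finset.sum_comm]
  refine Finset.sum_congr rfl fun k _ => ?_
  -- Exchanges the index in slot `k` with the summation index of the endomorphism, which moves the
  -- latter from `t` onto the frame.
  let e : ((Fin r → J) × J) ≃ ((Fin r → J) × J) := Function.Involutive.toPerm
    (fun p => (Function.update p.1 k p.2, p.1 k)) (fun p => by simp)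
  calc _ = ∑ p : (Fin r → J) × J, (∏ j, P (p.1 j) (α j)) *
        (M (p.1 k) p.2 * t (Function.update p.1 k p.2)) := by rw [Fintype.sum_prod_type]
    _ = ∑ p : (Fin r → J) × J, (∏ j, P ((e p).1 j) (α j)) *
        (M ((e p).1 k) (e p).2 * t (Function.update (e p).1 k (e p).2)) :=
        (Equiv.sum_comp e _).symm
    _ = ∑ p : (Fin r → J) × J, ((M p.2 (p.1 k) * P p.2 (α k)) *
        ∏ j ∈ Finset.univ.erase k, P (p.1 j) (α j)) * t p.1 := by
        refine Finset.sum_congr rfl fun p _ => ?_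
        have e1 : e p = (Function.update p.1 k p.2, p.1 k) := rfl
        rw [e1, ← Finset.mul_prod_erase _ _ (Finset.mem_univ k)]
        simp only [Function.update_self, Function.update_idem, Function.update_eq_self]
        rw [Finset.prod_congr rfl fun j hj => by
          rw [Function.update_of_ne (Finset.ne_of_mem_erase hj)]]
        ring
    _ = _ := by
        rw [Fintype.sum_prod_type]
        refine Finset.sum_congr rfl fun β _ => ?_
        simp only [Matrix.mul_apply, Finset.sum_mul, Matrix.transpose_apply]

theorem pd_prod {F : Fin r → Coord m → ℝ} (hF : ∀ k, ContDiffAt ℝ ∞ (F k) x) (i : Fin m) :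
    pd i (fun y => ∏ k, F k y) x
      = ∑ k, pd i (F k) x * ∏ j ∈ Finset.univ.erase k, F j x := by
  have h := HasFDerivAt.finsetProd (u := Finset.univ) (g := F)
    (g' := fun k => fderiv ℝ (F k) x) (x := x) (fun k _ => (diffAt (hF k)).hasFDerivAt)
  rw [pd, h.fderiv]
  simp only [pd, FunLike.coe_sum, Finset.sum_apply, _root_.smul_apply, smul_eq_mul]
  exact Finset.sum_congr rfl fun k _ => mul_comm _ _

theorem VSmooth.pull {P : Coord m → Matrix J I ℝ} {T : Coord m → (Fin r → J) → ℝ}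
    (hP : MSmooth P x) (hT : VSmooth T x) : VSmooth (fun y => pull (P y) (T y)) x := fun _ =>
  contDiffAt_finsum fun β _ => (contDiffAt_prod fun _ _ => hP _ _).mul (hT β)

theorem vpd_pull {P : Coord m → Matrix J I ℝ} {T : Coord m → (Fin r → J) → ℝ}
    (hP : MSmooth P x) (hT : VSmooth T x) (i : Fin m) :
    vpd i (fun y => pull (P y) (T y)) x
      = ∑ k, pullAt (P x) (mpd i P x) k (T x) + pull (P x) (vpd i T x) := by
  funext α
  rw [Pi.add_apply, Finset.sum_apply]
  simp only [vpd, pull, pullAt]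
  rw [pd_sum _ _ fun β _ => (contDiffAt_prod fun _ _ => hP _ _).mul (hT β), Finset.sum_comm,
    ← Finset.sum_add_distrib]
  refine Finset.sum_congr rfl fun β _ => ?_
  rw [pd_mul i (contDiffAt_prod fun _ _ => hP _ _) (hT β), pd_prod (fun k => hP _ _),
    Finset.sum_mul]
  rfl

theorem pull_sub (P : Matrix J I ℝ) (s t : (Fin r → J) → ℝ) :
    pull P (s - t) = pull P s - pull P t := by
  funext α
  simp only [pull, Pi.sub_apply, mul_sub, Finset.sum_sub_distrib]

theorem pull_add (P : Matrix J I ℝ) (s t : (Fin r → J) → ℝ) :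
    pull P (s + t) = pull P s + pull P t := by
  funext α
  simp only [pull, Pi.add_apply, mul_add, Finset.sum_add_distrib]

theorem pull_smul (P : Matrix J I ℝ) (a : ℝ) (t : (Fin r → J) → ℝ) :
    pull P (a • t) = a • pull P t := by
  funext α
  simp only [pull, Pi.smul_apply, smul_eq_mul, Finset.mul_sum]
  exact Finset.sum_congr rfl fun _ _ => by ring

theorem pull_zero (P : Matrix J I ℝ) : pull P (0 : (Fin r → J) → ℝ) = 0 := by
  funext α; simp [pull]

theorem pull_sum {κ : Type*} (s : Finset κ) (P : Matrix J I ℝ) (t : κ → (Fin r → J) → ℝ) :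
    pull P (∑ a ∈ s, t a) = ∑ a ∈ s, pull P (t a) := by
  classical
  induction s using Finset.induction_on with
  | empty => simp [pull_zero]
  | insert a s ha ih => rw [Finset.sum_insert ha, Finset.sum_insert ha, pull_add, ih]

/-- A change of frame that is parallel intertwines the covariant derivatives. -/
theorem cov_pull {P : Coord m → Matrix J I ℝ} {T : Coord m → (Fin r → J) → ℝ}
    {A : Coord m → Matrix I I ℝ} {B : Coord m → Matrix J J ℝ} (hP : MSmooth P x)
    (hT : VSmooth T x) (i : Fin m) (h : mpd i P x = P x * (A x)ᵀ - (B x)ᵀ * P x) :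
    cov i A (fun y => pull (P y) (T y)) x = pull (P x) (cov i B T x) := by
  rw [cov, cov, vpd_pull hP hT, pull_sub, der_pull, pull_der, h]
  simp only [pullAt_sub, Finset.sum_sub_distrib]
  abel

/-- Separates the action on the index added by a Thomas operator from that on the original ones. -/
theorem der_cons (M : Matrix I I ℝ) (V : (Fin (r + 1) → I) → ℝ) (a : I) (β : Fin r → I) :
    der M V (Fin.cons a β) = ∑ c, M a c * V (Fin.cons c β)
      + der M (fun γ => V (Fin.cons a γ)) β := by
  simp only [der]
  rw [Fin.sum_univ_succ]
  congr 1
  · simp only [Fin.cons_zero, Fin.update_cons_zero]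
  · simp only [Fin.cons_succ, ← Fin.cons_update]

theorem pull_cons (P : Matrix J I ℝ) (t : (Fin (r + 1) → J) → ℝ) (a : I) (α : Fin r → I) :
    pull P t (Fin.cons a α) = ∑ b, P b a * pull P (fun γ => t (Fin.cons b γ)) α := by
  simp only [pull]
  rw [← Equiv.sum_comp (Fin.consEquiv (fun _ : Fin (r + 1) => J)), Fintype.sum_prod_type]
  refine Finset.sum_congr rfl fun b _ => ?_
  rw [Finset.mul_sum]
  refine Finset.sum_congr rfl fun β _ => ?_
  rw [Fin.prod_univ_succ]
  simp only [Fin.consEquiv, Equiv.coe_fn_mk, Fin.cons_zero, Fin.cons_succ]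
  ring

theorem pull_two (P : Matrix J I ℝ) (t : (Fin 2 → J) → ℝ) (B C : I) :
    pull P t ![B, C] = ∑ b, ∑ c, P b B * P c C * t ![b, c] := by
  simp only [pull]
  rw [← (finTwoArrowEquiv J).symm.sum_comp, Fintype.sum_prod_type]
  simp [Fin.prod_univ_two, finTwoArrowEquiv]

theorem pull_one (P : Matrix J I ℝ) (t : (Fin 1 → J) → ℝ) (B : I) :
    pull P t ![B] = ∑ b, P b B * t ![b] := by
  simp only [pull]
  rw [← (Equiv.funUnique (Fin 1) J).symm.sum_comp]
  refine Finset.sum_congr rfl fun b _ => ?_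
  have : (Equiv.funUnique (Fin 1) J).symm b = ![b] := by
    funext k; fin_cases k; rfl
  rw [this]; simp

end Derivation

/-! ## The tractor connection as a matrix -/

section TractorMatrix

variable {m r : ℕ} {G : MetricFun m} {U : Set (Coord m)} {x : Coord m}

theorem sum_TIdx (f : TIdx m → ℝ) :
    ∑ a, f a = f (.inl ()) + (∑ i : Fin m, f (.inr (.inl i)) + f (.inr (.inr ()))) := by
  rw [Fintype.sum_sum_type, Fintype.sum_sum_type]
  simp

/-- The connection matrix of the tractor connection on covariant tractors. -/
def connM (G : MetricFun m) (i : Fin m) (x : Coord m) : Matrix (TIdx m) (TIdx m) ℝ :=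
  Matrix.of fun β γ => tractorConn G i x γ β

/-- The matrix of the tractor metric. -/
def metricM (A : Matrix (Fin m) (Fin m) ℝ) : Matrix (TIdx m) (TIdx m) ℝ :=
  Matrix.of (tractorMetric A)

theorem tractorNabla_eq_cov (G : MetricFun m) (i : Fin m) (V : TField m r) :
    tractorNabla G i V = cov i (connM G i) V := rfl

theorem sharp_eq_der (hinv Ω : TIdx m → TIdx m → ℝ) (V : TTensor m r) :
    sharp hinv Ω V = der (Matrix.of Ω * Matrix.of hinv) V := by
  funext β
  simp only [sharp, der, Matrix.mul_apply, Matrix.of_apply, Finset.sum_mul]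
  exact Finset.sum_congr rfl fun k _ => Finset.sum_comm

theorem MetricOn.connM_smooth (hG : MetricOn G U) (hx : x ∈ U) (i : Fin m) :
    MSmooth (connM G i) x := by
  have h1 := fun a b c => hG.christoffel_smooth hx a b c
  have h2 := fun a b => hG.schouten_smooth hx a b
  have h3 := fun a b => hG.smooth x hx a b
  have h4 := fun a b => hG.inv_smooth hx a b
  rintro (_ | k | _) (_ | l | _) <;> simp only [connM, Matrix.of_apply, tractorConn]
  all_goals first
    | exact contDiffAt_const
    | exact h1 _ _ _
    | exact (h2 _ _).neg
    | exact (h3 _ _).neg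
    | exact contDiffAt_finsum fun a _ => (h4 _ a).mul (h2 _ _)

theorem MetricOn.metricM_inv_smooth (hG : MetricOn G U) (hx : x ∈ U) :
    MSmooth (fun z => metricM (G z)⁻¹) x := by
  rintro (_ | k | _) (_ | l | _) <;> simp only [metricM, Matrix.of_apply, tractorMetric]
  all_goals first
    | exact contDiffAt_const
    | exact hG.inv_smooth hx _ _

theorem metricM_symm {A : Matrix (Fin m) (Fin m) ℝ} (h : Aᵀ = A) : (metricM A)ᵀ = metricM A := by
  ext (_ | k | _) (_ | l | _) <;> simp [metricM, tractorMetric]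
  exact congrFun (congrFun h k) l

theorem metricM_mul {A B : Matrix (Fin m) (Fin m) ℝ} (h : A * B = 1) :
    metricM A * metricM B = 1 := by
  have h' : ∀ k l, ∑ j, A k j * B j l = if k = l then 1 else 0 := fun k l => by
    rw [← Matrix.mul_apply, h, Matrix.one_apply]
  ext (_ | k | _) (_ | l | _) <;>
    simp [Matrix.mul_apply, metricM, tractorMetric, Matrix.one_apply, h']

/-- The tractor metric is parallel. -/
theorem MetricOn.mpd_metricM_inv (hG : MetricOn G U) (hx : x ∈ U) (i : Fin m) :
    mpd i (fun z => metricM (G z)⁻¹) x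
      = - (metricM (G x)⁻¹ * connM G i x) - (connM G i x)ᵀ * metricM (G x)⁻¹ := by
  have h0 := hG.mpd_inv hx i
  have h1 : ∀ k l, pd i (fun z => (G z)⁻¹ k l) x
      = - (∑ j, christoffel G k i j x * (G x)⁻¹ j l)
        - ∑ j, (G x)⁻¹ k j * christoffel G l i j x := by
    intro k l
    have := congrFun (congrFun h0 k) l
    simpa [mpd, Matrix.mul_apply, chris] using this
  have hgi : ∀ k, ∑ j, (G x)⁻¹ k j * G x i j = if k = i then 1 else 0 := by
    intro k
    have := congrFun (congrFun (hG.inv_mul hx) k) i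
    rw [Matrix.mul_apply, Matrix.one_apply] at this
    rw [← this]
    exact Finset.sum_congr rfl fun j _ => by rw [hG.symm_apply hx i j]
  ext (_ | k | _) (_ | l | _) <;>
    simp [mpd, Matrix.mul_apply, metricM, connM, tractorMetric, tractorConn, pd_const,
      hgi, h1]
  · have : ∑ a, G x i a * (G x)⁻¹ a l = if i = l then 1 else 0 := by
      rw [← Matrix.mul_apply, hG.mul_inv hx, Matrix.one_apply]
    rw [this]; ring
  · simp [eq_comm]
  · ring
  · rw [eq_comm, neg_add_eq_zero]
    exact Finset.sum_congr rfl fun j _ => by rw [hG.inv_symm_apply hx j l]; ring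

end TractorMatrix

/-! ## The adapted tractor frame -/

section Frame

variable {n r : ℕ} {G : MetricFun (n + 1)} {U : Set (Coord (n + 1))} {y : Coord n}

/-- The projection matrix onto the hypersurface tractors. -/
def projM (G : MetricFun (n + 1)) (y : Coord n) : Matrix (TIdx n) (TIdx (n + 1)) ℝ :=
  Matrix.of (tractorProj G y)

/-- The frame of hypersurface tractors inside the ambient tractors. -/
def frameM (G : MetricFun (n + 1)) (y : Coord n) : Matrix (TIdx n) (TIdx (n + 1)) ℝ :=
  Matrix.of fun
    | .inl _, .inl _ => 1
    | .inl _, .inr (.inl a) => meanCurv G y * normal G y a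
    | .inl _, .inr (.inr _) => - (1 / 2) * meanCurv G y ^ 2
    | .inr (.inl j), .inr (.inl a) => if a = j.succ then 1 else 0
    | .inr (.inr _), .inr (.inr _) => 1
    | _, _ => 0

theorem ambient_eq_pull (G : MetricFun (n + 1)) (y : Coord n) (t : TTensor n r) :
    ambient G y t = pull (projM G y) t := rfl

namespace MetricOn

theorem normalTractorLow_inl (u : Unit) :
    normalTractorLow G y (.inl u) = - meanCurv G y := by
  simp [normalTractorLow, tractorMetric, normalTractor]

theorem normalTractorLow_inr_inr (u : Unit) :
    normalTractorLow G y (.inr (.inr u)) = 0 := by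
  simp [normalTractorLow, tractorMetric, normalTractor]

theorem normalTractorLow_inr_inl (hG : MetricOn G U) (hy : slice y ∈ U) (a : Fin (n + 1)) :
    normalTractorLow G y (.inr (.inl a)) = conormal G (slice y) a := by
  simp [normalTractorLow, tractorMetric, normalTractor, hG.metric_normal hy]

theorem normalTractorLow_eq (G : MetricFun (n + 1)) (y : Coord n) :
    normalTractorLow G y = metricM (G (slice y)) *ᵥ normalTractor G y := rfl

/-- The rows of `frameM` and of `projM` are dual families. Together with `N` they decompose the
ambient tractors, the completeness relation being `frameM_mul_projM`. -/
theorem projM_mul_frameM (hG : MetricOn G U) (hy : slice y ∈ U) :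
    projM G y * (frameM G y)ᵀ = 1 := by
  have h := hG.conormal_mul_normal hy
  ext (_ | k | _) (_ | l | _) <;>
    simp [Matrix.mul_apply, projM, frameM, tractorProj, Matrix.one_apply,
      Fin.sum_univ_succ, conormal_succ, Fin.succ_ne_zero]
  · linear_combination (-meanCurv G y * normal G y k.succ) * h
  · linear_combination (meanCurv G y ^ 2) * h

theorem frameM_mul_projM (hG : MetricOn G U) (hy : slice y ∈ U) :
    (frameM G y)ᵀ * projM G y
      + Matrix.vecMulVec (normalTractor G y) (normalTractorLow G y) = 1 := by
  have h := hG.conormal_mul_normal hy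
  ext (_ | k | _) (_ | l | _) <;>
    simp [Matrix.mul_apply, projM, frameM, tractorProj, Matrix.one_apply,
      Matrix.vecMulVec_apply, normalTractor, normalTractorLow_inl, normalTractorLow_inr_inr,
      hG.normalTractorLow_inr_inl hy]
  · ring
  · refine Fin.cases ?_ (fun i => ?_) k
    · refine Fin.cases ?_ (fun j => ?_) l
      · simp [(Fin.succ_ne_zero _).symm]; linear_combination h
      · simp [(Fin.succ_ne_zero _).symm, conormal_succ]
    · refine Fin.cases ?_ (fun j => ?_) l
      · simp [Fin.succ_ne_zero]
      · simp [conormal_succ]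
  · ring

theorem projM_mulVec_normal (hG : MetricOn G U) (hy : slice y ∈ U) :
    projM G y *ᵥ normalTractor G y = 0 := by
  have h := hG.conormal_mul_normal hy
  ext (_ | k | _) <;>
    simp [Matrix.mulVec, dotProduct, projM, tractorProj, normalTractor,
      Fin.sum_univ_succ, conormal_succ]
  · linear_combination (- normal G y k.succ) * h
  · linear_combination (meanCurv G y) * h

theorem frameM_mulVec_normal (hG : MetricOn G U) (hy : slice y ∈ U) :
    frameM G y *ᵥ normalTractorLow G y = 0 := by
  have h := hG.conormal_mul_normal hy
  ext (_ | k | _) <;>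
    simp [Matrix.mulVec, dotProduct, frameM, normalTractorLow_inl,
      normalTractorLow_inr_inr, hG.normalTractorLow_inr_inl hy, Fin.sum_univ_succ, conormal_succ]
  · linear_combination (meanCurv G y) * h

theorem normalTractor_dotProduct (hG : MetricOn G U) (hy : slice y ∈ U) :
    normalTractorLow G y ⬝ᵥ normalTractor G y = 1 := by
  have h := hG.conormal_mul_normal hy
  simp [dotProduct, normalTractor, normalTractorLow_inl,
      normalTractorLow_inr_inr, hG.normalTractorLow_inr_inl hy, Fin.sum_univ_succ, conormal_succ, h]

/-- The identification with `N^⊥` is isometric: in the `Y` row the square of `H n` cancels against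
`2 · (-½ H²)`. -/
theorem frameM_metric (hG : MetricOn G U) (hy : slice y ∈ U) :
    frameM G y * metricM (G (slice y)) * (frameM G y)ᵀ = metricM (inducedMetric G y) := by
  have h := hG.conormal_mul_normal hy
  have h2 := hG.metric_normal hy
  ext (_ | k | _) (_ | l | _) <;>
    simp [Matrix.mul_apply, frameM, metricM, tractorMetric]
  · have e : ∀ a, ∑ b, meanCurv G y * normal G y b * G (slice y) b a
        = meanCurv G y * conormal G (slice y) a := by
      intro a
      rw [← h2 a, Finset.mul_sum]
      exact Finset.sum_congr rfl fun b _ => by rw [hG.symm_apply hy b a]; ring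
    simp only [e, Fin.sum_univ_succ, conormal_succ]
    simp
    linear_combination (meanCurv G y ^ 2) * h
  · rw [← mul_zero (meanCurv G y), ← conormal_succ (G := G) (slice y) l, ← h2, Finset.mul_sum]
    exact Finset.sum_congr rfl fun b _ => by rw [hG.symm_apply hy b]; ring
  · rw [← mul_zero (meanCurv G y), ← conormal_succ (G := G) (slice y) k, ← h2, Finset.mul_sum]
    exact Finset.sum_congr rfl fun b _ => by ring
  · rfl

end MetricOn

end Frame

/-! ### The tractor Gauss and Weingarten formulas -/

section GaussFormula

variable {n r : ℕ} {G : MetricFun (n + 1)} {U : Set (Coord (n + 1))} {y : Coord n}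

/-- Components of the tractor second fundamental form. -/
def matL (G : MetricFun (n + 1)) (y : Coord n) : Matrix (TIdx n) (TIdx n) ℝ :=
  Matrix.of fun b c => tractorL G y ![b, c]

/-- Components of the Fialkow tractor, corrected by the trace of the Fialkow tensor. -/
def matF (G : MetricFun (n + 1)) (y : Coord n) : Matrix (TIdx n) (TIdx n) ℝ :=
  Matrix.of fun b c => tractorF G y ![b, c]
    + rigidity G y / (2 * n * (n - 1)) * metricM (inducedMetric G y) b c

/-- The canonical tractor `X^A`. -/
def canonicalUp {m : ℕ} : TIdx m → ℝ
  | .inr (.inr _) => 1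
  | _ => 0

/-- A column of a matrix. -/
def colM {n : ℕ} (A : Matrix (TIdx n) (TIdx n) ℝ) (b : TIdx n) : TIdx n → ℝ := fun a => A a b

namespace MetricOn

theorem fialkow_symm (hG : MetricOn G U) (hy : slice y ∈ U) (i j : Fin n) :
    fialkow G y i j = fialkow G y j i := by
  rw [fialkow, fialkow, hG.schouten_symm hy, hG.induced.schouten_symm (x := y) hy,
    hG.tfSecondFF_symm hy, hG.induced.symm_apply (x := y) hy]

theorem tfFialkow_eq (hG : MetricOn G U) (hy : slice y ∈ U) (hn : 3 ≤ n) (i j : Fin n) :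
    tfFialkow G y i j = fialkow G y i j
      - rigidity G y / (2 * n * (n - 1)) * inducedMetric G y i j := by
  have hr : (3 : ℝ) ≤ n := by exact_mod_cast hn
  have h1 : (n : ℝ) - 1 ≠ 0 := by linarith
  have h2 : (n : ℝ) ≠ 0 := by linarith
  rw [tfFialkow, hG.trace_fialkow hy hn]
  field_simp

theorem matL_inr_inl (i k : Fin n) :
    matL G y (.inr (.inl k)) (.inr (.inl i)) = tfSecondFF G y k i := rfl

theorem matL_inl (i : Fin n) (u : Unit) : matL G y (.inl u) (.inr (.inl i))
    = - divTwo (inducedMetric G) (tfSecondFF G) y i / ((n : ℝ) - 1) := rfl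

theorem matL_inr_inr (b : TIdx n) (u : Unit) : matL G y (.inr (.inr u)) b = 0 := by
  rcases b with _ | _ | _ <;> rfl

/-- The multiple of the tractor metric added in `matF` restores the trace removed from the Fialkow
tensor, so the tangential block is the full tensor. -/
theorem matF_inr_inl (hG : MetricOn G U) (hy : slice y ∈ U) (hn : 3 ≤ n) (i k : Fin n) :
    matF G y (.inr (.inl k)) (.inr (.inl i)) = fialkow G y k i := by
  have : matF G y (.inr (.inl k)) (.inr (.inl i)) = tfFialkow G y k i
      + rigidity G y / (2 * n * (n - 1)) * inducedMetric G y k i := rfl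
  rw [this, hG.tfFialkow_eq hy hn]; ring

theorem matF_inl (i : Fin n) (u : Unit) : matF G y (.inl u) (.inr (.inl i))
    = - divTwo (inducedMetric G) (tfFialkow G) y i / ((n : ℝ) - 2) := by
  have : matF G y (.inl u) (.inr (.inl i))
    = - divTwo (inducedMetric G) (tfFialkow G) y i / ((n : ℝ) + -2)
      + rigidity G y / (2 * n * (n - 1)) * 0 := rfl
  rw [this, mul_zero, add_zero, ← sub_eq_add_neg]

theorem matF_inr_inr (i : Fin n) (u : Unit) : matF G y (.inr (.inr u)) (.inr (.inl i)) = 0 := by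
  have : matF G y (.inr (.inr u)) (.inr (.inl i))
    = 0 + rigidity G y / (2 * n * (n - 1)) * 0 := rfl
  rw [this]; simp

/-- The Schouten tensor with one tangential index, the other one raised. -/
theorem sum_inv_mul_schouten (hG : MetricOn G U) (hy : slice y ∈ U) (i : Fin n) :
    (∑ l, (G (slice y))⁻¹ 0 l * schouten G i.succ l (slice y)
      = normal G y 0 * ∑ l, schouten G i.succ l (slice y) * normal G y l) ∧
    ∀ k : Fin n, ∑ l, (G (slice y))⁻¹ k.succ l * schouten G i.succ l (slice y)
      = ∑ l : Fin n, (inducedMetric G y)⁻¹ k l * schouten G i.succ l.succ (slice y)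
        + normal G y k.succ * ∑ l, schouten G i.succ l (slice y) * normal G y l := by
  constructor
  · rw [Finset.mul_sum]
    exact Finset.sum_congr rfl fun l _ => by
      rw [hG.inv_symm_apply hy 0 l, hG.inv_zero hy]; ring
  · intro k
    rw [Fin.sum_univ_succ, Fin.sum_univ_succ (n := n)]
    simp only [hG.inv_zero hy, hG.inv_succ_succ hy, add_mul, Finset.sum_add_distrib]
    rw [mul_add, Finset.mul_sum]
    have : ∀ l : Fin n, normal G y k.succ * normal G y l.succ * schouten G i.succ l.succ (slice y)
        = normal G y k.succ * (schouten G i.succ l.succ (slice y) * normal G y l.succ) :=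
      fun l => by ring
    simp only [this]
    ring

theorem frameM_smooth (hG : MetricOn G U) (hy : slice y ∈ U) : MSmooth (frameM G) y := by
  have h1 := hG.meanCurv_smooth hy
  have h2 := hG.normal_smooth hy
  rintro (_ | k | _) (_ | l | _) <;> simp only [frameM, Matrix.of_apply]
  all_goals first
    | exact contDiffAt_const
    | exact h1.mul (h2 _)
    | exact contDiffAt_const.mul (h1.pow 2)

theorem normalTractor_smooth (hG : MetricOn G U) (hy : slice y ∈ U) :
    VSmooth (normalTractor G) y := by
  rintro (_ | k | _) <;> simp only [normalTractor]
  · exact contDiffAt_const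
  · exact hG.normal_smooth hy _
  · exact (hG.meanCurv_smooth hy).neg

theorem metricM_slice_smooth (hG : MetricOn G U) (hy : slice y ∈ U) :
    MSmooth (fun z : Coord n => metricM (G (slice z))) y := by
  rintro (_ | k | _) (_ | l | _) <;> simp only [metricM, Matrix.of_apply, tractorMetric]
  all_goals first
    | exact contDiffAt_const
    | exact hG.metric_smooth_slice hy _ _

theorem normalTractorLow_smooth (hG : MetricOn G U) (hy : slice y ∈ U) :
    VSmooth (normalTractorLow G) y :=
  (hG.metricM_slice_smooth hy).mulVec (hG.normalTractor_smooth hy)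

theorem projM_smooth (hG : MetricOn G U) (hy : slice y ∈ U) : MSmooth (projM G) y := by
  have h1 := hG.meanCurv_smooth hy
  have h2 := hG.normal_smooth hy
  have h3 := hG.conormal_slice_smooth hy
  rintro (_ | k | _) (_ | l | _) <;> simp only [projM, tractorProj, Matrix.of_apply]
  all_goals first
    | exact contDiffAt_const
    | exact contDiffAt_const.sub ((h2 _).mul (h3 _))
    | exact h1.mul (h3 _)
    | exact contDiffAt_const.mul (h1.pow 2)

/-- Derivative of the normal tractor along the hypersurface. -/
theorem vpd_normalTractor (hG : MetricOn G U) (hy : slice y ∈ U) (hn : 3 ≤ n) (i : Fin n) :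
    vpd i (normalTractor G) y + (connM G i.succ (slice y))ᵀ *ᵥ normalTractor G y
      = (frameM G y)ᵀ *ᵥ (metricM (inducedMetric G y)⁻¹ *ᵥ colM (matL G y) (.inr (.inl i))) := by
  have hB := hG.induced
  have hn0 := hG.metric_normal hy i.succ
  rw [conormal_succ] at hn0
  -- The derivative of the slot `-H` meets `P(∂_i, n)`. By the traced Codazzi equation the gradient
  -- of `H` cancels and the divergence of the trace-free `II` remains, which is the `Y` slot of `L`.
  have hS := hG.sum_schouten_mul_normal hy hn i
  have hd : ∀ k, ∑ l, (inducedMetric G y)⁻¹ k l * inducedMetric G y i l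
      = if k = i then 1 else 0 := by
    intro k
    rw [← Matrix.one_apply, ← hB.inv_mul (x := y) hy, Matrix.mul_apply]
    exact Finset.sum_congr rfl fun l _ => by rw [hB.symm_apply (x := y) hy i l]
  have hN : ∀ a, pd i (fun z => normal G z a) y
      + ∑ b, christoffel G a i.succ b (slice y) * normal G y b = nablaNormal G i y a := fun a => rfl
  ext (_ | a | _)
  · simp [vpd, normalTractor, pd_const, Matrix.mulVec, dotProduct, connM, tractorConn,
      frameM, colM, metricM, tractorMetric, matL_inr_inr, hn0]
  · have e : ∑ l, christoffel G a i.succ l (slice y) * normal G y l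
        = nablaNormal G i y a - pd i (fun z => normal G z a) y := by rw [← hN]; ring
    simp [vpd, normalTractor, Matrix.mulVec, dotProduct, connM, tractorConn,
      frameM, colM, metricM, tractorMetric, matL_inr_inr, matL_inr_inl, e]
    refine Fin.cases ?_ (fun k => ?_) a
    · simp [hG.nablaNormal_zero hy, (Fin.succ_ne_zero _).symm]
    · simp [hG.nablaNormal_succ hy, eq_comm (a := i), tfSecondFF, mul_sub]
      have : ∀ l, (inducedMetric G y)⁻¹ k l * secondFF G y l i
          = (inducedMetric G y)⁻¹ k l * secondFF G y i l := fun l => by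
        rw [hG.secondFF_symm hy l i]
      have h2 : ∀ l, (inducedMetric G y)⁻¹ k l * (meanCurv G y * inducedMetric G y l i)
          = meanCurv G y * ((inducedMetric G y)⁻¹ k l * inducedMetric G y i l) := fun l => by
        rw [hB.symm_apply (x := y) hy l i]; ring
      simp only [this, h2, ← Finset.mul_sum, hd]
      split_ifs <;> simp
      ring
  · simp [vpd, normalTractor, Matrix.mulVec, dotProduct, connM, tractorConn,
      frameM, colM, metricM, tractorMetric, matL_inr_inr, matL_inl, hS, pd_neg]
    ring

/-- Derivative of the adapted tractor frame along the hypersurface. -/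
theorem mpd_frameM (hG : MetricOn G U) (hy : slice y ∈ U) (hn : 3 ≤ n) (i : Fin n) :
    mpd i (frameM G) y + frameM G y * connM G i.succ (slice y)
      = connM (inducedMetric G) i y * frameM G y
        - Matrix.vecMulVec (colM (matL G y) (.inr (.inl i))) (normalTractor G y)
        - Matrix.vecMulVec (colM (matF G y) (.inr (.inl i))) canonicalUp
        + Matrix.vecMulVec canonicalTractor ((frameM G y)ᵀ *ᵥ
          (metricM (inducedMetric G y)⁻¹ *ᵥ colM (matF G y) (.inr (.inl i)))) := by
  have hB := hG.induced
  have hHs := hG.meanCurv_smooth hy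
  have hNs := hG.normal_smooth hy
  have hn0 := hG.metric_normal hy i.succ
  rw [conormal_succ] at hn0
  have hS := hG.sum_schouten_mul_normal hy hn i
  obtain ⟨hP0, hP1⟩ := hG.sum_inv_mul_schouten hy i
  have hd : ∀ k, ∑ l, (inducedMetric G y)⁻¹ k l * inducedMetric G y l i
      = if k = i then 1 else 0 := by
    intro k
    rw [← Matrix.one_apply, ← hB.inv_mul (x := y) hy, Matrix.mul_apply]
  have hN : ∀ a, ∑ b, christoffel G a i.succ b (slice y) * normal G y b
      = nablaNormal G i y a - pd i (fun z => normal G z a) y := fun a => by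
    rw [eq_sub_iff_add_eq, add_comm]; rfl
  have hHn : ∀ f : Fin (n + 1) → ℝ, ∑ a, meanCurv G y * normal G y a * f a
      = meanCurv G y * ∑ a, f a * normal G y a := fun f => by
    rw [Finset.mul_sum]; exact Finset.sum_congr rfl fun _ _ => by ring
  have hpH : pd i (fun z => meanCurv G z ^ 2) y
      = 2 * meanCurv G y * pd i (fun z => meanCurv G z) y := by
    simp only [sq]; rw [pd_mul i hHs hHs]; ring
  ext (_ | j | _) (_ | a | _)
  · simp [mpd, Matrix.mul_apply, frameM, connM, tractorConn, pd_const, Matrix.vecMulVec_apply,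
      normalTractor, canonicalUp, canonicalTractor, Matrix.mulVec, dotProduct, colM, metricM,
      tractorMetric, matF_inr_inr, hHn, hn0]
  -- The deepest entry, the derivative of `H n` together with the raised Schouten tensor: the normal
  -- part needs Codazzi, the tangential part needs Weingarten and the definition of the Fialkow
  -- tensor.
  · simp [mpd, Matrix.mul_apply, frameM, connM, tractorConn, Matrix.vecMulVec_apply,
      normalTractor, canonicalUp, canonicalTractor, Matrix.mulVec, dotProduct, colM, metricM,
      tractorMetric, matF_inr_inr, hHn, matL_inl, hG.matF_inr_inl hy hn, pd_mul i hHs (hNs a), hN]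
    refine Fin.cases ?_ (fun k => ?_) a
    · simp [hG.nablaNormal_zero hy, (Fin.succ_ne_zero _).symm, hP0, hS]
      field_simp
      ring
    · simp [hG.nablaNormal_succ hy, eq_comm (a := i), hP1, hS, fialkow]
      have e : ∀ l, (inducedMetric G y)⁻¹ k l * (schouten G l.succ i.succ (slice y)
          - schouten (inducedMetric G) l i y + meanCurv G y * tfSecondFF G y l i
          + 2⁻¹ * meanCurv G y ^ 2 * inducedMetric G y l i)
          = (inducedMetric G y)⁻¹ k l * schouten G i.succ l.succ (slice y)
            - (inducedMetric G y)⁻¹ k l * schouten (inducedMetric G) i l y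
            + meanCurv G y * ((inducedMetric G y)⁻¹ k l * secondFF G y i l)
            - 2⁻¹ * meanCurv G y ^ 2 * ((inducedMetric G y)⁻¹ k l * inducedMetric G y l i) := by
        intro l
        rw [hG.schouten_symm hy l.succ, hB.schouten_symm (x := y) hy l, tfSecondFF,
          hG.secondFF_symm hy l i]
        ring
      simp only [e, Finset.sum_add_distrib, Finset.sum_sub_distrib, ← Finset.mul_sum, hd]
      split_ifs <;> ring
  · simp [mpd, Matrix.mul_apply, frameM, connM, tractorConn, Matrix.vecMulVec_apply,
      normalTractor, canonicalUp, canonicalTractor, Matrix.mulVec, dotProduct, colM, metricM,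
      tractorMetric, matF_inr_inr, hHn, matL_inl, hS, pd_neg, pd_const_mul i _ (hHs.pow 2), hpH]
    ring
  · simp [mpd, Matrix.mul_apply, frameM, connM, tractorConn, pd_const, Matrix.vecMulVec_apply,
      normalTractor, canonicalUp, canonicalTractor, colM]
    rfl
  -- The classical Gauss formula. The `H ḡ` part of `II` is carried by the term `H n` in the `Y` row
  -- of the frame, leaving the trace-free part to `L`.
  · simp [mpd, Matrix.mul_apply, frameM, connM, tractorConn, pd_const, Matrix.vecMulVec_apply,
      normalTractor, canonicalUp, canonicalTractor, colM, matL_inr_inl]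
    refine Fin.cases ?_ (fun k => ?_) a
    · simp [hG.christoffel_zero hy, tfSecondFF, (Fin.succ_ne_zero _).symm]
      rw [hG.secondFF_symm hy j i, hB.symm_apply (x := y) hy j i]
      ring
    · simp [hG.christoffel_succ hy, tfSecondFF]
      rw [hG.secondFF_symm hy j i, hB.symm_apply (x := y) hy j i]
      ring
  -- This entry compares `P` with `P̄`; the Fialkow tensor is the difference that remains.
  · simp [mpd, Matrix.mul_apply, frameM, connM, tractorConn, pd_const, Matrix.vecMulVec_apply,
      normalTractor, canonicalUp, canonicalTractor, colM, matL_inr_inl, hG.matF_inr_inl hy hn,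
      fialkow]
    rw [hG.schouten_symm hy j.succ, hB.schouten_symm (x := y) hy j, hB.symm_apply (x := y) hy j i]
    ring
  · simp [mpd, Matrix.mul_apply, frameM, connM, tractorConn, pd_const, Matrix.vecMulVec_apply,
      normalTractor, canonicalUp, canonicalTractor, colM]
  · simp [mpd, Matrix.mul_apply, frameM, connM, tractorConn, pd_const, Matrix.vecMulVec_apply,
      normalTractor, canonicalUp, canonicalTractor, colM, matL_inr_inr]
    refine Fin.cases ?_ (fun k => ?_) a <;> simp [(Fin.succ_ne_zero _).symm]
  · simp [mpd, Matrix.mul_apply, frameM, connM, tractorConn, pd_const, Matrix.vecMulVec_apply,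
      normalTractor, canonicalUp, canonicalTractor, colM, matL_inr_inr, matF_inr_inr]

end MetricOn

end GaussFormula

/-! ### The modified connection `∇ - Γ^♯` and its parallel objects -/

section GaussConnection

variable {n r : ℕ} {G : MetricFun (n + 1)} {U : Set (Coord (n + 1))} {y : Coord n}

/-- `u_B v_C - v_B u_C`. -/
def wedgeM {I : Type*} (u v : I → ℝ) : Matrix I I ℝ := Matrix.vecMulVec u v - Matrix.vecMulVec v u

theorem wedgeM_transpose {I : Type*} (u v : I → ℝ) : (wedgeM u v)ᵀ = - wedgeM u v := by
  rw [wedgeM, Matrix.transpose_sub, Matrix.transpose_vecMulVec, Matrix.transpose_vecMulVec, neg_sub]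

/-- The component of `Γ_A` in the direction of the frame element `b`. -/
def gam (G : MetricFun (n + 1)) (y : Coord n) (b : TIdx n) :
    Matrix (TIdx (n + 1)) (TIdx (n + 1)) ℝ :=
  wedgeM ((projM G y)ᵀ *ᵥ colM (matL G y) b) (normalTractorLow G y)
    + wedgeM ((projM G y)ᵀ *ᵥ colM (matF G y) b) canonicalTractor

theorem gam_transpose (b : TIdx n) : (gam G y b)ᵀ = - gam G y b := by
  rw [gam, Matrix.transpose_add, wedgeM_transpose, wedgeM_transpose, neg_add]

/-- The connection matrix `∇ - Γ^♯` along the hypersurface. -/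
def tildeM (G : MetricFun (n + 1)) (i : Fin n) (y : Coord n) :
    Matrix (TIdx (n + 1)) (TIdx (n + 1)) ℝ :=
  connM G i.succ (slice y) + gam G y (.inr (.inl i)) * metricM (G (slice y))⁻¹

namespace MetricOn

theorem frameM_mulVec_canonical :
    frameM G y *ᵥ canonicalTractor = canonicalTractor := by
  ext (_ | k | _) <;>
    simp [Matrix.mulVec, dotProduct, frameM, canonicalTractor]

theorem projM_mulVec_canonicalUp : projM G y *ᵥ canonicalUp = canonicalUp := by
  ext (_ | k | _) <;>
    simp [Matrix.mulVec, dotProduct, projM, tractorProj, canonicalUp]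

theorem projM_transpose_mulVec_canonical :
    (projM G y)ᵀ *ᵥ canonicalTractor = canonicalTractor := by
  ext (_ | k | _) <;>
    simp [Matrix.mulVec, dotProduct, projM, tractorProj, canonicalTractor]

theorem metricM_mulVec_canonical {m : ℕ} (A : Matrix (Fin m) (Fin m) ℝ) :
    metricM A *ᵥ canonicalTractor = canonicalUp := by
  ext (_ | k | _) <;>
    simp [Matrix.mulVec, dotProduct, metricM, tractorMetric, canonicalTractor, canonicalUp]

theorem metricM_inv_mulVec_normal (hG : MetricOn G U) (hy : slice y ∈ U) :
    metricM (G (slice y))⁻¹ *ᵥ normalTractorLow G y = normalTractor G y := by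
  rw [normalTractorLow_eq, Matrix.mulVec_mulVec, metricM_mul (hG.inv_mul hy), Matrix.one_mulVec]

theorem metricM_inv_symm (hG : MetricOn G U) (hy : slice y ∈ U) :
    (metricM (G (slice y))⁻¹)ᵀ = metricM (G (slice y))⁻¹ := metricM_symm (hG.inv_symm hy)

theorem projM_mul_frameM' (hG : MetricOn G U) (hy : slice y ∈ U) :
    frameM G y * (projM G y)ᵀ = 1 := by
  have := congrArg Matrix.transpose (hG.projM_mul_frameM hy)
  rwa [Matrix.transpose_mul, Matrix.transpose_transpose, Matrix.transpose_one] at this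

theorem frameM_mul_projM' (hG : MetricOn G U) (hy : slice y ∈ U) :
    (projM G y)ᵀ * frameM G y
      + Matrix.vecMulVec (normalTractorLow G y) (normalTractor G y) = 1 := by
  have := congrArg Matrix.transpose (hG.frameM_mul_projM hy)
  rwa [Matrix.transpose_add, Matrix.transpose_mul, Matrix.transpose_transpose,
    Matrix.transpose_vecMulVec, Matrix.transpose_one] at this

/-- Lowering an index turns the frame into the projection. The normal component drops out because
the frame is orthogonal to `N`. -/
theorem metricM_mul_frameM (hG : MetricOn G U) (hy : slice y ∈ U) :
    metricM (G (slice y)) * (frameM G y)ᵀ = (projM G y)ᵀ * metricM (inducedMetric G y) := by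
  have h1 : normalTractor G y ᵥ* (metricM (G (slice y)) * (frameM G y)ᵀ) = 0 := by
    have h0 : normalTractor G y ᵥ* metricM (G (slice y)) = normalTractorLow G y := by
      rw [← Matrix.mulVec_transpose, metricM_symm (hG.symm hy), ← normalTractorLow_eq]
    rw [← Matrix.vecMul_vecMul, h0, Matrix.vecMul_transpose, hG.frameM_mulVec_normal hy]
  calc metricM (G (slice y)) * (frameM G y)ᵀ
      = ((projM G y)ᵀ * frameM G y
      + Matrix.vecMulVec (normalTractorLow G y) (normalTractor G y)) *
        (metricM (G (slice y)) * (frameM G y)ᵀ) := by rw [hG.frameM_mul_projM' hy, Matrix.one_mul]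
    _ = (projM G y)ᵀ * (frameM G y * metricM (G (slice y)) * (frameM G y)ᵀ) := by
      rw [Matrix.add_mul, Matrix.vecMulVec_mul, h1]
      simp only [Matrix.mul_assoc, add_eq_left]
      ext a b
      exact mul_zero _
    _ = _ := by rw [hG.frameM_metric hy]

theorem metricM_inv_mul_projM (hG : MetricOn G U) (hy : slice y ∈ U) :
    metricM (G (slice y))⁻¹ * (projM G y)ᵀ
      = (frameM G y)ᵀ * metricM (inducedMetric G y)⁻¹ := by
  have h := congrArg (fun A => metricM (G (slice y))⁻¹ * (A * metricM (inducedMetric G y)⁻¹))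
    (hG.metricM_mul_frameM hy)
  simp only [Matrix.mul_assoc, metricM_mul (hG.induced.mul_inv (x := y) hy), Matrix.mul_one] at h
  rw [← h, ← Matrix.mul_assoc, metricM_mul (hG.inv_mul hy), Matrix.one_mul]

theorem projM_metricM_inv (hG : MetricOn G U) (hy : slice y ∈ U) :
    projM G y * metricM (G (slice y))⁻¹ * (projM G y)ᵀ = metricM (inducedMetric G y)⁻¹ := by
  rw [Matrix.mul_assoc, hG.metricM_inv_mul_projM hy, ← Matrix.mul_assoc, hG.projM_mul_frameM hy,
    Matrix.one_mul]

theorem projM_transpose_metricM (hG : MetricOn G U) (hy : slice y ∈ U) :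
    (projM G y)ᵀ * metricM (inducedMetric G y) * projM G y = metricM (G (slice y))
      - Matrix.vecMulVec (normalTractorLow G y) (normalTractorLow G y) := by
  rw [← hG.metricM_mul_frameM hy, eq_sub_iff_add_eq, Matrix.mul_assoc]
  conv_rhs => rw [← Matrix.mul_one (metricM (G (slice y))), ← hG.frameM_mul_projM hy,
    Matrix.mul_add, Matrix.mul_vecMulVec, ← normalTractorLow_eq]

theorem frameM_mul_wedgeM_normal (hG : MetricOn G U) (hy : slice y ∈ U) (u : TIdx n → ℝ) :
    frameM G y * (wedgeM ((projM G y)ᵀ *ᵥ u) (normalTractorLow G y) * metricM (G (slice y))⁻¹)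
      = Matrix.vecMulVec u (normalTractor G y) := by
  rw [wedgeM, ← Matrix.mul_assoc, Matrix.mul_sub, Matrix.mul_vecMulVec, Matrix.mul_vecMulVec,
    hG.frameM_mulVec_normal hy, Matrix.mulVec_mulVec, hG.projM_mul_frameM' hy,
    Matrix.one_mulVec, Matrix.zero_vecMulVec, sub_zero, Matrix.vecMulVec_mul,
    ← Matrix.mulVec_transpose, hG.metricM_inv_symm hy, hG.metricM_inv_mulVec_normal hy]

theorem frameM_mul_wedgeM_canonical (hG : MetricOn G U) (hy : slice y ∈ U) (u : TIdx n → ℝ) :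
    frameM G y * (wedgeM ((projM G y)ᵀ *ᵥ u) canonicalTractor * metricM (G (slice y))⁻¹)
      = Matrix.vecMulVec u canonicalUp - Matrix.vecMulVec canonicalTractor
        ((frameM G y)ᵀ *ᵥ (metricM (inducedMetric G y)⁻¹ *ᵥ u)) := by
  rw [wedgeM, ← Matrix.mul_assoc, Matrix.mul_sub, Matrix.mul_vecMulVec, Matrix.mul_vecMulVec,
    frameM_mulVec_canonical, Matrix.mulVec_mulVec, hG.projM_mul_frameM' hy,
    Matrix.one_mulVec, Matrix.sub_mul, Matrix.vecMulVec_mul, Matrix.vecMulVec_mul,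
    ← Matrix.mulVec_transpose, ← Matrix.mulVec_transpose, hG.metricM_inv_symm hy,
    metricM_mulVec_canonical, Matrix.mulVec_mulVec, hG.metricM_inv_mul_projM hy,
    Matrix.mulVec_mulVec]

/-- The `L` and `F` terms of the Gauss formula are exactly the action of `Γ_i` on the frame, so
subtracting `Γ^♯` makes the frame parallel. -/
theorem mpd_frameM_tilde (hG : MetricOn G U) (hy : slice y ∈ U) (hn : 3 ≤ n) (i : Fin n) :
    mpd i (frameM G) y = connM (inducedMetric G) i y * frameM G y
      - frameM G y * tildeM G i y := by
  have h := hG.mpd_frameM hy hn i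
  rw [tildeM, gam, Matrix.mul_add, Matrix.add_mul, Matrix.mul_add (frameM G y),
    hG.frameM_mul_wedgeM_normal hy, hG.frameM_mul_wedgeM_canonical hy, eq_sub_of_add_eq h]
  abel

theorem gam_mulVec_normal (hG : MetricOn G U) (hy : slice y ∈ U) (b : TIdx n) :
    gam G y b *ᵥ normalTractor G y = (projM G y)ᵀ *ᵥ colM (matL G y) b := by
  have h1 : ∀ u, (projM G y)ᵀ *ᵥ u ⬝ᵥ normalTractor G y = 0 := fun u => by
    rw [dotProduct_comm, Matrix.dotProduct_mulVec, Matrix.vecMul_transpose,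
      hG.projM_mulVec_normal hy, zero_dotProduct]
  have h2 : canonicalTractor ⬝ᵥ normalTractor G y = 0 := by
    simp [dotProduct, canonicalTractor, normalTractor]
  rw [gam, wedgeM, wedgeM, Matrix.add_mulVec, Matrix.sub_mulVec, Matrix.sub_mulVec]
  simp only [Matrix.vecMulVec_mulVec, h1, h2, hG.normalTractor_dotProduct hy]
  simp

/-- `Γ_i` sends `N` to `L_i`, which is the ambient derivative of `N`; hence `N` is parallel for the
modified connection. -/
theorem vpd_normalTractor_tilde (hG : MetricOn G U) (hy : slice y ∈ U) (hn : 3 ≤ n) (i : Fin n) :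
    vpd i (normalTractor G) y = - ((tildeM G i y)ᵀ *ᵥ normalTractor G y) := by
  have h := hG.vpd_normalTractor hy hn i
  rw [eq_sub_of_add_eq h, tildeM, Matrix.transpose_add, Matrix.add_mulVec, Matrix.transpose_mul,
    gam_transpose, hG.metricM_inv_symm hy, ← Matrix.mulVec_mulVec, Matrix.neg_mulVec,
    hG.gam_mulVec_normal hy, Matrix.mulVec_neg, Matrix.mulVec_mulVec, Matrix.mulVec_mulVec,
    hG.metricM_inv_mul_projM hy]
  abel

/-- The projection is determined by its products with the frame and with `N`. Both are constant, so
its derivative follows from theirs by the completeness relation. -/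
theorem mpd_projM (hG : MetricOn G U) (hy : slice y ∈ U) (hn : 3 ≤ n) (i : Fin n) :
    mpd i (projM G) y = projM G y * (tildeM G i y)ᵀ
      - (connM (inducedMetric G) i y)ᵀ * projM G y := by
  have hopen := isOpen_preimage_slice (n := n) hG.isOpen
  have h1 : mpd i (projM G) y * (frameM G y)ᵀ = - (projM G y * (mpd i (frameM G) y)ᵀ) := by
    have : mpd i (fun z => projM G z * (frameM G z)ᵀ) y = 0 := by
      rw [mpd_congr_of_eqOn hopen hy (fun z hz => hG.projM_mul_frameM hz), mpd_const]
    rw [mpd_mul (hG.projM_smooth hy) (hG.frameM_smooth hy).transpose, mpd_transpose] at this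
    exact eq_neg_of_add_eq_zero_left this
  have h2 : mpd i (projM G) y *ᵥ normalTractor G y
      = - (projM G y *ᵥ vpd i (normalTractor G) y) := by
    have : vpd i (fun z => projM G z *ᵥ normalTractor G z) y = 0 := by
      ext a
      have := pd_congr_of_eqOn hopen hy
        (fun z hz => congrFun (hG.projM_mulVec_normal hz) a) i
      rw [vpd, this]
      exact pd_const i 0
    rw [vpd_mulVec (hG.projM_smooth hy) (hG.normalTractor_smooth hy)] at this
    exact eq_neg_of_add_eq_zero_left this
  have h3 : mpd i (projM G) y = mpd i (projM G) y * ((frameM G y)ᵀ * projM G y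
      + Matrix.vecMulVec (normalTractor G y) (normalTractorLow G y)) := by
    rw [hG.frameM_mul_projM hy, Matrix.mul_one]
  have h4 : projM G y * (tildeM G i y)ᵀ = projM G y * (tildeM G i y)ᵀ *
      ((frameM G y)ᵀ * projM G y
      + Matrix.vecMulVec (normalTractor G y) (normalTractorLow G y)) := by
    rw [hG.frameM_mul_projM hy, Matrix.mul_one]
  rw [h3, h4, Matrix.mul_add, Matrix.mul_add, Matrix.mul_vecMulVec, Matrix.mul_vecMulVec,
    ← Matrix.mul_assoc, h1, h2, hG.mpd_frameM_tilde hy hn, hG.vpd_normalTractor_tilde hy hn,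
    Matrix.transpose_sub, Matrix.transpose_mul, Matrix.transpose_mul, Matrix.mulVec_neg, neg_neg,
    Matrix.mulVec_mulVec, Matrix.mul_sub, ← Matrix.mul_assoc, hG.projM_mul_frameM hy,
    Matrix.one_mul, neg_sub, Matrix.sub_mul]
  simp only [Matrix.mul_assoc]
  abel

/-- As for `mpd_projM`: the constant pairings of the lowered `N` with the frame and with `N`
determine its derivative. -/
theorem vpd_normalTractorLow (hG : MetricOn G U) (hy : slice y ∈ U) (hn : 3 ≤ n) (i : Fin n) :
    vpd i (normalTractorLow G) y = tildeM G i y *ᵥ normalTractorLow G y := by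
  have hopen := isOpen_preimage_slice (n := n) hG.isOpen
  have h1 : frameM G y *ᵥ vpd i (normalTractorLow G) y
      = - (mpd i (frameM G) y *ᵥ normalTractorLow G y) := by
    have : vpd i (fun z => frameM G z *ᵥ normalTractorLow G z) y = 0 := by
      ext a
      have := pd_congr_of_eqOn hopen hy
        (fun z hz => congrFun (hG.frameM_mulVec_normal hz) a) i
      rw [vpd, this]
      exact pd_const i 0
    rw [vpd_mulVec (hG.frameM_smooth hy) (hG.normalTractorLow_smooth hy)] at this
    exact eq_neg_of_add_eq_zero_right this
  have h2 : normalTractor G y ⬝ᵥ vpd i (normalTractorLow G) y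
      = - (normalTractorLow G y ⬝ᵥ vpd i (normalTractor G) y) := by
    have : pd i (fun z => normalTractorLow G z ⬝ᵥ normalTractor G z) y = 0 := by
      rw [pd_congr_of_eqOn (g := fun _ => (1 : ℝ)) hopen hy
        (fun z hz => hG.normalTractor_dotProduct hz) i, pd_const]
    rw [pd_dotProduct (hG.normalTractorLow_smooth hy) (hG.normalTractor_smooth hy),
      dotProduct_comm] at this
    exact eq_neg_of_add_eq_zero_left this
  have key : ∀ v, v = (projM G y)ᵀ *ᵥ (frameM G y *ᵥ v)
      + (normalTractor G y ⬝ᵥ v) • normalTractorLow G y := by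
    intro v
    conv_lhs => rw [← Matrix.one_mulVec v, ← hG.frameM_mul_projM' hy, Matrix.add_mulVec,
      Matrix.vecMulVec_mulVec, ← Matrix.mulVec_mulVec]
    simp
  rw [key (vpd i (normalTractorLow G) y), key (tildeM G i y *ᵥ normalTractorLow G y), h1, h2,
    hG.mpd_frameM_tilde hy hn, hG.vpd_normalTractor_tilde hy hn, Matrix.sub_mulVec,
    ← Matrix.mulVec_mulVec, hG.frameM_mulVec_normal hy, Matrix.mulVec_zero, zero_sub, neg_neg,
    Matrix.mulVec_mulVec, dotProduct_neg, neg_neg, Matrix.mulVec_transpose,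
    dotProduct_comm (normalTractorLow G y), ← Matrix.dotProduct_mulVec]
  simp only [Matrix.mulVec_mulVec]

/-- Skewness of `Γ_i` keeps the tractor metric parallel under the modification. -/
theorem mpd_metricM_inv_slice (hG : MetricOn G U) (hy : slice y ∈ U) (i : Fin n) :
    mpd i (fun z : Coord n => metricM (G (slice z))⁻¹) y
      = - (metricM (G (slice y))⁻¹ * tildeM G i y)
        - (tildeM G i y)ᵀ * metricM (G (slice y))⁻¹ := by
  have h1 : mpd i (fun z : Coord n => metricM (G (slice z))⁻¹) y
      = mpd i.succ (fun z => metricM (G z)⁻¹) (slice y) := by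
    ext a b
    exact pd_comp_slice i (hG.metricM_inv_smooth hy a b)
  rw [h1, hG.mpd_metricM_inv hy, tildeM, Matrix.transpose_add, Matrix.transpose_mul,
    gam_transpose, hG.metricM_inv_symm hy]
  noncomm_ring

theorem metricM_inv_slice_smooth (hG : MetricOn G U) (hy : slice y ∈ U) :
    MSmooth (fun z : Coord n => metricM (G (slice z))⁻¹) y := fun a b =>
  contDiffAt_comp_slice (hG.metricM_inv_smooth hy a b)

/-- `L`, `F` and `h̄` are all pulled back by `projM`. The `K X ∧ h̄` term, with the ½ of its
antisymmetrisation, is the trace correction built into `matF`. -/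
theorem gammaTractor_eq (hG : MetricOn G U) (hy : slice y ∈ U) (A : TIdx (n + 1)) :
    Matrix.of (gammaTractor G y A) = ∑ b, projM G y b A • gam G y b := by
  have hamb : ∀ (t : TTensor n 2) B C, ambient G y t ![B, C]
      = ∑ b, ∑ c, projM G y b B * projM G y c C * t ![b, c] := by
    intro t B C
    exact pull_two _ _ _ _
  have hh : ∀ B C, tractorMetric (G (slice y)) B C
      - normalTractorLow G y B * normalTractorLow G y C
      = ∑ b, ∑ c, projM G y b B * projM G y c C * metricM (inducedMetric G y) b c := by
    intro B C
    have := congrFun (congrFun (hG.projM_transpose_metricM hy) B) C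
    rw [Matrix.sub_apply] at this
    refine Eq.trans this.symm ?_
    simp only [Matrix.mul_apply, Finset.sum_mul, Matrix.transpose_apply]
    rw [Finset.sum_comm]
    exact Finset.sum_congr rfl fun _ _ => Finset.sum_congr rfl fun _ _ => by ring
  have hL : ∀ B C, ambient G y (tractorL G y) ![B, C]
      = ∑ c, projM G y c C * ((projM G y)ᵀ *ᵥ colM (matL G y) c) B := by
    intro B C
    rw [hamb, Finset.sum_comm]
    refine Finset.sum_congr rfl fun c _ => ?_
    rw [Matrix.mulVec, dotProduct, Finset.mul_sum]
    refine Finset.sum_congr rfl fun b _ => ?_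
    simp only [colM, matL, Matrix.transpose_apply, Matrix.of_apply]
    ring
  have hF : ∀ B C, ambient G y (tractorF G y) ![B, C] + rigidity G y / (2 * n * (n - 1)) *
      (tractorMetric (G (slice y)) B C - normalTractorLow G y B * normalTractorLow G y C)
      = ∑ c, projM G y c C * ((projM G y)ᵀ *ᵥ colM (matF G y) c) B := by
    intro B C
    rw [hamb, hh, Finset.sum_comm, Finset.sum_comm (s := Finset.univ (α := TIdx n))
      (f := fun b c => projM G y b B * projM G y c C * metricM (inducedMetric G y) b c),
      Finset.mul_sum, ← Finset.sum_add_distrib]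
    refine Finset.sum_congr rfl fun c _ => ?_
    rw [Matrix.mulVec, dotProduct, Finset.mul_sum, Finset.mul_sum, ← Finset.sum_add_distrib]
    refine Finset.sum_congr rfl fun b _ => ?_
    simp only [colM, matF, Matrix.transpose_apply, Matrix.of_apply]
    ring
  ext B C
  have e : (Matrix.of (gammaTractor G y A)) B C
      = normalTractorLow G y C * ambient G y (tractorL G y) ![B, A]
        - normalTractorLow G y B * ambient G y (tractorL G y) ![C, A]
        + (canonicalTractor C * (ambient G y (tractorF G y) ![B, A]
            + rigidity G y / (2 * n * (n - 1)) * (tractorMetric (G (slice y)) B A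
              - normalTractorLow G y B * normalTractorLow G y A))
          - canonicalTractor B * (ambient G y (tractorF G y) ![C, A]
            + rigidity G y / (2 * n * (n - 1)) * (tractorMetric (G (slice y)) C A
              - normalTractorLow G y C * normalTractorLow G y A))) := by
    simp only [Matrix.of_apply, gammaTractor]
    have : rigidity G y / (2 * n * (n - 1)) = rigidity G y / ((n : ℝ) * (n - 1)) * (1 / 2) := by
      rw [mul_assoc 2, mul_comm (2 : ℝ), ← div_div, div_eq_mul_one_div (_ / _) 2]
    rw [this]
    ring
  rw [e, hL, hL, hF, hF, Matrix.sum_apply]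
  simp only [Finset.mul_sum, ← Finset.sum_add_distrib, ← Finset.sum_sub_distrib]
  refine Finset.sum_congr rfl fun b _ => ?_
  simp only [Matrix.smul_apply, gam, wedgeM, Matrix.add_apply, Matrix.sub_apply,
    Matrix.vecMulVec_apply, smul_eq_mul]
  ring

end MetricOn

end GaussConnection

/-! ### Derivatives of `Γ_i` and divergences of the columns of `L` and `F` -/

section DivGamma

variable {n r : ℕ} {G : MetricFun (n + 1)} {U : Set (Coord (n + 1))} {y : Coord n}

/-- Divergence of a tractor-valued one-form. -/
def divTractor {m : ℕ} (G : MetricFun m) (u : Fin m → Coord m → TIdx m → ℝ) (y : Coord m) :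
    TIdx m → ℝ := fun b =>
  ∑ i, ∑ j, (G y)⁻¹ i j * (pd i (fun z => u j z b) y - (connM G i y *ᵥ u j y) b
    - ∑ k, christoffel G k i j y * u k y b)

/-- Components of `D̂̄ K`. -/
def gradK (G : MetricFun (n + 1)) (y : Coord n) : TIdx n → ℝ := fun b =>
  thomasHat (inducedMetric G) (-2) (fun z (_ : Fin 0 → TIdx n) => rigidity G z) y ![b]

namespace MetricOn

theorem gradK_inr_inl (k : Fin n) :
    gradK G y (.inr (.inl k)) = pd k (fun z => rigidity G z) y := by
  have : gradK G y (.inr (.inl k)) = tractorNabla (inducedMetric G) k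
    (fun z (_ : Fin 0 → TIdx n) => rigidity G z) y (Fin.tail ![.inr (.inl k)]) := rfl
  rw [this, tractorNabla]; simp

theorem gradK_inr_inr (u : Unit) : gradK G y (.inr (.inr u)) = -2 * rigidity G y := rfl

theorem rigidity_smooth (hG : MetricOn G U) (hy : slice y ∈ U) :
    ContDiffAt ℝ ∞ (fun z => rigidity G z) y := by
  have h1 := fun a b => hG.induced.inv_smooth (x := y) hy a b
  have h2 := fun a b => hG.tfSecondFF_smooth hy a b
  unfold rigidity
  exact contDiffAt_finsum fun i _ => contDiffAt_finsum fun j _ => contDiffAt_finsum fun k _ =>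
    contDiffAt_finsum fun l _ => (((h1 _ _).mul (h1 _ _)).mul (h2 _ _)).mul (h2 _ _)

theorem fialkow_smooth (hG : MetricOn G U) (hy : slice y ∈ U) (i j : Fin n) :
    ContDiffAt ℝ ∞ (fun z => fialkow G z i j) y := by
  have h1 := contDiffAt_comp_slice (hG.schouten_smooth hy i.succ j.succ)
  have h2 := hG.induced.schouten_smooth (x := y) hy i j
  have h3 := hG.meanCurv_smooth hy
  have h4 := hG.tfSecondFF_smooth hy i j
  have h5 := hG.induced.smooth y hy i j
  exact ((h1.sub h2).add (h3.mul h4)).add ((contDiffAt_const.mul (h3.pow 2)).mul h5)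

theorem tfFialkow_smooth (hG : MetricOn G U) (hy : slice y ∈ U) (i j : Fin n) :
    ContDiffAt ℝ ∞ (fun z => tfFialkow G z i j) y := by
  have h1 := fun a b => hG.induced.inv_smooth (x := y) hy a b
  have h2 := fun a b => hG.fialkow_smooth hy a b
  exact (h2 i j).sub (((contDiffAt_finsum fun k _ => contDiffAt_finsum fun l _ =>
    (h1 k l).mul (h2 k l)).div_const _).mul (hG.induced.smooth y hy i j))

theorem matL_col_smooth (hG : MetricOn G U) (hy : slice y ∈ U) (i : Fin n) :
    VSmooth (fun z => colM (matL G z) (.inr (.inl i))) y := by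
  rintro (_ | k | _)
  · simp only [colM, matL_inl]
    exact (divTwo_smooth hG.induced (x := y) hy (hG.tfSecondFF_msmooth hy) i).neg.div_const _
  · exact hG.tfSecondFF_smooth hy k i
  · exact contDiffAt_const

theorem matF_col_smooth (hG : MetricOn G U) (hy : slice y ∈ U) (i : Fin n) :
    VSmooth (fun z => colM (matF G z) (.inr (.inl i))) y := by
  have hK := hG.rigidity_smooth hy
  rintro (_ | k | _)
  · simp only [colM, matF_inl]
    exact (divTwo_smooth hG.induced (x := y) hy
      (fun a b => hG.tfFialkow_smooth hy a b) i).neg.div_const _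
  · exact (hG.tfFialkow_smooth hy k i).add
      ((hK.div_const _).mul (hG.induced.smooth y hy k i))
  · simp only [colM, matF_inr_inr]
    exact contDiffAt_const

theorem vsmooth_const {I : Type*} {m : ℕ} (u : I → ℝ) (x : Coord m) :
    VSmooth (fun _ => u) x := fun _ => contDiffAt_const

theorem wedgeM_smooth {I : Type*} {m : ℕ} {x : Coord m} {u v : Coord m → I → ℝ}
    (hu : VSmooth u x) (hv : VSmooth v x) : MSmooth (fun z => wedgeM (u z) (v z)) x :=
  (hu.vecMulVec hv).sub (hv.vecMulVec hu)

theorem gam_smooth (hG : MetricOn G U) (hy : slice y ∈ U) (i : Fin n) :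
    MSmooth (fun z => gam G z (.inr (.inl i))) y := by
  have h1 := (hG.projM_smooth hy).transpose.mulVec (hG.matL_col_smooth hy i)
  have h2 := (hG.projM_smooth hy).transpose.mulVec (hG.matF_col_smooth hy i)
  exact (wedgeM_smooth h1 (hG.normalTractorLow_smooth hy)).add
    (wedgeM_smooth h2 (vsmooth_const _ _))

/-- `Z_i` with its index lowered, as a hypersurface tractor. -/
def zLow (G : MetricFun (n + 1)) (y : Coord n) (i : Fin n) : TIdx n → ℝ
  | .inr (.inl j) => inducedMetric G y i j
  | _ => 0

theorem connM_mulVec_canonical {m : ℕ} (G : MetricFun m) (x : Coord m) (i : Fin m)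
    (b : TIdx m) : (connM G i x *ᵥ canonicalTractor) b = tractorConn G i x (.inl ()) b := by
  simp [Matrix.mulVec, dotProduct, connM, canonicalTractor]

/-- This is `∇_i X = Z_i`. -/
theorem connM_mulVec_canonical' (i : Fin n) :
    connM (inducedMetric G) i y *ᵥ canonicalTractor = - zLow G y i := by
  ext b
  rw [connM_mulVec_canonical]
  rcases b with _ | _ | _ <;> simp [tractorConn, zLow]

/-- Parallelism of the projection lets the modified ambient derivative be computed intrinsically. -/
theorem vpd_projM_mulVec (hG : MetricOn G U) (hy : slice y ∈ U) (hn : 3 ≤ n) (i : Fin n)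
    {u : Coord n → TIdx n → ℝ} (hu : VSmooth u y) :
    vpd i (fun z => (projM G z)ᵀ *ᵥ u z) y - tildeM G i y *ᵥ ((projM G y)ᵀ *ᵥ u y)
      = (projM G y)ᵀ *ᵥ (vpd i u y - connM (inducedMetric G) i y *ᵥ u y) := by
  rw [vpd_mulVec (hG.projM_smooth hy).transpose hu, mpd_transpose, hG.mpd_projM hy hn,
    Matrix.transpose_sub, Matrix.transpose_mul, Matrix.transpose_mul, Matrix.transpose_transpose,
    Matrix.transpose_transpose, Matrix.sub_mulVec, Matrix.mulVec_sub, Matrix.mulVec_mulVec,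
    Matrix.mulVec_mulVec]
  abel

/-- The ambient `X` is the image of the intrinsic one, so its modified derivative is the image of
`Z_i`. -/
theorem tilde_canonical (hG : MetricOn G U) (hy : slice y ∈ U) (hn : 3 ≤ n) (i : Fin n) :
    tildeM G i y *ᵥ canonicalTractor = - ((projM G y)ᵀ *ᵥ zLow G y i) := by
  have h := hG.vpd_projM_mulVec hy hn i (vsmooth_const (canonicalTractor (m := n)) y)
  have h1 : vpd i (fun z => (projM G z)ᵀ *ᵥ canonicalTractor) y = 0 := by
    ext a
    simp only [vpd, projM_transpose_mulVec_canonical]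
    exact pd_const i _
  have h2 : vpd i (fun _ : Coord n => (canonicalTractor : TIdx n → ℝ)) y = 0 := by
    ext a; exact pd_const i _
  rw [h1, h2, projM_transpose_mulVec_canonical, zero_sub, zero_sub, connM_mulVec_canonical',
    neg_neg] at h
  rw [← h, neg_neg]

/-- Derivation property of the connection on `u ∧ v`. -/
theorem mpd_wedgeM {I : Type*} [Fintype I] {m : ℕ} {x : Coord m} {u v : Coord m → I → ℝ}
    (hu : VSmooth u x) (hv : VSmooth v x) (i : Fin m) (M : Matrix I I ℝ) :
    mpd i (fun z => wedgeM (u z) (v z)) x - M * wedgeM (u x) (v x) - wedgeM (u x) (v x) * Mᵀ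
      = wedgeM (vpd i u x - M *ᵥ u x) (v x) + wedgeM (u x) (vpd i v x - M *ᵥ v x) := by
  simp only [wedgeM]
  rw [mpd_sub (hu.vecMulVec hv) (hv.vecMulVec hu), mpd_vecMulVec hu hv, mpd_vecMulVec hv hu,
    Matrix.mul_sub, Matrix.sub_mul]
  simp only [Matrix.mul_vecMulVec, Matrix.vecMulVec_mul, Matrix.vecMul_transpose,
    Matrix.vecMulVec_sub, Matrix.sub_vecMulVec]
  abel

/-- Derivative of `Γ_j` with respect to the connection `∇ - Γ^♯`. -/
theorem mpd_gam (hG : MetricOn G U) (hy : slice y ∈ U) (hn : 3 ≤ n) (i j : Fin n) :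
    mpd i (fun z => gam G z (.inr (.inl j))) y - tildeM G i y * gam G y (.inr (.inl j))
        - gam G y (.inr (.inl j)) * (tildeM G i y)ᵀ
      = wedgeM ((projM G y)ᵀ *ᵥ (vpd i (fun z => colM (matL G z) (.inr (.inl j))) y
          - connM (inducedMetric G) i y *ᵥ colM (matL G y) (.inr (.inl j)))) (normalTractorLow G y)
        + wedgeM ((projM G y)ᵀ *ᵥ (vpd i (fun z => colM (matF G z) (.inr (.inl j))) y
          - connM (inducedMetric G) i y *ᵥ colM (matF G y) (.inr (.inl j)))) canonicalTractor
        + wedgeM ((projM G y)ᵀ *ᵥ colM (matF G y) (.inr (.inl j)))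
          ((projM G y)ᵀ *ᵥ zLow G y i) := by
  have hP := (hG.projM_smooth hy).transpose
  have hL := hG.matL_col_smooth hy j
  have hF := hG.matF_col_smooth hy j
  have h1 := hP.mulVec hL
  have h2 := hP.mulVec hF
  have hN := hG.normalTractorLow_smooth hy
  have hX := vsmooth_const (canonicalTractor (m := n + 1)) y
  have e1 := mpd_wedgeM h1 hN i (tildeM G i y)
  have e2 := mpd_wedgeM h2 hX i (tildeM G i y)
  rw [hG.vpd_projM_mulVec hy hn i hL, hG.vpd_normalTractorLow hy hn, sub_self] at e1
  have hX0 : vpd i (fun _ : Coord n => (canonicalTractor : TIdx (n + 1) → ℝ)) y = 0 := by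
    ext a; exact pd_const i _
  rw [hG.vpd_projM_mulVec hy hn i hF, hX0, zero_sub, hG.tilde_canonical hy hn, neg_neg] at e2
  have hz : wedgeM ((projM G y)ᵀ *ᵥ colM (matL G y) (.inr (.inl j))) (0 : TIdx (n + 1) → ℝ) = 0 := by
    ext a b; simp [wedgeM]
  rw [hz, add_zero] at e1
  have e3 : mpd i (fun z => gam G z (.inr (.inl j))) y
      = mpd i (fun z => wedgeM ((projM G z)ᵀ *ᵥ colM (matL G z) (.inr (.inl j)))
          (normalTractorLow G z)) y
        + mpd i (fun z => wedgeM ((projM G z)ᵀ *ᵥ colM (matF G z) (.inr (.inl j)))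
          canonicalTractor) y := mpd_add (wedgeM_smooth h1 hN) (wedgeM_smooth h2 hX) i
  rw [add_assoc, ← e2, ← e1, e3, gam, Matrix.mul_add, Matrix.add_mul]
  abel

section DivTractor

variable {m : ℕ} {G : MetricFun m} {U : Set (Coord m)} {y : Coord m}
  {u : Fin m → Coord m → TIdx m → ℝ} {t : Coord m → Fin m → Fin m → ℝ}

theorem divTractor_inr_inr (hX : ∀ j, ∀ z ∈ U, u j z (.inr (.inr ())) = 0) (hU : IsOpen U)
    (hy : y ∈ U) (ht : ∀ j k, ∀ z ∈ U, u j z (.inr (.inl k)) = t z k j) (v : Unit) :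
    divTractor G u y (.inr (.inr v)) = - ∑ i, ∑ j, (G y)⁻¹ i j * t y i j := by
  rw [← Finset.sum_neg_distrib]
  refine Finset.sum_congr rfl fun i _ => ?_
  rw [← Finset.sum_neg_distrib]
  refine Finset.sum_congr rfl fun j _ => ?_
  have h1 : pd i (fun z => u j z (.inr (.inr v))) y = 0 := by
    rw [pd_congr_of_eqOn (g := fun _ => (0 : ℝ)) hU hy (fun z hz => hX j z hz), pd_const]
  rw [h1]
  simp [Matrix.mulVec, dotProduct, connM, tractorConn, hX _ _ hy, ht _ _ _ hy]

theorem divTractor_inr_inl (hG : MetricOn G U) (hX : ∀ j, ∀ z ∈ U, u j z (.inr (.inr ())) = 0)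
    (hy : y ∈ U) (ht : ∀ j k, ∀ z ∈ U, u j z (.inr (.inl k)) = t z k j)
    (hs : ∀ z ∈ U, ∀ a b, t z a b = t z b a) (k : Fin m) :
    divTractor G u y (.inr (.inl k)) = divTwo G t y k + u k y (.inl ()) := by
  have h1 : ∀ i j, pd i (fun z => u j z (.inr (.inl k))) y = pd i (fun z => t z k j) y :=
    fun i j => pd_congr_of_eqOn hG.isOpen hy (fun z hz => ht j k z hz) i
  have h2 : ∑ i, ∑ j, (G y)⁻¹ i j * (G y i k * u j y (.inl ())) = u k y (.inl ()) := by
    rw [Finset.sum_comm]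
    have : ∀ j, ∑ i, (G y)⁻¹ i j * (G y i k * u j y (.inl ()))
        = (1 : Matrix (Fin m) (Fin m) ℝ) j k * u j y (.inl ()) := by
      intro j
      rw [← hG.inv_mul hy, Matrix.mul_apply, Finset.sum_mul]
      exact Finset.sum_congr rfl fun i _ => by rw [hG.inv_symm_apply hy i j]; ring
    simp only [this, Matrix.one_apply]
    simp
  rw [divTwo_eq_of_symm G hG.isOpen hy hs, ← h2]
  simp only [← Finset.sum_add_distrib]
  refine Finset.sum_congr rfl fun i _ => Finset.sum_congr rfl fun j _ => ?_
  rw [h1, nablaTwo]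
  simp [Matrix.mulVec, dotProduct, connM, tractorConn, hX _ _ hy, ht _ _ _ hy,
    Finset.sum_add_distrib]
  ring

theorem divTractor_inl (hX : ∀ j, ∀ z ∈ U, u j z (.inr (.inr ())) = 0)
    (hy : y ∈ U) (ht : ∀ j k, ∀ z ∈ U, u j z (.inr (.inl k)) = t z k j) :
    divTractor G u y (.inl ()) = divForm G (fun z j => u j z (.inl ())) y
      - ∑ i, ∑ j, (G y)⁻¹ i j * ∑ k, (∑ l, (G y)⁻¹ k l * schouten G i l y) * t y k j := by
  simp only [divForm, ← Finset.sum_sub_distrib, ← mul_sub]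
  refine Finset.sum_congr rfl fun i _ => Finset.sum_congr rfl fun j _ => ?_
  rw [nablaForm]
  simp [Matrix.mulVec, dotProduct, connM, tractorConn, hX _ _ hy, ht _ _ _ hy]
  left
  ring

theorem divForm_neg_div {η : Coord m → Fin m → ℝ} (a : ℝ)
    (hη : VSmooth η y) : divForm G (fun z j => - η z j / a) y = - divForm G η y / a := by
  simp only [divForm, nablaForm]
  rw [← Finset.sum_neg_distrib, Finset.sum_div]
  refine Finset.sum_congr rfl fun i _ => ?_
  rw [← Finset.sum_neg_distrib, Finset.sum_div]
  refine Finset.sum_congr rfl fun j _ => ?_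
  rw [pd_div_const i a (hη j).neg, pd_neg]
  have : ∑ k, christoffel G k i j y * (- η y k / a)
      = - (∑ k, christoffel G k i j y * η y k) / a := by
    rw [← Finset.sum_neg_distrib, Finset.sum_div]
    exact Finset.sum_congr rfl fun k _ => by ring
  rw [this]; ring

end DivTractor

/-- The slots of `insertTwo` are chosen so that each divergence is a multiple of the next slot. In
weight `-1` the denominators `n - 1` and `n - 2` give the common factor `-(n - 2)`; the last slot is
the vanishing trace. -/
theorem divTractor_matL (hG : MetricOn G U) (hy : slice y ∈ U) (hn : 3 ≤ n) :
    divTractor (inducedMetric G) (fun j z => colM (matL G z) (.inr (.inl j))) y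
      = - ((n : ℝ) - 2) • colM (matL G y) (.inl ()) := by
  have hB := hG.induced
  have hr : (3 : ℝ) ≤ n := by exact_mod_cast hn
  have h1 : (n : ℝ) - 1 ≠ 0 := by linarith
  have h2 : (n : ℝ) - 2 ≠ 0 := by linarith
  have hX : ∀ j, ∀ z ∈ slice ⁻¹' U, colM (matL G z) (.inr (.inl j)) (.inr (.inr ())) = 0 :=
    fun j z _ => rfl
  have ht : ∀ j k, ∀ z ∈ slice ⁻¹' U,
      colM (matL G z) (.inr (.inl j)) (.inr (.inl k)) = tfSecondFF G z k j := fun j k z _ => rfl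
  have hs : ∀ z ∈ slice ⁻¹' U, ∀ a b, tfSecondFF G z a b = tfSecondFF G z b a :=
    fun z hz => hG.tfSecondFF_symm hz
  ext (_ | k | _)
  · rw [divTractor_inl hX hy ht]
    simp only [colM, matL_inl]
    rw [divForm_neg_div _
      (fun k => divTwo_smooth hB (x := y) hy (hG.tfSecondFF_msmooth hy) k)]
    have e : ∑ i, ∑ j, (inducedMetric G y)⁻¹ i j * ∑ k, (∑ l, (inducedMetric G y)⁻¹ k l *
        schouten (inducedMetric G) i l y) * tfSecondFF G y k j
        = ∑ i, ∑ j, ∑ k, ∑ l, (inducedMetric G y)⁻¹ i k * (inducedMetric G y)⁻¹ j l *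
          schouten (inducedMetric G) i j y * tfSecondFF G y k l := by
      simp only [Finset.mul_sum, Finset.sum_mul]
      refine Finset.sum_congr rfl fun i _ => ?_
      rw [Finset.sum_comm (s := Finset.univ (α := Fin n)) (t := Finset.univ (α := Fin n))
        (f := fun j k => ∑ l, (inducedMetric G y)⁻¹ i k * (inducedMetric G y)⁻¹ j l *
          schouten (inducedMetric G) i j y * tfSecondFF G y k l)]
      refine Finset.sum_congr rfl fun k _ => ?_
      rw [Finset.sum_comm]
      refine Finset.sum_congr rfl fun j _ => Finset.sum_congr rfl fun l _ => ?_
      rw [hB.inv_symm_apply (x := y) hy l j, hG.tfSecondFF_symm hy l k]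
      ring
    have e2 : matL G y (.inl ()) (.inl ())
        = (divForm (inducedMetric G) (divTwo (inducedMetric G) (tfSecondFF G)) y
          + ((n : ℝ) + -1) * ∑ i, ∑ j, ∑ k, ∑ l, (inducedMetric G y)⁻¹ i k *
            (inducedMetric G y)⁻¹ j l * schouten (inducedMetric G) i j y * tfSecondFF G y k l)
          / (((n : ℝ) + -1) * ((n : ℝ) + -1 - 1)) := rfl
    simp only [Pi.smul_apply, smul_eq_mul, colM]
    rw [e2, e]
    have h3 : (n : ℝ) + -1 = n - 1 := by ring
    have h4 : (n : ℝ) - 1 - 1 = n - 2 := by ring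
    rw [h3, h4]
    field_simp
    ring
  · rw [divTractor_inr_inl hB hX hy ht hs]
    have e2 : matL G y (.inr (.inl k)) (.inl ())
        = - divTwo (inducedMetric G) (tfSecondFF G) y k / ((n : ℝ) + -1) := rfl
    have h3 : (n : ℝ) + -1 = n - 1 := by ring
    simp only [Pi.smul_apply, smul_eq_mul, colM, matL_inl]
    rw [e2, h3]
    field_simp
    ring
  · rw [divTractor_inr_inr hX hB.isOpen hy ht, hG.trace_tfSecondFF hy (by omega)]
    have e2 : matL G y (.inr (.inr ())) (.inl ()) = 0 := rfl
    simp [colM, e2]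

/-- Compared with `L`, the divergence of the trace part produces the gradient of `K`, and the weight
`-2` leaves one copy of the `Y` row over, to be cancelled by `sum_wedgeM_zLow`. The `Y` slot is
omitted: it only changes the result by a multiple of `X`, so the value chosen for `F^{--}` when `n =
3` plays no role. -/
theorem divTractor_matF (hG : MetricOn G U) (hy : slice y ∈ U) (hn : 3 ≤ n) (b : Fin n ⊕ Unit) :
    divTractor (inducedMetric G) (fun j z => colM (matF G z) (.inr (.inl j))) y (.inr b)
      = - ((n : ℝ) - 2) * matF G y (.inr b) (.inl ())
        + 1 / (2 * (n * (n - 1))) * gradK G y (.inr b)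
        + Sum.elim (fun k => matF G y (.inl ()) (.inr (.inl k))) (fun _ => 0) b := by
  have hB := hG.induced
  have hr : (3 : ℝ) ≤ n := by exact_mod_cast hn
  have h0 : (n : ℝ) ≠ 0 := by linarith
  have h1 : (n : ℝ) - 1 ≠ 0 := by linarith
  have h2 : (n : ℝ) - 2 ≠ 0 := by linarith
  have hX : ∀ j, ∀ z ∈ slice ⁻¹' U, colM (matF G z) (.inr (.inl j)) (.inr (.inr ())) = 0 :=
    fun j z _ => matF_inr_inr j ()
  have ht : ∀ j k, ∀ z ∈ slice ⁻¹' U,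
      colM (matF G z) (.inr (.inl j)) (.inr (.inl k)) = fialkow G z k j := fun j k z hz =>
    hG.matF_inr_inl hz hn j k
  have hs : ∀ z ∈ slice ⁻¹' U, ∀ a b, fialkow G z a b = fialkow G z b a :=
    fun z hz => hG.fialkow_symm hz
  rcases b with k | _
  · rw [divTractor_inr_inl hB hX hy ht hs, gradK_inr_inl]
    have e2 : matF G y (.inr (.inl k)) (.inl ())
        = - divTwo (inducedMetric G) (tfFialkow G) y k / ((n : ℝ) - 2) := by
      have : matF G y (.inr (.inl k)) (.inl ())
        = - divTwo (inducedMetric G) (tfFialkow G) y k / ((n : ℝ) + -2)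
          + rigidity G y / (2 * n * (n - 1)) * 0 := rfl
      rw [this, mul_zero, add_zero, ← sub_eq_add_neg]
    have hKs : ContDiffAt ℝ ∞ (fun z => rigidity G z / (2 * n * (n - 1))) y :=
      (hG.rigidity_smooth hy).div_const _
    have e3 : divTwo (inducedMetric G) (fialkow G) y k
        = divTwo (inducedMetric G) (tfFialkow G) y k
          + pd k (fun z => rigidity G z) y / (2 * n * (n - 1)) := by
      have hsp : ∀ i a b, nablaTwo (inducedMetric G) (fialkow G) i a b y
          = nablaTwo (inducedMetric G) (tfFialkow G) i a b y
            + pd i (fun z => rigidity G z) y / (2 * n * (n - 1)) * inducedMetric G y a b := by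
        intro i a b
        -- The full Fialkow tensor is split into its trace-free part and `K ḡ / (2n(n-1))`.
        have hHG : MSmooth (fun z => Matrix.of fun a b =>
            rigidity G z / (2 * n * (n - 1)) * inducedMetric G z a b) y :=
          fun a b => hKs.mul (hB.smooth y hy a b)
        have := nablaTwo_add (inducedMetric G) (s := tfFialkow G)
          (fun a b => hG.tfFialkow_smooth hy a b) hHG i a b
        rw [hB.nablaTwo_smul_metric (x := y) hy hKs, pd_div_const i _ (hG.rigidity_smooth hy)] at this
        rw [← this]
        have hf : ∀ z ∈ slice ⁻¹' U, ∀ p q, fialkow G z p q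
            = tfFialkow G z p q + rigidity G z / (2 * n * (n - 1)) * inducedMetric G z p q :=
          fun z hz p q => by rw [hG.tfFialkow_eq hz hn]; ring
        simp only [nablaTwo]
        rw [pd_congr_of_eqOn hB.isOpen hy (fun z hz => hf z hz a b) i]
        simp only [hf y hy]
      simp only [divTwo, hsp, mul_add, Finset.sum_add_distrib]
      congr 1
      have : ∀ i, ∑ j, (inducedMetric G y)⁻¹ i j * (pd i (fun z => rigidity G z) y /
          (2 * n * (n - 1)) * inducedMetric G y j k)
          = pd i (fun z => rigidity G z) y / (2 * n * (n - 1)) *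
            (1 : Matrix (Fin n) (Fin n) ℝ) i k := by
        intro i
        rw [← hB.inv_mul (x := y) hy, Matrix.mul_apply, Finset.mul_sum]
        exact Finset.sum_congr rfl fun j _ => by ring
      simp only [this, Matrix.one_apply]
      simp
    simp only [Sum.elim_inl, colM]
    rw [e3, e2]
    field_simp
  · rw [divTractor_inr_inr hX hB.isOpen hy ht, hG.trace_fialkow hy hn, gradK_inr_inr]
    have e2 : matF G y (.inr (.inr ())) (.inl ())
        = 0 + rigidity G y / (2 * n * (n - 1)) * 1 := rfl
    rw [e2, Sum.elim_inr]
    field_simp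
    ring

end MetricOn

end DivGamma

/-! ### The divergence of `Γ_i` -/

section DivergenceGamma

variable {n r : ℕ} {G : MetricFun (n + 1)} {U : Set (Coord (n + 1))} {y : Coord n}

/-- `u ↦ (P^T u) ∧ v`. -/
def wedgeL (P : Matrix (TIdx n) (TIdx (n + 1)) ℝ) (v : TIdx (n + 1) → ℝ) :
    (TIdx n → ℝ) →ₗ[ℝ] Matrix (TIdx (n + 1)) (TIdx (n + 1)) ℝ where
  toFun u := wedgeM (Pᵀ *ᵥ u) v
  map_add' u u' := by
    rw [wedgeM, wedgeM, wedgeM, Matrix.mulVec_add, Matrix.add_vecMulVec, Matrix.vecMulVec_add]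
    abel
  map_smul' a u := by
    rw [wedgeM, wedgeM, Matrix.mulVec_smul, Matrix.smul_vecMulVec, Matrix.vecMulVec_smul,
      RingHom.id_apply, smul_sub]

theorem wedgeL_apply (P : Matrix (TIdx n) (TIdx (n + 1)) ℝ) (v : TIdx (n + 1) → ℝ)
    (u : TIdx n → ℝ) : wedgeM (Pᵀ *ᵥ u) v = wedgeL P v u := rfl

theorem divTractor_eq_sum {m : ℕ} (G : MetricFun m) (u : Fin m → Coord m → TIdx m → ℝ)
    (y : Coord m) : divTractor G u y = ∑ i, ∑ j, (G y)⁻¹ i j • (vpd i (u j) y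
      - connM G i y *ᵥ u j y - ∑ k, christoffel G k i j y • u k y) := by
  ext b
  simp only [divTractor, vpd, Finset.sum_apply, Pi.smul_apply, Pi.sub_apply, smul_eq_mul]

theorem wedgeM_mulVec (P : Matrix (TIdx n) (TIdx (n + 1)) ℝ) (u v : TIdx n → ℝ) :
    wedgeM (Pᵀ *ᵥ u) (Pᵀ *ᵥ v) = Pᵀ * wedgeM u v * P := by
  simp only [wedgeM, Matrix.mul_sub, Matrix.sub_mul, Matrix.mul_vecMulVec, Matrix.vecMulVec_mul,
    Matrix.mulVec_transpose]

/-- The term of `∇^i Γ_i` in which `X` is differentiated. Its tangential block is the skew part of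
the symmetric Fialkow tensor and vanishes, so only the `Y` row of `F` survives. -/
theorem MetricOn.sum_wedgeM_zLow (hG : MetricOn G U) (hy : slice y ∈ U) (hn : 3 ≤ n) :
    ∑ i, ∑ j, (inducedMetric G y)⁻¹ i j • wedgeM (colM (matF G y) (.inr (.inl j))) (zLow G y i)
      = - wedgeM (Sum.elim (fun _ => 0) (Sum.elim (fun k => matF G y (.inl ()) (.inr (.inl k)))
          fun _ => 0)) (canonicalTractor : TIdx n → ℝ) := by
  have key : ∀ b c, ∑ i, ∑ j, (inducedMetric G y)⁻¹ i j *
      (colM (matF G y) (.inr (.inl j)) b * zLow G y i c)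
      = Sum.elim (fun _ => 0) (Sum.elim (fun k => matF G y b (.inr (.inl k))) fun _ => 0) c := by
    intro b c
    rcases c with _ | k | _
    · simp [zLow]
    · simp only [zLow, Sum.elim_inr, Sum.elim_inl, colM]
      rw [Finset.sum_comm]
      have : ∀ j, ∑ i, (inducedMetric G y)⁻¹ i j * (matF G y b (.inr (.inl j)) *
          inducedMetric G y i k) = (1 : Matrix (Fin n) (Fin n) ℝ) j k *
            matF G y b (.inr (.inl j)) := by
        intro j
        rw [← hG.induced.inv_mul (x := y) hy, Matrix.mul_apply, Finset.sum_mul]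
        exact Finset.sum_congr rfl fun i _ => by
          rw [hG.induced.inv_symm_apply (x := y) hy i j]; ring
      simp only [this, Matrix.one_apply]
      simp
    · simp [zLow]
  ext b c
  have : (∑ i, ∑ j, (inducedMetric G y)⁻¹ i j •
      wedgeM (colM (matF G y) (.inr (.inl j))) (zLow G y i)) b c
      = ∑ i, ∑ j, (inducedMetric G y)⁻¹ i j * (colM (matF G y) (.inr (.inl j)) b * zLow G y i c)
        - ∑ i, ∑ j, (inducedMetric G y)⁻¹ i j *
          (colM (matF G y) (.inr (.inl j)) c * zLow G y i b) := by
    simp only [Matrix.sum_apply, ← Finset.sum_sub_distrib]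
    refine Finset.sum_congr rfl fun i _ => Finset.sum_congr rfl fun j _ => ?_
    simp only [Matrix.smul_apply, wedgeM, Matrix.sub_apply, Matrix.vecMulVec_apply, smul_eq_mul]
    ring
  rw [this, key, key]
  rcases b with _ | b | _ <;> rcases c with _ | c | _ <;>
    simp [wedgeM, Matrix.vecMulVec_apply, canonicalTractor, matF_inr_inr, hG.matF_inr_inl hy hn]
  rw [hG.fialkow_symm hy, sub_self]

/-- Divergence of the tractor-valued one-form `Γ_i`. -/
theorem MetricOn.sum_mpd_gam (hG : MetricOn G U) (hy : slice y ∈ U) (hn : 3 ≤ n) :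
    ∑ i, ∑ j, (inducedMetric G y)⁻¹ i j • (mpd i (fun z => gam G z (.inr (.inl j))) y
        - tildeM G i y * gam G y (.inr (.inl j)) - gam G y (.inr (.inl j)) * (tildeM G i y)ᵀ
        - ∑ k, christoffel (inducedMetric G) k i j y • gam G y (.inr (.inl k)))
      = - ((n : ℝ) - 2) • gam G y (.inl ())
        + (1 / (2 * ((n : ℝ) * (n - 1)))) • wedgeM ((projM G y)ᵀ *ᵥ gradK G y)
          canonicalTractor := by
  have h1 : wedgeL (projM G y) canonicalTractor canonicalTractor = 0 := by
    rw [← wedgeL_apply, MetricOn.projM_transpose_mulVec_canonical, wedgeM, sub_self]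
  have h2 := congrArg (fun A => (projM G y)ᵀ * A * projM G y) (hG.sum_wedgeM_zLow hy hn)
  simp only [Matrix.mul_sum, Matrix.sum_mul, Matrix.mul_smul, Matrix.smul_mul, ← wedgeM_mulVec,
    Matrix.mul_neg, Matrix.neg_mul, MetricOn.projM_transpose_mulVec_canonical] at h2
  set g : TIdx n → ℝ := Sum.elim (fun _ => 0)
    (Sum.elim (fun k => matF G y (.inl ()) (.inr (.inl k))) fun _ => 0)
  have hL := congrArg (wedgeL (projM G y) (normalTractorLow G y)) (hG.divTractor_matL hy hn)
  -- The unspecified `Y` slot is collected in a multiple `s` of `X`, which `∧ X` annihilates. This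
  -- also makes the `X` part of `D̂̄K` irrelevant.
  obtain ⟨s, hs⟩ : ∃ s : ℝ,
      divTractor (inducedMetric G) (fun j z => colM (matF G z) (.inr (.inl j))) y
        = - ((n : ℝ) - 2) • colM (matF G y) (.inl ()) + (1 / (2 * ((n : ℝ) * (n - 1)))) • gradK G y
          + g + s • canonicalTractor := by
    refine ⟨divTractor (inducedMetric G) (fun j z => colM (matF G z) (.inr (.inl j))) y (.inl ())
      + ((n : ℝ) - 2) * matF G y (.inl ()) (.inl ())
      - 1 / (2 * ((n : ℝ) * (n - 1))) * gradK G y (.inl ()), ?_⟩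
    ext (_ | b)
    · simp only [Pi.add_apply, Pi.smul_apply, smul_eq_mul, colM, g, Sum.elim_inl, canonicalTractor]
      ring
    · rw [hG.divTractor_matF hy hn b]
      rcases b with b | b <;> simp [g, colM, canonicalTractor]
  have hF := congrArg (wedgeL (projM G y) canonicalTractor) hs
  rw [divTractor_eq_sum] at hL hF
  simp only [map_sum, map_smul, map_sub, map_add, h1, smul_zero, add_zero] at hL hF
  have e : ∀ i j, mpd i (fun z => gam G z (.inr (.inl j))) y
        - tildeM G i y * gam G y (.inr (.inl j)) - gam G y (.inr (.inl j)) * (tildeM G i y)ᵀ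
        - ∑ k, christoffel (inducedMetric G) k i j y • gam G y (.inr (.inl k))
      = (wedgeL (projM G y) (normalTractorLow G y)
            (vpd i (fun z => colM (matL G z) (.inr (.inl j))) y)
          - wedgeL (projM G y) (normalTractorLow G y)
            (connM (inducedMetric G) i y *ᵥ colM (matL G y) (.inr (.inl j)))
          - ∑ k, christoffel (inducedMetric G) k i j y •
            wedgeL (projM G y) (normalTractorLow G y) (colM (matL G y) (.inr (.inl k))))
        + (wedgeL (projM G y) canonicalTractor
            (vpd i (fun z => colM (matF G z) (.inr (.inl j))) y)
          - wedgeL (projM G y) canonicalTractor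
            (connM (inducedMetric G) i y *ᵥ colM (matF G y) (.inr (.inl j)))
          - ∑ k, christoffel (inducedMetric G) k i j y •
            wedgeL (projM G y) canonicalTractor (colM (matF G y) (.inr (.inl k))))
        + wedgeM ((projM G y)ᵀ *ᵥ colM (matF G y) (.inr (.inl j)))
          ((projM G y)ᵀ *ᵥ zLow G y i) := by
    intro i j
    rw [hG.mpd_gam hy hn, wedgeL_apply, wedgeL_apply, map_sub, map_sub]
    simp only [gam, wedgeL_apply, smul_add, Finset.sum_add_distrib]
    abel
  simp only [e, smul_add, Finset.sum_add_distrib]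
  -- The surplus `g ∧ X` from the divergence of `F` cancels against the term from `∇X = Z`.
  rw [hL, hF, h2, wedgeL_apply, wedgeL_apply, gam, wedgeL_apply, wedgeL_apply, smul_add]
  abel

end DivergenceGamma

/-! ### Locality and additivity of covariant derivatives -/

section Cov

variable {m r : ℕ} {I : Type*} [Fintype I] [DecidableEq I] {x : Coord m} {A : Coord m → Matrix I I ℝ}
  {V W : Coord m → (Fin r → I) → ℝ}

theorem VSmooth.cov (hA : MSmooth A x) (hV : VSmooth V x) (i : Fin m) : VSmooth (cov i A V) x :=
  fun β => (contDiffAt_pd i (hV β)).sub (VSmooth.der hA hV β)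

theorem cov_add (hV : VSmooth V x) (hW : VSmooth W x) (i : Fin m) :
    cov i A (fun z => V z + W z) x = cov i A V x + cov i A W x := by
  have : vpd i (fun z => V z + W z) x = vpd i V x + vpd i W x := by
    funext β; exact pd_add i (hV β) (hW β)
  rw [cov, cov, cov, this, der_add_right]
  abel

theorem cov_congr_of_eqOn {U : Set (Coord m)} (hU : IsOpen U) (hx : x ∈ U)
    (h : ∀ z ∈ U, V z = W z) (i : Fin m) : cov i A V x = cov i A W x := by
  have : vpd i V x = vpd i W x := by
    funext β; exact pd_congr_of_eqOn hU hx (fun z hz => congrFun (h z hz) β) i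
  rw [cov, cov, this, h x hx]

end Cov

/-! ### The Laplacian along the hypersurface -/

section SliceLaplacian

variable {n r : ℕ} {G : MetricFun (n + 1)} {U : Set (Coord (n + 1))} {y : Coord n}
  {D : Set (Coord n)} {T : TField n r}

/-- The endomorphism `Γ_i` of the ambient tractors. -/
def gamEnd (G : MetricFun (n + 1)) (i : Fin n) (y : Coord n) :
    Matrix (TIdx (n + 1)) (TIdx (n + 1)) ℝ :=
  gam G y (.inr (.inl i)) * metricM (G (slice y))⁻¹

/-- The ambient tractor connection along the hypersurface. -/
def covS (G : MetricFun (n + 1)) (i : Fin n) (V : Coord n → TTensor (n + 1) r) (y : Coord n) :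
    TTensor (n + 1) r :=
  cov i (fun z => connM G i.succ (slice z)) V y

theorem covS_eq (i : Fin n) (V : Coord n → TTensor (n + 1) r) :
    covS G i V y = cov i (tildeM G i) V y + der (gamEnd G i y) (V y) := by
  rw [covS, cov, cov, tildeM, gamEnd, der_add_left]
  abel

namespace MetricOn

theorem gamEnd_smooth (hG : MetricOn G U) (hy : slice y ∈ U) (i : Fin n) :
    MSmooth (gamEnd G i) y := (hG.gam_smooth hy i).mul (hG.metricM_inv_slice_smooth hy)

/-- Because the tractor metric is parallel, raising an index commutes with the modified derivative.
-/
theorem mpd_gamEnd (hG : MetricOn G U) (hy : slice y ∈ U) (i j : Fin n) :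
    mpd i (gamEnd G j) y - (tildeM G i y * gamEnd G j y - gamEnd G j y * tildeM G i y)
      = (mpd i (fun z => gam G z (.inr (.inl j))) y - tildeM G i y * gam G y (.inr (.inl j))
        - gam G y (.inr (.inl j)) * (tildeM G i y)ᵀ) * metricM (G (slice y))⁻¹ := by
  have : mpd i (gamEnd G j) y = _ :=
    mpd_mul (hG.gam_smooth hy j) (hG.metricM_inv_slice_smooth hy) i
  rw [this, hG.mpd_metricM_inv_slice hy, gamEnd]
  noncomm_ring

theorem cov_tilde_pull (hG : MetricOn G U) (hy : slice y ∈ U) (hn : 3 ≤ n) (hT : VSmooth T y)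
    (i : Fin n) : cov i (tildeM G i) (fun z => pull (projM G z) (T z)) y
      = pull (projM G y) (tractorNabla (inducedMetric G) i T y) := by
  rw [tractorNabla_eq_cov]
  exact cov_pull (P := projM G) (A := tildeM G i) (B := connM (inducedMetric G) i)
    (hG.projM_smooth hy) hT i (hG.mpd_projM hy hn i)

/-- The Gauss formula on tensors: the modified connection passes through the parallel
identification, and `Γ_i^♯` is added back. -/
theorem covS_pull (hG : MetricOn G U) (hy : slice y ∈ U) (hn : 3 ≤ n) (hT : VSmooth T y)
    (i : Fin n) : covS G i (fun z => pull (projM G z) (T z)) y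
      = pull (projM G y) (tractorNabla (inducedMetric G) i T y)
        + der (gamEnd G i y) (pull (projM G y) (T y)) := by
  rw [covS_eq, hG.cov_tilde_pull hy hn hT]

theorem tractorNabla_smooth {m : ℕ} {G : MetricFun m} {U : Set (Coord m)} {x : Coord m}
    (hG : MetricOn G U) (hx : x ∈ U) {V : TField m r} (hV : VSmooth V x) (i : Fin m) :
    VSmooth (tractorNabla G i V) x := VSmooth.cov (hG.connM_smooth hx i) hV i

/-- The Gauss formula holds throughout the open set `D`, so it may be differentiated again; the
Leibniz rule `cov_der` produces the derivative of `Γ_j` and the cross terms. -/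
theorem covS_covS_pull (hG : MetricOn G U) (hn : 3 ≤ n) (hD : IsOpen D)
    (hDU : ∀ z ∈ D, slice z ∈ U) (hT : ∀ z ∈ D, VSmooth T z) (hy : y ∈ D) (i j : Fin n) :
    covS G i (covS G j (fun z => pull (projM G z) (T z))) y
      = pull (projM G y) (tractorNabla (inducedMetric G) i
          (tractorNabla (inducedMetric G) j T) y)
        + der ((mpd i (fun z => gam G z (.inr (.inl j))) y
          - tildeM G i y * gam G y (.inr (.inl j))
          - gam G y (.inr (.inl j)) * (tildeM G i y)ᵀ) * metricM (G (slice y))⁻¹)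
            (pull (projM G y) (T y))
        + der (gamEnd G j y) (pull (projM G y) (tractorNabla (inducedMetric G) i T y))
        + der (gamEnd G i y) (pull (projM G y) (tractorNabla (inducedMetric G) j T y))
        + der (gamEnd G i y) (der (gamEnd G j y) (pull (projM G y) (T y))) := by
  have hyU := hDU y hy
  have hP := hG.projM_smooth hyU
  have hN : VSmooth (tractorNabla (inducedMetric G) j T) y :=
    hG.induced.tractorNabla_smooth (x := y) hyU (hT y hy) j
  have hW : VSmooth (fun z => pull (projM G z) (T z)) y := VSmooth.pull hP (hT y hy)
  have hO := hG.gamEnd_smooth hyU j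
  have h1 : covS G i (covS G j (fun z => pull (projM G z) (T z))) y
      = covS G i (fun z => pull (projM G z) (tractorNabla (inducedMetric G) j T z)
        + der (gamEnd G j z) (pull (projM G z) (T z))) y :=
    cov_congr_of_eqOn hD hy (fun z hz => hG.covS_pull (hDU z hz) hn (hT z hz) j) i
  rw [h1, covS_eq, cov_add (VSmooth.pull hP hN) (VSmooth.der hO hW), hG.cov_tilde_pull hyU hn hN,
    cov_der i _ hO hW, hG.mpd_gamEnd hyU, hG.cov_tilde_pull hyU hn (hT y hy), der_add_right]
  abel

/-- The Laplacian of an ambient tractor along the hypersurface. -/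
theorem sum_covS_covS_pull (hG : MetricOn G U) (hn : 3 ≤ n) (hD : IsOpen D)
    (hDU : ∀ z ∈ D, slice z ∈ U) (hT : ∀ z ∈ D, VSmooth T z) (hy : y ∈ D) :
    ∑ i, ∑ j, (inducedMetric G y)⁻¹ i j •
        (covS G i (covS G j (fun z => pull (projM G z) (T z))) y
          - ∑ k, christoffel (inducedMetric G) k i j y •
            covS G k (fun z => pull (projM G z) (T z)) y)
      = pull (projM G y) (tractorLaplacian (inducedMetric G) T y)
        + (2 : ℝ) • ∑ i, ∑ j, (inducedMetric G y)⁻¹ i j • der (gamEnd G i y)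
          (pull (projM G y) (tractorNabla (inducedMetric G) j T y))
        + ∑ i, ∑ j, (inducedMetric G y)⁻¹ i j • der (gamEnd G i y)
          (der (gamEnd G j y) (pull (projM G y) (T y)))
        - ((n : ℝ) - 2) • der (gam G y (.inl ()) * metricM (G (slice y))⁻¹)
          (pull (projM G y) (T y))
        + (1 / (2 * ((n : ℝ) * (n - 1)))) • der (wedgeM ((projM G y)ᵀ *ᵥ gradK G y)
          canonicalTractor * metricM (G (slice y))⁻¹) (pull (projM G y) (T y)) := by
  have hyU := hDU y hy
  have hdiv := congrArg (fun M => der (M * metricM (G (slice y))⁻¹) (pull (projM G y) (T y)))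
    (hG.sum_mpd_gam hyU hn)
  simp only [Matrix.sum_mul, Matrix.add_mul, Matrix.smul_mul, der_sum_left, der_smul_left,
    der_add_left, neg_smul, Matrix.neg_mul, der_neg_left] at hdiv
  have hlap : tractorLaplacian (inducedMetric G) T y = ∑ i, ∑ j, (inducedMetric G y)⁻¹ i j •
      (tractorNabla (inducedMetric G) i (tractorNabla (inducedMetric G) j T) y
        - ∑ k, christoffel (inducedMetric G) k i j y • tractorNabla (inducedMetric G) k T y) := by
    funext β
    simp only [tractorLaplacian, Finset.sum_apply, Pi.smul_apply, Pi.sub_apply, smul_eq_mul]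
  -- The two cross terms agree after tracing with the symmetric `ḡ⁻¹`, whence the factor 2.
  have hsw : ∑ i, ∑ j, (inducedMetric G y)⁻¹ i j • der (gamEnd G j y)
        (pull (projM G y) (tractorNabla (inducedMetric G) i T y))
      = ∑ i, ∑ j, (inducedMetric G y)⁻¹ i j • der (gamEnd G i y)
        (pull (projM G y) (tractorNabla (inducedMetric G) j T y)) := by
    rw [Finset.sum_comm]
    exact Finset.sum_congr rfl fun i _ => Finset.sum_congr rfl fun j _ => by
      rw [hG.induced.inv_symm_apply (x := y) hyU j i]
  have e : ∀ i j, covS G i (covS G j (fun z => pull (projM G z) (T z))) y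
          - ∑ k, christoffel (inducedMetric G) k i j y •
            covS G k (fun z => pull (projM G z) (T z)) y
      = pull (projM G y) (tractorNabla (inducedMetric G) i (tractorNabla (inducedMetric G) j T) y
        - ∑ k, christoffel (inducedMetric G) k i j y • tractorNabla (inducedMetric G) k T y)
        + der ((mpd i (fun z => gam G z (.inr (.inl j))) y
          - tildeM G i y * gam G y (.inr (.inl j))
          - gam G y (.inr (.inl j)) * (tildeM G i y)ᵀ
          - ∑ k, christoffel (inducedMetric G) k i j y • gam G y (.inr (.inl k)))
            * metricM (G (slice y))⁻¹) (pull (projM G y) (T y))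
        + der (gamEnd G j y) (pull (projM G y) (tractorNabla (inducedMetric G) i T y))
        + der (gamEnd G i y) (pull (projM G y) (tractorNabla (inducedMetric G) j T y))
        + der (gamEnd G i y) (der (gamEnd G j y) (pull (projM G y) (T y))) := by
    intro i j
    rw [hG.covS_covS_pull hn hD hDU hT hy]
    generalize mpd i (fun z => gam G z (.inr (.inl j))) y - tildeM G i y * gam G y (.inr (.inl j))
      - gam G y (.inr (.inl j)) * (tildeM G i y)ᵀ = B
    rw [pull_sub, Matrix.sub_mul, der_sub_left, pull_sum,
      Matrix.sum_mul, der_sum_left]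
    simp only [hG.covS_pull hyU hn (hT y hy), pull_smul, Matrix.smul_mul, der_smul_left, smul_add,
      Finset.sum_add_distrib, gamEnd]
    abel
  simp only [e, smul_add, Finset.sum_add_distrib]
  rw [hdiv, hsw, hlap]
  simp only [pull_sum, pull_smul]
  rw [two_smul]
  abel

end MetricOn

end SliceLaplacian

/-! ### The tangential Thomas operator along the hypersurface -/

section AmbientSide

variable {n r m : ℕ} {G : MetricFun (n + 1)} {U : Set (Coord (n + 1))} {y : Coord n}
  {D : Set (Coord n)} {V : TField (n + 1) r} {W : Coord n → TTensor (n + 1) r}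

/-- Second covariant derivative of a tractor. -/
def hess (G : MetricFun m) (V : TField m r) (a b : Fin m) (x : Coord m) : TTensor m r :=
  tractorNabla G a (tractorNabla G b V) x - ∑ c, christoffel G c a b x • tractorNabla G c V x

theorem tractorLaplacian_eq (G : MetricFun m) (V : TField m r) (x : Coord m) :
    tractorLaplacian G V x = ∑ a, ∑ b, (G x)⁻¹ a b • hess G V a b x := by
  funext β
  simp only [tractorLaplacian, hess, Finset.sum_apply, Pi.smul_apply, Pi.sub_apply, smul_eq_mul]

/-- The Laplacian of a tractor along the hypersurface. -/
def lapS (G : MetricFun (n + 1)) (W : Coord n → TTensor (n + 1) r) (y : Coord n) :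
    TTensor (n + 1) r :=
  ∑ i, ∑ j, (inducedMetric G y)⁻¹ i j • (covS G i (covS G j W) y
    - ∑ k, christoffel (inducedMetric G) k i j y • covS G k W y)

theorem tractorNabla_slice (hV : VSmooth V (slice y)) (i : Fin n) :
    tractorNabla G i.succ V (slice y) = covS G i (fun z => V (slice z)) y := by
  funext β
  have h := pd_comp_slice (y := y) i (hV β)
  rw [tractorNabla_eq_cov, covS, cov, cov, Pi.sub_apply, Pi.sub_apply, vpd, vpd, h]

/-- Derivative in the direction of the normal. -/
def nablaN (G : MetricFun (n + 1)) (V : TField (n + 1) r) (y : Coord n) : TTensor (n + 1) r :=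
  ∑ a, normal G y a • tractorNabla G a V (slice y)

theorem tractorNabla_cons (G : MetricFun m) (a : Fin m) (Q : TField m (r + 1)) (x : Coord m)
    (c : TIdx m) (β : Fin r → TIdx m) :
    tractorNabla G a Q x (Fin.cons c β)
      = tractorNabla G a (fun z γ => Q z (Fin.cons c γ)) x β
        - ∑ e, tractorConn G a x e c * Q x (Fin.cons e β) := by
  rw [tractorNabla_eq_cov, tractorNabla_eq_cov, cov, cov, Pi.sub_apply, Pi.sub_apply, der_cons]
  simp only [connM, Matrix.of_apply, vpd]
  ring

theorem thomasHat_inl (G : MetricFun m) (w : ℝ) (V : TField m r) (x : Coord m) (u : Unit)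
    (β : Fin r → TIdx m) : thomasHat G w V x (Fin.cons (.inl u) β)
      = - (tractorLaplacian G V x β + w * schoutenTrace G x * V x β) / ((m : ℝ) + 2 * w - 2) := rfl

theorem thomasHat_inr_inl (G : MetricFun m) (w : ℝ) (V : TField m r) (x : Coord m) (i : Fin m)
    (β : Fin r → TIdx m) : thomasHat G w V x (Fin.cons (.inr (.inl i)) β)
      = tractorNabla G i V x β := rfl

theorem thomasHat_inr_inr (G : MetricFun m) (w : ℝ) (V : TField m r) (x : Coord m) (u : Unit)
    (β : Fin r → TIdx m) : thomasHat G w V x (Fin.cons (.inr (.inr u)) β) = w * V x β := rfl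

/-- The Christoffel part of the coupling completes the Hessian. The neighbouring slots of `D̂V`
enter through the metric and the Schouten tensor. -/
theorem tractorNabla_thomasHat_inr_inl (G : MetricFun m) (w : ℝ) (V : TField m r) (x : Coord m)
    (a b : Fin m) (β : Fin r → TIdx m) :
    tractorNabla G a (thomasHat G w V) x (Fin.cons (.inr (.inl b)) β)
      = hess G V a b x β + G x a b * thomasHat G w V x (Fin.cons (.inl ()) β)
        + w * schouten G a b x * V x β := by
  rw [tractorNabla_cons, sum_TIdx]
  simp only [thomasHat_inr_inl, thomasHat_inr_inr, tractorConn, hess, Pi.sub_apply,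
    Finset.sum_apply, Pi.smul_apply, smul_eq_mul]
  have : tractorNabla G a (fun z γ => tractorNabla G b V z γ) x β
      = tractorNabla G a (tractorNabla G b V) x β := rfl
  rw [this]
  ring

theorem tractorNabla_const_mul {x : Coord m} (G : MetricFun m) (w : ℝ) {V : TField m r}
    (hV : VSmooth V x) (a : Fin m) (β : Fin r → TIdx m) :
    tractorNabla G a (fun z γ => w * V z γ) x β = w * tractorNabla G a V x β := by
  simp only [tractorNabla]
  rw [pd_const_mul a w (hV β), mul_sub, Finset.mul_sum]
  congr 1
  refine Finset.sum_congr rfl fun k _ => ?_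
  rw [Finset.mul_sum]
  exact Finset.sum_congr rfl fun γ _ => by ring

/-- The connection subtracts one copy of `∇_a V` from the derivative of `w V`. -/
theorem tractorNabla_thomasHat_inr_inr {x : Coord m} (G : MetricFun m) (w : ℝ) {V : TField m r}
    (hV : VSmooth V x) (a : Fin m) (u : Unit) (β : Fin r → TIdx m) :
    tractorNabla G a (thomasHat G w V) x (Fin.cons (.inr (.inr u)) β)
      = (w - 1) * tractorNabla G a V x β := by
  rw [tractorNabla_cons, sum_TIdx]
  simp only [thomasHat_inr_inl, thomasHat_inr_inr, tractorConn,
    tractorNabla_const_mul G w hV]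
  simp
  ring

namespace MetricOn

theorem tractorNabla_tractorNabla_slice (hG : MetricOn G U) (hy : slice y ∈ U)
    (hV : ∀ x ∈ U, VSmooth V x) (i j : Fin n) :
    tractorNabla G i.succ (tractorNabla G j.succ V) (slice y)
      = covS G i (covS G j (fun z => V (slice z))) y := by
  rw [tractorNabla_slice (hG.tractorNabla_smooth hy (hV _ hy) _)]
  exact cov_congr_of_eqOn (isOpen_preimage_slice hG.isOpen) hy
    (fun z hz => tractorNabla_slice (hV _ hz) j) i

/-- Tangential part of the second derivative of an ambient tractor. -/
theorem hess_slice (hG : MetricOn G U) (hy : slice y ∈ U) (hV : ∀ x ∈ U, VSmooth V x)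
    (i j : Fin n) :
    hess G V i.succ j.succ (slice y) = covS G i (covS G j (fun z => V (slice z))) y
      - ∑ k, christoffel (inducedMetric G) k i j y • covS G k (fun z => V (slice z)) y
      + secondFF G y i j • nablaN G V y := by
  rw [hess, hG.tractorNabla_tractorNabla_slice hy hV, nablaN, Fin.sum_univ_succ,
    Fin.sum_univ_succ, hG.christoffel_zero hy]
  simp only [hG.christoffel_succ hy, tractorNabla_slice (hV _ hy), sub_smul, mul_smul, neg_smul,
    Finset.sum_sub_distrib, Finset.smul_sum, smul_add]
  abel

/-- Split the trace as `ḡ⁻¹ + n ⊗ n`; the `II` term in the tangential Hessian contributes its trace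
`nH` times the normal derivative. -/
theorem tractorLaplacian_slice (hG : MetricOn G U) (hy : slice y ∈ U)
    (hV : ∀ x ∈ U, VSmooth V x) (hn : n ≠ 0) :
    tractorLaplacian G V (slice y) = lapS G (fun z => V (slice z)) y
      + (n * meanCurv G y) • nablaN G V y
      + ∑ a, ∑ b, (normal G y a * normal G y b) • hess G V a b (slice y) := by
  have h1 : ∑ i, ∑ j, (inducedMetric G y)⁻¹ i j • secondFF G y i j • nablaN G V y
      = (n * meanCurv G y) • nablaN G V y := by
    rw [← sum_inv_mul_secondFF hn]
    simp only [smul_smul, Finset.sum_smul]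
  rw [tractorLaplacian_eq, ← h1, lapS]
  simp only [← Finset.sum_add_distrib, ← smul_add, ← hG.hess_slice hy hV]
  funext β
  have := hG.sum_inv_mul hy (fun a b => hess G V a b (slice y) β)
  simpa only [Pi.add_apply, Finset.sum_apply, Pi.smul_apply, smul_eq_mul] using this

theorem sum_inv_mul_schouten_eq {G : MetricFun m} {U : Set (Coord m)} {x : Coord m}
    (hG : MetricOn G U) (hx : x ∈ U) (hm : 3 ≤ m) :
    ∑ i, ∑ j, (G x)⁻¹ i j * schouten G i j x = schoutenTrace G x := by
  have hr : (3 : ℝ) ≤ m := by exact_mod_cast hm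
  have h1 : (m : ℝ) - 1 ≠ 0 := by linarith
  have h2 : (m : ℝ) - 2 ≠ 0 := by linarith
  have e : ∀ i j, (G x)⁻¹ i j * schouten G i j x = ((G x)⁻¹ i j * ricci G i j x
      - schoutenTrace G x * ((G x)⁻¹ i j * G x i j)) / ((m : ℝ) - 2) := fun i j => by
    rw [schouten]; ring
  simp only [e, ← Finset.sum_div, Finset.sum_sub_distrib, ← Finset.mul_sum]
  have e2 : ∑ i, ∑ j, (G x)⁻¹ i j * ricci G i j x = scal G x := rfl
  rw [hG.sum_inv_mul_metric hx, e2, schoutenTrace]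
  field_simp
  ring

/-- The left-hand side is the tangential trace of `P`, which the known trace of the Fialkow tensor
compares with `J̄`. -/
theorem schoutenTrace_slice (hG : MetricOn G U) (hy : slice y ∈ U) (hn : 3 ≤ n) :
    schoutenTrace G (slice y)
      - ∑ a, ∑ b, normal G y a * normal G y b * schouten G a b (slice y)
      = schoutenTrace (inducedMetric G) y + rigidity G y / (2 * ((n : ℝ) - 1))
        - n * meanCurv G y ^ 2 / 2 := by
  rw [← hG.trace_fialkow hy hn, ← hG.sum_inv_mul_schouten_eq hy (by omega),
    hG.sum_inv_mul hy (fun a b => schouten G a b (slice y)), add_sub_cancel_right,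
    ← hG.induced.sum_inv_mul_schouten_eq (x := y) hy hn]
  have h1 := hG.trace_tfSecondFF hy (by omega)
  have h2 := hG.induced.sum_inv_mul_metric (x := y) hy
  have e : ∀ i j, (inducedMetric G y)⁻¹ i j * fialkow G y i j
      = (inducedMetric G y)⁻¹ i j * schouten G i.succ j.succ (slice y)
        - (inducedMetric G y)⁻¹ i j * schouten (inducedMetric G) i j y
        + meanCurv G y * ((inducedMetric G y)⁻¹ i j * tfSecondFF G y i j)
        + 1 / 2 * meanCurv G y ^ 2 * ((inducedMetric G y)⁻¹ i j * inducedMetric G y i j) := by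
    intro i j; rw [fialkow]; ring
  simp only [e, Finset.sum_add_distrib, Finset.sum_sub_distrib, ← Finset.mul_sum, h1, h2]
  ring

/-- `N^A` has no `Y` component, so contracting with `N` never picks up the slot of `D̂` that carries
the Laplacian. -/
theorem sum_normalTractor_mul (f : TIdx (n + 1) → ℝ) :
    ∑ B, normalTractor G y B * f B = ∑ a, normal G y a * f (.inr (.inl a))
      - meanCurv G y * f (.inr (.inr ())) := by
  rw [sum_TIdx]
  simp only [normalTractor]
  ring

theorem sum_normalTractor_thomasHat (w : ℝ) (β : Fin r → TIdx (n + 1)) :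
    ∑ B, normalTractor G y B * thomasHat G w V (slice y) (Fin.cons B β)
      = nablaN G V y β - meanCurv G y * (w * V (slice y) β) := by
  rw [sum_normalTractor_mul]
  simp only [thomasHat_inr_inl, thomasHat_inr_inr, nablaN, Finset.sum_apply, Pi.smul_apply,
    smul_eq_mul]

theorem sum_normal_metric (hG : MetricOn G U) (hy : slice y ∈ U) :
    ∑ a, ∑ b, normal G y a * normal G y b * G (slice y) a b = 1 := by
  have : ∀ a, ∑ b, normal G y a * normal G y b * G (slice y) a b
      = conormal G (slice y) a * normal G y a := fun a => by
    rw [← hG.metric_normal hy a, Finset.sum_mul]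
    exact Finset.sum_congr rfl fun b _ => by ring
  simp only [this]
  rw [sum_conormal_mul, hG.conormal_mul_normal hy]

/-- The Laplacian of the inner operator reappears once, through the metric coefficient in the
derivative of its middle slot and `|n|² = 1`. The outer operator contributes only first derivatives
and weights. -/
theorem sum_normalTractor_thomasHat_thomasHat (hG : MetricOn G U) (hy : slice y ∈ U)
    (hV : VSmooth V (slice y)) (w : ℝ) (β : Fin r → TIdx (n + 1)) :
    ∑ B, ∑ C, normalTractor G y B * normalTractor G y C *
        thomasHat G (w - 1) (thomasHat G w V) (slice y) (Fin.cons B (Fin.cons C β))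
      = ∑ a, ∑ b, normal G y a * normal G y b * hess G V a b (slice y) β
        + thomasHat G w V (slice y) (Fin.cons (.inl ()) β)
        + w * (∑ a, ∑ b, normal G y a * normal G y b * schouten G a b (slice y)) *
          V (slice y) β
        - 2 * meanCurv G y * (w - 1) * nablaN G V y β
        + meanCurv G y ^ 2 * (w * (w - 1)) * V (slice y) β := by
  simp only [mul_assoc, ← Finset.mul_sum]
  rw [sum_normalTractor_mul]
  simp only [thomasHat_inr_inl, thomasHat_inr_inr]
  have h1 : ∀ a, ∑ C, normalTractor G y C * tractorNabla G a (thomasHat G w V) (slice y)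
      (Fin.cons C β) = ∑ b, normal G y b * (hess G V a b (slice y) β
        + G (slice y) a b * thomasHat G w V (slice y) (Fin.cons (.inl ()) β)
        + w * schouten G a b (slice y) * V (slice y) β)
        - meanCurv G y * ((w - 1) * tractorNabla G a V (slice y) β) := by
    intro a
    rw [sum_normalTractor_mul]
    simp only [tractorNabla_thomasHat_inr_inl, tractorNabla_thomasHat_inr_inr G w hV]
  have h2 : ∑ C, normalTractor G y C * ((w - 1) * thomasHat G w V (slice y) (Fin.cons C β))
      = (w - 1) * (nablaN G V y β - meanCurv G y * (w * V (slice y) β)) := by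
    rw [← sum_normalTractor_thomasHat, Finset.mul_sum]
    exact Finset.sum_congr rfl fun _ _ => by ring
  have h3 : ∑ a, normal G y a * tractorNabla G a V (slice y) β = nablaN G V y β := by
    simp only [nablaN, Finset.sum_apply, Pi.smul_apply, smul_eq_mul]
  have h4 : ∀ a, normal G y a * (∑ b, normal G y b * (hess G V a b (slice y) β
        + G (slice y) a b * thomasHat G w V (slice y) (Fin.cons (.inl ()) β)
        + w * schouten G a b (slice y) * V (slice y) β)
        - meanCurv G y * ((w - 1) * tractorNabla G a V (slice y) β))
      = ∑ b, normal G y a * normal G y b * hess G V a b (slice y) β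
        + (∑ b, normal G y a * normal G y b * G (slice y) a b) *
          thomasHat G w V (slice y) (Fin.cons (.inl ()) β)
        + (∑ b, normal G y a * normal G y b * schouten G a b (slice y)) *
          (w * V (slice y) β)
        - normal G y a * tractorNabla G a V (slice y) β * (meanCurv G y * (w - 1)) := by
    intro a
    rw [mul_sub, Finset.mul_sum, Finset.sum_mul, Finset.sum_mul, ← Finset.sum_add_distrib,
      ← Finset.sum_add_distrib]
    congr 1
    · exact Finset.sum_congr rfl fun b _ => by ring
    · ring
  simp only [h1, h2, h4]
  simp only [Finset.sum_add_distrib, Finset.sum_sub_distrib, ← Finset.sum_mul, h3,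
    hG.sum_normal_metric hy]
  simp only [mul_assoc, Finset.mul_sum]
  ring

/-- The bottom slot of the tangential Thomas operator. -/
theorem tangentialThomas_inl (hG : MetricOn G U) (hy : slice y ∈ U) (hn : 3 ≤ n)
    (hV : ∀ x ∈ U, VSmooth V x) {w : ℝ} (hw₁ : (n : ℝ) + 2 * w - 1 ≠ 0)
    (hw₂ : (n : ℝ) + 2 * w - 2 ≠ 0) (u : Unit) (β : Fin r → TIdx (n + 1)) :
    tangentialThomas G w V y (Fin.cons (.inl u) β)
      = - (lapS G (fun z => V (slice z)) y β
          + w * (schoutenTrace (inducedMetric G) y - rigidity G y / (2 * ((n : ℝ) - 1))) *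
            V (slice y) β) / ((n : ℝ) + 2 * w - 2)
        - 1 / 2 * w * meanCurv G y ^ 2 * V (slice y) β := by
  have hr : (3 : ℝ) ≤ n := by exact_mod_cast hn
  have h1 : (n : ℝ) - 1 ≠ 0 := by linarith
  have hlap := congrFun (hG.tractorLaplacian_slice hy hV (by omega)) β
  simp only [Pi.add_apply, Pi.smul_apply, smul_eq_mul, Finset.sum_apply] at hlap
  have hJ := hG.schoutenTrace_slice hy hn
  have hdd := hG.sum_normalTractor_thomasHat_thomasHat hy (hV _ hy) w β
  have e : tangentialThomas G w V y (Fin.cons (.inl u) β)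
      = thomasHat G w V (slice y) (Fin.cons (.inl ()) β)
        - normalTractorLow G y (.inl ()) *
          ∑ B, normalTractor G y B * thomasHat G w V (slice y) (Fin.cons B β)
        + 1 / ((n : ℝ) + 1 + 2 * w - 3) * ((∑ B, ∑ C, normalTractor G y B * normalTractor G y C *
          thomasHat G (w - 1) (thomasHat G w V) (slice y) (Fin.cons B (Fin.cons C β)))
          + w * rigidity G y / ((n : ℝ) + 1 - 2) * V (slice y) β) := rfl
  rw [e, hdd, sum_normalTractor_thomasHat, normalTractorLow_inl, thomasHat_inl, hlap]
  generalize ∑ a, ∑ b, normal G y a * normal G y b * schouten G a b (slice y) = P at *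
  generalize ∑ a, ∑ b, normal G y a * normal G y b * hess G V a b (slice y) β = Q at *
  rw [eq_add_of_sub_eq hJ]
  have e1 : (n : ℝ) + 1 + 2 * w - 3 = n + 2 * w - 2 := by ring
  have e2 : (n : ℝ) + 1 - 2 = n - 1 := by ring
  have e3 : ((n + 1 : ℕ) : ℝ) + 2 * w - 2 = n + 2 * w - 1 := by push_cast; ring
  rw [e1, e2, e3]
  -- The bottom slot of `D̂V` occurs with total factor `1 + 1/E = E'/E`, which replaces its
  -- denominator `E'` by `E`. The normal Hessian `Q` then cancels, and the normal derivative has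
  -- coefficient `-n + E - 2(w-1) = 0`.
  obtain ⟨E, hE⟩ : ∃ E, E = (n : ℝ) + 2 * w - 2 := ⟨_, rfl⟩
  obtain ⟨E', hE'⟩ : ∃ E', E' = (n : ℝ) + 2 * w - 1 := ⟨_, rfl⟩
  rw [← hE] at hw₂ ⊢
  rw [← hE'] at hw₁ ⊢
  field_simp
  subst hE hE'
  ring

end MetricOn

end AmbientSide

/-! ### The right-hand side in the adapted frame -/

section GaussSide

variable {n r m : ℕ} {G : MetricFun (n + 1)} {U : Set (Coord (n + 1))} {y : Coord n}
  {D : Set (Coord n)} {V : TField (n + 1) r} {T : TField n r}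

/-- Turns contractions with the ambient inverse metric into contractions with the intrinsic one,
through `projM_metricM_inv`. -/
theorem sum_sandwich {I J : Type*} [Fintype I] [Fintype J] (h : Matrix I I ℝ) (P : Matrix J I ℝ)
    (f : J → J → ℝ) :
    ∑ B, ∑ C, h B C * ∑ e, ∑ b, P e B * P b C * f e b
      = ∑ e, ∑ b, (P * h * Pᵀ) e b * f e b := by
  simp only [Matrix.mul_apply, Matrix.transpose_apply, Finset.mul_sum, Finset.sum_mul]
  calc ∑ B, ∑ C, ∑ e, ∑ b, h B C * (P e B * P b C * f e b)
      = ∑ B, ∑ e, ∑ b, ∑ C, h B C * (P e B * P b C * f e b) :=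
        Finset.sum_congr rfl fun B _ => by
          rw [Finset.sum_comm]
          exact Finset.sum_congr rfl fun e _ => Finset.sum_comm
    _ = ∑ e, ∑ b, ∑ B, ∑ C, h B C * (P e B * P b C * f e b) := by
        rw [Finset.sum_comm]
        exact Finset.sum_congr rfl fun e _ => Finset.sum_comm
    _ = _ := Finset.sum_congr rfl fun e _ => Finset.sum_congr rfl fun b _ => by
        rw [Finset.sum_comm]
        exact Finset.sum_congr rfl fun _ _ => Finset.sum_congr rfl fun _ _ => by ring

theorem colM_matL_inr_inr (u : Unit) : colM (matL G y) (.inr (.inr u)) = 0 := by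
  ext (_ | k | _) <;> rfl

theorem colM_matF_inr_inr (u : Unit) : colM (matF G y) (.inr (.inr u))
    = (rigidity G y / (2 * n * (n - 1))) • canonicalTractor := by
  ext (_ | k | _)
  · show 0 + rigidity G y / (2 * n * (n - 1)) * 1 = rigidity G y / (2 * n * (n - 1)) * 1
    rw [zero_add]
  · show 0 + rigidity G y / (2 * n * (n - 1)) * 0 = rigidity G y / (2 * n * (n - 1)) * 0
    rw [zero_add]
  · show 0 + rigidity G y / (2 * n * (n - 1)) * 0 = rigidity G y / (2 * n * (n - 1)) * 0
    rw [zero_add]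

/-- `X^A Γ_A = 0`: `L` annihilates `X`, and the `X` column of the corrected `F` is a multiple of
`X`, killed by `∧ X`. -/
theorem gam_inr_inr (u : Unit) : gam G y (.inr (.inr u)) = 0 := by
  rw [gam, colM_matL_inr_inr, colM_matF_inr_inr, wedgeL_apply, wedgeL_apply, map_zero, map_smul,
    ← wedgeL_apply, MetricOn.projM_transpose_mulVec_canonical, wedgeM, sub_self, smul_zero,
    add_zero]

namespace MetricOn

theorem projM_mul_metricM_inv (hG : MetricOn G U) (hy : slice y ∈ U) :
    projM G y * metricM (G (slice y))⁻¹ = metricM (inducedMetric G y)⁻¹ * frameM G y := by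
  have := congrArg Matrix.transpose (hG.metricM_inv_mul_projM hy)
  rwa [Matrix.transpose_mul, Matrix.transpose_mul, Matrix.transpose_transpose,
    Matrix.transpose_transpose, hG.metricM_inv_symm hy,
    metricM_symm (hG.induced.inv_symm (x := y) hy)] at this

/-- The endomorphism `Γ_e` in the hypersurface frame. -/
theorem projM_mul_gam (hG : MetricOn G U) (hy : slice y ∈ U) (e : TIdx n) :
    projM G y * metricM (G (slice y))⁻¹ * (gam G y e * metricM (G (slice y))⁻¹) * (projM G y)ᵀ
      = Matrix.vecMulVec (metricM (inducedMetric G y)⁻¹ *ᵥ colM (matF G y) e) canonicalUp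
        - Matrix.vecMulVec canonicalUp (metricM (inducedMetric G y)⁻¹ *ᵥ colM (matF G y) e) := by
  have h : frameM G y * (gam G y e * metricM (G (slice y))⁻¹) * (projM G y)ᵀ
      = Matrix.vecMulVec (colM (matF G y) e) canonicalUp
        - Matrix.vecMulVec canonicalTractor
          (metricM (inducedMetric G y)⁻¹ *ᵥ colM (matF G y) e) := by
    rw [gam, Matrix.add_mul, Matrix.mul_add, hG.frameM_mul_wedgeM_normal hy,
      hG.frameM_mul_wedgeM_canonical hy, Matrix.add_mul, Matrix.sub_mul, Matrix.vecMulVec_mul,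
      Matrix.vecMulVec_mul, Matrix.vecMulVec_mul, Matrix.vecMul_transpose,
      Matrix.vecMul_transpose, Matrix.vecMul_transpose, hG.projM_mulVec_normal hy,
      projM_mulVec_canonicalUp, Matrix.mulVec_mulVec _ (projM G y), hG.projM_mul_frameM hy,
      Matrix.one_mulVec, Matrix.vecMulVec_zero, zero_add]
  rw [hG.projM_mul_metricM_inv hy, Matrix.mul_assoc, Matrix.mul_assoc, ← Matrix.mul_assoc (frameM G y),
    h, Matrix.mul_sub, Matrix.mul_vecMulVec, Matrix.mul_vecMulVec, metricM_mulVec_canonical]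

/-- With `κ = K / (2n(n-1))`, the Fialkow trace gives `nκ` and the two pairings of `Y` with `X` give
`κ` each. -/
theorem trace_matF (hG : MetricOn G U) (hy : slice y ∈ U) (hn : 3 ≤ n) :
    ∑ e, (metricM (inducedMetric G y)⁻¹ *ᵥ colM (matF G y) e) e
      = ((n : ℝ) + 2) * (rigidity G y / (2 * n * (n - 1))) := by
  have hr : (3 : ℝ) ≤ n := by exact_mod_cast hn
  have h0 : (n : ℝ) ≠ 0 := by linarith
  have h1 : (n : ℝ) - 1 ≠ 0 := by linarith
  have h2 := hG.trace_fialkow hy hn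
  have e1 : matF G y (.inr (.inr ())) (.inl ()) = 0 + rigidity G y / (2 * n * (n - 1)) * 1 := rfl
  have e2 : matF G y (.inl ()) (.inr (.inr ())) = 0 + rigidity G y / (2 * n * (n - 1)) * 1 := rfl
  have h3 : ∑ k, ∑ l, (inducedMetric G y)⁻¹ k l * fialkow G y l k
      = rigidity G y / (2 * ((n : ℝ) - 1)) := by
    rw [← h2]
    exact Finset.sum_congr rfl fun k _ => Finset.sum_congr rfl fun l _ => by
      rw [hG.fialkow_symm hy]
  rw [sum_TIdx]
  simp only [Matrix.mulVec, dotProduct, sum_TIdx, metricM, Matrix.of_apply, tractorMetric, colM,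
    zero_mul, one_mul, Finset.sum_const_zero, zero_add, add_zero, hG.matF_inr_inl hy hn, h3, e1, e2]
  field_simp
  ring

theorem sharp_gammaTractor (hG : MetricOn G U) (hy : slice y ∈ U) (A : TIdx (n + 1))
    (t : TTensor (n + 1) r) :
    sharp (tractorMetric (G (slice y))⁻¹) (gammaTractor G y A) t
      = ∑ e, projM G y e A • der (gam G y e * metricM (G (slice y))⁻¹) t := by
  rw [sharp_eq_der, hG.gammaTractor_eq hy, Matrix.sum_mul, der_sum_left]
  refine Finset.sum_congr rfl fun e _ => ?_
  rw [Matrix.smul_mul, der_smul_left]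
  rfl

/-- Contraction `Γ^{B ♯} Q_B`, the action including the index `B`. -/
theorem sum_sharp_gammaTractor (hG : MetricOn G U) (hy : slice y ∈ U) (hn : 3 ≤ n)
    {Q : TTensor (n + 1) (r + 1)} {δ : TIdx n → TTensor (n + 1) r}
    (hQ : ∀ c β, Q (Fin.cons c β) = ∑ b, projM G y b c * δ b β) (β : Fin r → TIdx (n + 1)) :
    ∑ B, ∑ C, tractorMetric (G (slice y))⁻¹ B C *
        sharp (tractorMetric (G (slice y))⁻¹) (gammaTractor G y B) Q (Fin.cons C β)
      = ((n : ℝ) + 1) * (rigidity G y / (2 * n * (n - 1))) * δ (.inr (.inr ())) β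
        + der (gam G y (.inl ()) * metricM (G (slice y))⁻¹) (δ (.inr (.inr ()))) β
        + ∑ i, ∑ j, (inducedMetric G y)⁻¹ i j * der (gamEnd G i y) (δ (.inr (.inl j))) β := by
  set hi := metricM (G (slice y))⁻¹ with hhi
  have hQ' : ∀ C, (fun γ => Q (Fin.cons C γ)) = ∑ b, projM G y b C • δ b := fun C => by
    funext γ; rw [hQ, Finset.sum_apply]; rfl
  -- The action on the contracted index and the action on the remaining indices are separated.
  have h1 : ∀ B C, sharp (tractorMetric (G (slice y))⁻¹) (gammaTractor G y B) Q (Fin.cons C β)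
      = ∑ e, ∑ b, projM G y e B * (gam G y e * hi * (projM G y)ᵀ) C b * δ b β
        + ∑ e, ∑ b, projM G y e B * projM G y b C * der (gam G y e * hi) (δ b) β := by
    intro B C
    rw [hG.sharp_gammaTractor hy, Finset.sum_apply, ← Finset.sum_add_distrib]
    refine Finset.sum_congr rfl fun e _ => ?_
    rw [Pi.smul_apply, smul_eq_mul, der_cons, hQ', der_sum_right, mul_add, Finset.sum_apply]
    congr 1
    · simp only [hQ, Matrix.mul_apply (M := gam G y e * hi), Finset.mul_sum, Finset.sum_mul,
        Matrix.transpose_apply]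
      rw [Finset.sum_comm]
      exact Finset.sum_congr rfl fun _ _ => Finset.sum_congr rfl fun _ _ => by ring
    · rw [Finset.mul_sum]
      refine Finset.sum_congr rfl fun b _ => ?_
      rw [der_smul_right, Pi.smul_apply, smul_eq_mul]
      ring
  have h2 : ∑ B, ∑ C, hi B C *
      ∑ e, ∑ b, projM G y e B * (gam G y e * hi * (projM G y)ᵀ) C b * δ b β
      = ∑ b, (∑ e, (projM G y * hi * (gam G y e * hi) * (projM G y)ᵀ) e b) * δ b β := by
    have : ∀ e b, (projM G y * hi * (gam G y e * hi) * (projM G y)ᵀ) e b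
        = ∑ B, ∑ C, projM G y e B * hi B C * (gam G y e * hi * (projM G y)ᵀ) C b := by
      intro e b
      rw [Matrix.mul_assoc (projM G y * hi), Matrix.mul_apply]
      simp only [Matrix.mul_apply (M := projM G y), Finset.sum_mul]
      exact Finset.sum_comm
    simp only [this, Finset.mul_sum, Finset.sum_mul]
    calc ∑ B, ∑ C, ∑ e, ∑ b, hi B C *
          (projM G y e B * (gam G y e * hi * (projM G y)ᵀ) C b * δ b β)
        = ∑ B, ∑ b, ∑ e, ∑ C, hi B C *
          (projM G y e B * (gam G y e * hi * (projM G y)ᵀ) C b * δ b β) :=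
          Finset.sum_congr rfl fun B _ => by
            rw [Finset.sum_comm]
            rw [Finset.sum_comm (s := Finset.univ (α := TIdx n)) (t := Finset.univ (α := TIdx n))]
            exact Finset.sum_congr rfl fun e _ => Finset.sum_comm
      _ = ∑ b, ∑ e, ∑ B, ∑ C, hi B C *
          (projM G y e B * (gam G y e * hi * (projM G y)ᵀ) C b * δ b β) := by
          rw [Finset.sum_comm]
          exact Finset.sum_congr rfl fun e _ => Finset.sum_comm
      _ = _ := Finset.sum_congr rfl fun b _ => Finset.sum_congr rfl fun e _ =>
          Finset.sum_congr rfl fun B _ => Finset.sum_congr rfl fun C _ => by ring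
  -- In units of `K / (2n(n-1))`: the trace of `F` gives `n + 2`, the other half of the wedge
  -- subtracts `1`. The `L ∧ N` part disappears on projecting to `N^⊥`.
  have h3 : ∀ b, ∑ e, (projM G y * hi * (gam G y e * hi) * (projM G y)ᵀ) e b
      = ((n : ℝ) + 1) * (rigidity G y / (2 * n * (n - 1))) * canonicalUp b := by
    intro b
    have hX : ∑ e, (canonicalUp : TIdx n → ℝ) e *
        (metricM (inducedMetric G y)⁻¹ *ᵥ colM (matF G y) e) b
        = rigidity G y / (2 * n * (n - 1)) * canonicalUp b := by
      rw [sum_TIdx]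
      simp only [canonicalUp, zero_mul, Finset.sum_const_zero, zero_add, one_mul,
        colM_matF_inr_inr, Matrix.mulVec_smul, metricM_mulVec_canonical, Pi.smul_apply, smul_eq_mul]
    simp only [hG.projM_mul_gam hy, hhi, Matrix.sub_apply, Matrix.vecMulVec_apply,
      Finset.sum_sub_distrib, ← Finset.sum_mul, hX, hG.trace_matF hy hn]
    ring
  have h4 : ∑ B, ∑ C, hi B C *
      ∑ e, ∑ b, projM G y e B * projM G y b C * der (gam G y e * hi) (δ b) β
      = ∑ e, ∑ b, metricM (inducedMetric G y)⁻¹ e b * der (gam G y e * hi) (δ b) β := by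
    rw [sum_sandwich, hhi, hG.projM_metricM_inv hy]
  -- The inverse tractor metric pairs `Y` with `X`, and of these two terms the one with `Γ_X`
  -- vanishes.
  have h5 : ∑ e, ∑ b, metricM (inducedMetric G y)⁻¹ e b * der (gam G y e * hi) (δ b) β
      = der (gam G y (.inl ()) * hi) (δ (.inr (.inr ()))) β
        + ∑ i, ∑ j, (inducedMetric G y)⁻¹ i j * der (gamEnd G i y) (δ (.inr (.inl j))) β := by
    simp only [sum_TIdx, gam_inr_inr, metricM, Matrix.of_apply, tractorMetric,
      der_zero_left, Pi.zero_apply, mul_zero, zero_mul, Finset.sum_const_zero, zero_add, add_zero,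
      one_mul, gamEnd]
    rfl
  have h6 : ∑ b, ((n : ℝ) + 1) * (rigidity G y / (2 * n * (n - 1))) * canonicalUp b * δ b β
      = ((n : ℝ) + 1) * (rigidity G y / (2 * n * (n - 1))) * δ (.inr (.inr ())) β := by
    rw [sum_TIdx]
    simp [canonicalUp]
  have h7 : ∀ B C, tractorMetric (G (slice y))⁻¹ B C = hi B C := fun _ _ => rfl
  simp only [h1, h7, mul_add, Finset.sum_add_distrib]
  rw [h2, h4, h5]
  simp only [h3]
  rw [h6, add_assoc]

theorem ambient_thomasHat (w : ℝ) (c : TIdx (n + 1)) (β : Fin r → TIdx (n + 1)) :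
    ambient G y (thomasHat (inducedMetric G) w T y) (Fin.cons c β)
      = ∑ b, projM G y b c *
        pull (projM G y) (fun γ => thomasHat (inducedMetric G) w T y (Fin.cons b γ)) β := by
  rw [ambient_eq_pull, pull_cons]

theorem pull_thomasHat_inr_inr (w : ℝ) (u : Unit) :
    pull (projM G y) (fun γ => thomasHat (inducedMetric G) w T y (Fin.cons (.inr (.inr u)) γ))
      = w • pull (projM G y) (T y) := by
  rw [← pull_smul]; rfl

theorem pull_thomasHat_inr_inl (w : ℝ) (i : Fin n) :
    pull (projM G y) (fun γ => thomasHat (inducedMetric G) w T y (Fin.cons (.inr (.inl i)) γ))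
      = pull (projM G y) (tractorNabla (inducedMetric G) i T y) := rfl

theorem pull_thomasHat_inl (w : ℝ) (u : Unit) :
    pull (projM G y) (fun γ => thomasHat (inducedMetric G) w T y (Fin.cons (.inl u) γ))
      = (-1 / ((n : ℝ) + 2 * w - 2)) • (pull (projM G y) (tractorLaplacian (inducedMetric G) T y)
        + (w * schoutenTrace (inducedMetric G) y) • pull (projM G y) (T y)) := by
  rw [← pull_smul, ← pull_add, ← pull_smul]
  congr 1
  funext γ
  rw [thomasHat_inl]
  simp only [Pi.smul_apply, Pi.add_apply, smul_eq_mul]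
  ring

/-- Reconciles the two conventions: `wedge` carries a factor ½ that `wedgeM` does not. -/
theorem sharp_wedge (DK : TIdx (n + 1) → ℝ) (A : Matrix (Fin (n + 1)) (Fin (n + 1)) ℝ)
    (t : TTensor (n + 1) r) :
    sharp (tractorMetric A) (wedge DK canonicalTractor) t
      = (1 / 2 : ℝ) • der (wedgeM DK canonicalTractor * metricM A) t := by
  rw [sharp_eq_der, ← der_smul_left, ← Matrix.smul_mul]
  congr 2
  ext B C
  simp only [wedge, wedgeM, Matrix.of_apply, Matrix.smul_apply, Matrix.sub_apply,
    Matrix.vecMulVec_apply, smul_eq_mul]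
  ring

/-- The right-hand side of the Gauß–Thomas formula in the adapted frame. -/
theorem gaussThomas_eq (hG : MetricOn G U) (hy : slice y ∈ U) (hn : 3 ≤ n) (w : ℝ)
    (A : TIdx (n + 1)) (β : Fin r → TIdx (n + 1)) :
    gaussThomas G w T y (Fin.cons A β)
      = ∑ b, projM G y b A * (pull (projM G y)
          (fun γ => thomasHat (inducedMetric G) w T y (Fin.cons b γ)) β
          + der (gam G y b * metricM (G (slice y))⁻¹) (pull (projM G y) (T y)) β)
        - canonicalTractor A / ((n : ℝ) + 2 * w - 2) *
          (2 * (((n : ℝ) + 1) * (rigidity G y / (2 * n * (n - 1))) *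
              (w * pull (projM G y) (T y) β)
              + w * der (gam G y (.inl ()) * metricM (G (slice y))⁻¹) (pull (projM G y) (T y)) β
              + ∑ i, ∑ j, (inducedMetric G y)⁻¹ i j * der (gamEnd G i y)
                (pull (projM G y) (tractorNabla (inducedMetric G) j T y)) β)
            + ∑ i, ∑ j, (inducedMetric G y)⁻¹ i j * der (gamEnd G i y)
                (der (gamEnd G j y) (pull (projM G y) (T y))) β
            + 1 / ((n : ℝ) * (n - 1)) * (1 / 2 * der (wedgeM ((projM G y)ᵀ *ᵥ gradK G y)
              canonicalTractor * metricM (G (slice y))⁻¹) (pull (projM G y) (T y)) β)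
            - (3 * (n : ℝ) + 2) * w * rigidity G y / (2 * n * (n - 1)) *
              pull (projM G y) (T y) β) := by
  have hDK : (fun B => ambient G y (thomasHat (inducedMetric G) (-2)
      (fun z (_ : Fin 0 → TIdx n) => rigidity G z) y) ![B]) = (projM G y)ᵀ *ᵥ gradK G y := by
    funext B
    exact pull_one _ _ _
  have hΓ : ∀ c (β : Fin r → TIdx (n + 1)), sharp (tractorMetric (G (slice y))⁻¹)
      (gammaTractor G y c) (ambient G y (T y)) β = ∑ b, projM G y b c *
        der (gam G y b * metricM (G (slice y))⁻¹) (pull (projM G y) (T y)) β := fun c β => by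
    rw [hG.sharp_gammaTractor hy, Finset.sum_apply]; rfl
  have h1 := hG.sum_sharp_gammaTractor hy hn
    (δ := fun b => pull (projM G y) fun γ => thomasHat (inducedMetric G) w T y (Fin.cons b γ))
    (fun c β => ambient_thomasHat w c β) β
  have h2 := hG.sum_sharp_gammaTractor hy hn
    (Q := fun γ => sharp (tractorMetric (G (slice y))⁻¹) (gammaTractor G y (γ 0))
      (ambient G y (T y)) (Fin.tail γ))
    (δ := fun b => der (gam G y b * metricM (G (slice y))⁻¹) (pull (projM G y) (T y)))
    (fun c β => hΓ c β) β
  simp only [pull_thomasHat_inr_inr, pull_thomasHat_inr_inl, der_smul_right, Pi.smul_apply,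
    smul_eq_mul] at h1
  -- For `Γ^{B♯} Γ_B^♯ T` the inner factor in direction `X` is zero, which leaves only the
  -- tangential contraction.
  simp only [gam_inr_inr, Matrix.zero_mul, der_zero_left, der_zero_right, Pi.zero_apply, mul_zero,
    zero_add] at h2
  have e : gaussThomas G w T y (Fin.cons A β)
      = ambient G y (thomasHat (inducedMetric G) w T y) (Fin.cons A β)
        + sharp (tractorMetric (G (slice y))⁻¹) (gammaTractor G y A) (ambient G y (T y)) β
        - canonicalTractor A / ((n : ℝ) + 2 * w - 2) *
      (2 * (∑ B, ∑ C, tractorMetric (G (slice y))⁻¹ B C *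
            sharp (tractorMetric (G (slice y))⁻¹) (gammaTractor G y B)
            (ambient G y (thomasHat (inducedMetric G) w T y)) (Fin.cons C β))
        + (∑ B, ∑ C, tractorMetric (G (slice y))⁻¹ B C *
            sharp (tractorMetric (G (slice y))⁻¹) (gammaTractor G y B)
            (fun γ => sharp (tractorMetric (G (slice y))⁻¹) (gammaTractor G y (γ 0))
              (ambient G y (T y)) (Fin.tail γ)) (Fin.cons C β))
        + 1 / ((n : ℝ) * (n - 1)) * sharp (tractorMetric (G (slice y))⁻¹)
            (wedge (fun B => ambient G y (thomasHat (inducedMetric G) (-2)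
              (fun z (_ : Fin 0 → TIdx n) => rigidity G z) y) ![B]) canonicalTractor)
            (ambient G y (T y)) β
        - (3 * (n : ℝ) + 2) * w * rigidity G y / (2 * n * (n - 1)) * ambient G y (T y) β) := rfl
  rw [e, h1, h2, hDK, hΓ, ambient_thomasHat, sharp_wedge, ← Finset.sum_add_distrib]
  simp only [← mul_add]
  rfl

end MetricOn

end GaussSide

/-! ### The Gauß–Thomas formula in adapted coordinates -/

section LocalTheorem

variable {n r m : ℕ} {G : MetricFun (n + 1)} {U : Set (Coord (n + 1))} {y : Coord n}
  {D : Set (Coord n)} {V : TField (n + 1) r} {T : TField n r}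

theorem covS_congr_of_eqOn (hD : IsOpen D) (hy : y ∈ D) {V W : Coord n → TTensor (n + 1) r}
    (h : ∀ z ∈ D, V z = W z) (i : Fin n) : covS G i V y = covS G i W y :=
  cov_congr_of_eqOn hD hy h i

theorem lapS_congr_of_eqOn (hD : IsOpen D) (hy : y ∈ D) {V W : Coord n → TTensor (n + 1) r}
    (h : ∀ z ∈ D, V z = W z) : lapS G V y = lapS G W y := by
  have h1 : ∀ z ∈ D, ∀ j, covS G j V z = covS G j W z := fun z hz j =>
    covS_congr_of_eqOn hD hz h j
  simp only [lapS, h1 y hy, covS_congr_of_eqOn hD hy (fun z hz => h1 z hz _)]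

namespace MetricOn

/-- Decomposition of a covector along the hypersurface. -/
theorem sum_projM_mul (hG : MetricOn G U) (hy : slice y ∈ U) (v : Fin (n + 1) → ℝ)
    (a : Fin (n + 1)) :
    ∑ i : Fin n, projM G y (.inr (.inl i)) (.inr (.inl a)) * v i.succ
      = v a - conormal G (slice y) a * ∑ b, normal G y b * v b := by
  have h := hG.conormal_mul_normal hy
  simp only [projM, Matrix.of_apply, tractorProj]
  refine Fin.cases ?_ (fun j => ?_) a
  · rw [Fin.sum_univ_succ]
    simp only [Fin.succ_ne_zero, if_false, zero_sub, neg_mul, Finset.sum_neg_distrib, mul_add,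
      Finset.mul_sum]
    have : ∀ i : Fin n, normal G y i.succ * conormal G (slice y) 0 * v i.succ
        = conormal G (slice y) 0 * (normal G y i.succ * v i.succ) := fun i => by ring
    simp only [this]
    linear_combination v 0 * h
  · simp [conormal_succ]

/-- The new tractor index is tested on `Y`, `Z_a` and `X`. On `X` both sides are `wV`, on `Z_a` the
claim is the tractor Gauss formula, and on `Y` it compares Laplacians. -/
theorem tangentialThomas_eq_gaussThomas (hG : MetricOn G U) (hn : 3 ≤ n) (hD : IsOpen D)
    (hDU : ∀ z ∈ D, slice z ∈ U) (hV : ∀ x ∈ U, VSmooth V x) (hT : ∀ z ∈ D, VSmooth T z)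
    (hVT : ∀ z ∈ D, V (slice z) = ambient G z (T z)) {w : ℝ} (hw₁ : (n : ℝ) + 2 * w - 1 ≠ 0)
    (hw₂ : (n : ℝ) + 2 * w - 2 ≠ 0) (hy : y ∈ D) :
    tangentialThomas G w V y = gaussThomas G w T y := by
  have hyU := hDU y hy
  have hr : (3 : ℝ) ≤ n := by exact_mod_cast hn
  have h0 : (n : ℝ) ≠ 0 := by linarith
  have h1 : (n : ℝ) - 1 ≠ 0 := by linarith
  have hW : V (slice y) = pull (projM G y) (T y) := by rw [hVT y hy, ambient_eq_pull]
  have hVW : ∀ z ∈ D, V (slice z) = pull (projM G z) (T z) := fun z hz => by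
    rw [hVT z hz, ambient_eq_pull]
  have hN : ∀ i : Fin n, tractorNabla G i.succ V (slice y)
      = pull (projM G y) (tractorNabla (inducedMetric G) i T y)
        + der (gamEnd G i y) (pull (projM G y) (T y)) := fun i => by
    rw [tractorNabla_slice (hV _ hyU), covS_congr_of_eqOn hD hy hVW,
      hG.covS_pull hyU hn (hT y hy)]
  funext α
  obtain ⟨A, β, rfl⟩ : ∃ A β, α = Fin.cons A β := ⟨α 0, Fin.tail α, (Fin.cons_self_tail α).symm⟩
  rw [hG.gaussThomas_eq hyU hn]
  rcases A with _ | a | _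
  · have p1 : projM G y (.inl ()) (.inl ‹Unit›) = 1 := rfl
    have p2 : ∀ i, projM G y (.inr (.inl i)) (.inl ‹Unit›) = 0 := fun _ => rfl
    have p3 : projM G y (.inr (.inr ())) (.inl ‹Unit›) = - (1 / 2) * meanCurv G y ^ 2 := rfl
    have hlap := congrFun (lapS_congr_of_eqOn (G := G) hD hy hVW) β
    have hlap2 := congrFun (hG.sum_covS_covS_pull hn hD hDU hT hy) β
    rw [hG.tangentialThomas_inl hyU hn hV hw₁ hw₂, hlap, lapS, hlap2, hW, sum_TIdx]
    simp only [gam_inr_inr, der_zero_left, Pi.zero_apply, add_zero,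
      pull_thomasHat_inr_inr, pull_thomasHat_inl, p1, p2, p3,
      canonicalTractor, zero_mul, Finset.sum_const_zero, one_mul, zero_add, Pi.add_apply,
      Pi.sub_apply, Pi.smul_apply, smul_eq_mul, Finset.sum_apply]
    -- What remains is arithmetic in the coefficients: `1 - 2w/E = (n-2)/E` for `Γ_Y`, and `2(n+1) -
    -- (3n+2) = -n` for `wK / (2n(n-1))`. The `H²` term matches the entry `p3` of the projection.
    obtain ⟨E, hE⟩ : ∃ E, E = (n : ℝ) + 2 * w - 2 := ⟨_, rfl⟩
    rw [← hE] at hw₂ ⊢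
    field_simp
    subst hE
    ring
  · have e : tangentialThomas G w V y (Fin.cons (.inr (.inl a)) β)
        = tractorNabla G a V (slice y) β - normalTractorLow G y (.inr (.inl a)) *
          ∑ B, normalTractor G y B * thomasHat G w V (slice y) (Fin.cons B β)
          + 0 / ((n : ℝ) + 1 + 2 * w - 3) * ((∑ B, ∑ C, normalTractor G y B * normalTractor G y C *
          thomasHat G (w - 1) (thomasHat G w V) (slice y) (Fin.cons B (Fin.cons C β)))
          + w * rigidity G y / ((n : ℝ) + 1 - 2) * V (slice y) β) := rfl
    -- Removing the normal derivative is exactly the effect of `-N_A N^B D̂_B`, up to the term `H w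
    -- V` that the `X` slot of the projection accounts for.
    have h2 := hG.sum_projM_mul hyU (fun b => tractorNabla G b V (slice y) β) a
    have h3 : ∑ b, normal G y b * tractorNabla G b V (slice y) β = nablaN G V y β := by
      simp only [nablaN, Finset.sum_apply, Pi.smul_apply, smul_eq_mul]
    rw [h3] at h2
    simp only [hN, Pi.add_apply] at h2
    have p1 : projM G y (.inl ()) (.inr (.inl a)) = 0 := rfl
    have p3 : projM G y (.inr (.inr ())) (.inr (.inl a))
      = meanCurv G y * conormal G (slice y) a := rfl
    rw [e, zero_div, zero_mul, add_zero, sum_normalTractor_thomasHat,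
      hG.normalTractorLow_inr_inl hyU, sum_TIdx]
    simp only [pull_thomasHat_inr_inr, pull_thomasHat_inr_inl, gam_inr_inr,
      der_zero_left, Pi.zero_apply, add_zero, zero_div, zero_mul, canonicalTractor, sub_zero, p1, p3,
      zero_add, Pi.smul_apply, smul_eq_mul, hW]
    rw [show (∑ i, projM G y (.inr (.inl i)) (.inr (.inl a)) *
        (pull (projM G y) (tractorNabla (inducedMetric G) i T y) β
          + der (gam G y (.inr (.inl i)) * metricM (G (slice y))⁻¹)
            (pull (projM G y) (T y)) β)) = _ from h2]
    ring
  · have e : tangentialThomas G w V y (Fin.cons (.inr (.inr ())) β)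
        = w * V (slice y) β - normalTractorLow G y (.inr (.inr ())) *
          ∑ B, normalTractor G y B * thomasHat G w V (slice y) (Fin.cons B β)
          + 0 / ((n : ℝ) + 1 + 2 * w - 3) * ((∑ B, ∑ C, normalTractor G y B * normalTractor G y C *
          thomasHat G (w - 1) (thomasHat G w V) (slice y) (Fin.cons B (Fin.cons C β)))
          + w * rigidity G y / ((n : ℝ) + 1 - 2) * V (slice y) β) := rfl
    have p1 : projM G y (.inl ()) (.inr (.inr ‹Unit›)) = 0 := rfl
    have p2 : ∀ i, projM G y (.inr (.inl i)) (.inr (.inr ‹Unit›)) = 0 := fun _ => rfl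
    have p3 : projM G y (.inr (.inr ())) (.inr (.inr ‹Unit›)) = 1 := rfl
    rw [e, zero_div, zero_mul, add_zero, normalTractorLow_inr_inr, zero_mul, sum_TIdx, hW]
    simp only [pull_thomasHat_inr_inr, gam_inr_inr, der_zero_left, Pi.zero_apply,
      add_zero, zero_div, zero_mul, canonicalTractor, sub_zero, p1, p2, p3, zero_add, one_mul, Finset.sum_const_zero, Pi.smul_apply, smul_eq_mul]

end MetricOn

end LocalTheorem

/-! ### Smoothness and positivity of chart components -/

section ManifoldReduction

variable {m : ℕ} {M : Type*} [TopologicalSpace M] [ChartedSpace (Coord m) M]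
  [IsManifold (𝓡 m) ∞ M] {φ : OpenPartialHomeomorph M (Coord m)}

/-- A coordinate field is the tangent map of the inverse chart applied to a constant, hence smooth,
vector field. -/
theorem contMDiffAt_coordinateField (hφ : φ ∈ IsManifold.maximalAtlas (𝓡 m) ∞ M) {x : Coord m}
    (hx : x ∈ φ.target) (e : Coord m) :
    ContMDiffAt (𝓡 m) ((𝓡 m).prod 𝓘(ℝ, Coord m)) ∞
      (fun z => (Bundle.TotalSpace.mk' (Coord m) (φ.symm z) (mfderiv (𝓡 m) (𝓡 m) φ.symm z e) :
        TangentBundle (𝓡 m) M)) x := by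
  have h1 := (contMDiffOn_symm_of_mem_maximalAtlas hφ).contMDiffOn_tangentMapWithin (m := ∞)
    (by simp) φ.open_target.uniqueMDiffOn
  have h2 : ContMDiffAt (𝓡 m) ((𝓡 m).prod 𝓘(ℝ, Coord m)) ∞
      (fun z => (Bundle.TotalSpace.mk' (Coord m) z e : TangentBundle (𝓡 m) (Coord m))) x :=
    contMDiffAt_vectorSpace_iff_contDiffAt.2 contDiffAt_const
  have hmem : Bundle.TotalSpace.proj ⁻¹' φ.target ∈
      nhds (Bundle.TotalSpace.mk' (Coord m) x e : TangentBundle (𝓡 m) (Coord m)) :=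
    (φ.open_target.preimage (FiberBundle.continuous_proj _ _)).mem_nhds hx
  have h3 := (h1.contMDiffAt hmem).comp x h2
  refine h3.congr_of_eventuallyEq ?_
  filter_upwards [φ.open_target.mem_nhds hx] with z hz
  simp only [Function.comp, tangentMapWithin, mfderivWithin_of_isOpen φ.open_target hz]

theorem contDiffAt_comp (g : RMetric m M) (hφ : φ ∈ IsManifold.maximalAtlas (𝓡 m) ∞ M)
    {x : Coord m} (hx : x ∈ φ.target) (i j : Fin m) :
    ContDiffAt ℝ ∞ (fun z => g.comp φ z i j) x := by
  rw [← contMDiffAt_iff_contDiffAt]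
  have hb := contMDiffAt_symm_of_mem_maximalAtlas hφ hx
  have : ContMDiffAt (𝓡 m) ((𝓡 m).prod 𝓘(ℝ)) ∞
      (fun z => Bundle.TotalSpace.mk' ℝ (E := Bundle.Trivial M ℝ) (φ.symm z)
        (g.inner (φ.symm z) (mfderiv (𝓡 m) (𝓡 m) φ.symm z (EuclideanSpace.single i (1 : ℝ)))
          (mfderiv (𝓡 m) (𝓡 m) φ.symm z (EuclideanSpace.single j (1 : ℝ))))) x := by
    apply ContMDiffAt.clm_bundle_apply₂ (F₁ := Coord m) (F₂ := Coord m)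
    · exact g.contMDiff.contMDiffAt.comp x hb
    · exact contMDiffAt_coordinateField hφ hx _
    · exact contMDiffAt_coordinateField hφ hx _
  rw [Bundle.contMDiffAt_totalSpace] at this
  exact this.2

/-- The quadratic form of the component matrix is `g` evaluated on the image under the differential
of the inverse chart, which is injective. -/
theorem posDef_comp (g : RMetric m M) (hφ : φ ∈ IsManifold.maximalAtlas (𝓡 m) ∞ M)
    {x : Coord m} (hx : x ∈ φ.target) : (g.comp φ x).PosDef := by
  have hd : φ.symm.MDifferentiable (𝓡 m) (𝓡 m) :=
    ⟨(contMDiffOn_symm_of_mem_maximalAtlas hφ).mdifferentiableOn (by simp),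
      (contMDiffOn_of_mem_maximalAtlas hφ).mdifferentiableOn (by simp)⟩
  have hinj := hd.mfderiv_injective hx
  have key : ∀ v : Fin m → ℝ, star v ⬝ᵥ (g.comp φ x *ᵥ v)
      = g.inner (φ.symm x) (mfderiv (𝓡 m) (𝓡 m) φ.symm x (WithLp.toLp 2 v))
        (mfderiv (𝓡 m) (𝓡 m) φ.symm x (WithLp.toLp 2 v)) := by
    intro v
    have hv : (WithLp.toLp 2 v : Coord m) = ∑ i, v i • EuclideanSpace.single i (1 : ℝ) := by
      ext k
      simp [Pi.single_apply]
    have hL : mfderiv (𝓡 m) (𝓡 m) φ.symm x (WithLp.toLp 2 v : Coord m)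
        = ∑ i, v i • mfderiv (𝓡 m) (𝓡 m) φ.symm x (EuclideanSpace.single i (1 : ℝ)) := by
      rw [hv]
      exact (map_sum (mfderiv (𝓡 m) (𝓡 m) φ.symm x) _ _).trans
        (Finset.sum_congr rfl fun i _ => map_smul (mfderiv (𝓡 m) (𝓡 m) φ.symm x) _ _)
    rw [hL]
    simp only [map_sum, map_smul, dotProduct, Matrix.mulVec, star_trivial, Finset.mul_sum,
      FunLike.coe_sum, Finset.sum_apply, _root_.smul_apply, smul_eq_mul]
    rw [Finset.sum_comm]
    refine Finset.sum_congr rfl fun i _ => Finset.sum_congr rfl fun j _ => ?_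
    simp only [RMetric.comp, Matrix.of_apply]
    ring
  refine Matrix.PosDef.of_dotProduct_mulVec_pos ?_ fun v hv => ?_
  · ext i j
    simp only [Matrix.conjTranspose_apply, star_trivial, RMetric.comp, Matrix.of_apply]
    exact g.symm _ _ _
  · rw [key]
    refine g.pos _ _ fun h0 => hv ?_
    have := hinj (h0.trans (map_zero (mfderiv (𝓡 m) (𝓡 m) φ.symm x)).symm)
    funext k
    exact congrArg (fun z : Coord m => z k) this

theorem metricOn_comp (g : RMetric m M) (hφ : φ ∈ IsManifold.maximalAtlas (𝓡 m) ∞ M) :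
    MetricOn (g.comp φ) φ.target where
  isOpen := φ.open_target
  posDef _ hx := posDef_comp g hφ hx
  smooth _ hx i j := contDiffAt_comp g hφ hx i j

theorem TractorField.vsmooth_comp {c : ConformalClass m M} {r : ℕ} {w : ℝ}
    (T : TractorField c r w) (g : c.metrics) (hφ : φ ∈ IsManifold.maximalAtlas (𝓡 m) ∞ M)
    {x : Coord m} (hx : x ∈ φ.target) : VSmooth (T.comp g φ) x := fun β =>
  (T.smooth g φ hφ β).contDiffAt (φ.open_target.mem_nhds hx)

theorem IsAdapted.slice_mem {n : ℕ} {M S : Type*} [TopologicalSpace M]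
    [ChartedSpace (Coord (n + 1)) M] [IsManifold (𝓡 (n + 1)) ∞ M] [TopologicalSpace S]
    [ChartedSpace (Coord n) S] [IsManifold (𝓡 n) ∞ S] {ι : S → M}
    {φ : OpenPartialHomeomorph M (Coord (n + 1))} {ψ : OpenPartialHomeomorph S (Coord n)}
    (h : IsAdapted ι φ ψ) {y : Coord n} (hy : y ∈ ψ.target) : slice y ∈ φ.target := by
  have hs := ψ.map_target hy
  have := φ.map_source (h.maps _ hs)
  rwa [h.eq_slice _ hs, ψ.right_inv hy] at this

end ManifoldReduction

end GaussThomas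

end

theorem mainTheorem2 {n : ℕ} (hn : 3 ≤ n)
    {M : Type*} [TopologicalSpace M] [ChartedSpace (Coord (n + 1)) M]
    [IsManifold (𝓡 (n + 1)) ∞ M]
    {S : Type*} [TopologicalSpace S] [ChartedSpace (Coord n) S] [IsManifold (𝓡 n) ∞ S]
    (c : ConformalClass (n + 1) M) (cbar : ConformalClass n S)
    (ι : S → M) (hι : Manifold.IsSmoothEmbedding (𝓡 n) (𝓡 (n + 1)) ∞ ι)
    (hc : IsInducedClass ι c cbar)
    (w : ℝ) (hw₁ : w + (n + 1 : ℝ) / 2 ≠ 1) (hw₂ : w + (n + 1 : ℝ) / 2 ≠ 3 / 2)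
    (hw₃ : w + (n + 1 : ℝ) / 2 ≠ 2)
    (r : ℕ) (T : TractorField cbar r w) (V : TractorField c r w) (hV : IsExtension ι T V)
    (g : c.metrics) (gbar : cbar.metrics) (hg : IsInducedMetric ι g.1 gbar.1)
    (φ : OpenPartialHomeomorph M (Coord (n + 1))) (ψ : OpenPartialHomeomorph S (Coord n))
    (hφψ : IsAdapted ι φ ψ) (y : Coord n) (hy : y ∈ ψ.target) :
    tangentialThomas (g.1.comp φ) w (V.comp g φ) y
      = gaussThomas (g.1.comp φ) w (T.comp gbar ψ) y :=
  (metricOn_comp g.1 hφψ.mem_left).tangentialThomas_eq_gaussThomas hn ψ.open_target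
    (fun _ hz => hφψ.slice_mem hz) (fun _ hx => V.vsmooth_comp g hφψ.mem_left hx)
    (fun _ hz => T.vsmooth_comp gbar hφψ.mem_right hz)
    -- With `d = n + 1` the excluded values `1` and `3/2` of `w + d/2` are the zeros of the ambient
    -- denominator `n + 2w - 1` and of the intrinsic one `n + 2w - 2`.
    (fun z hz => hV g gbar hg φ ψ hφψ z hz) (fun h => hw₁ (by linarith))
    (fun h => hw₂ (by linarith)) hy
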